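/- Let $n\ge 1$ and equip $\mathbb R^{2n}=\mathbb R^n_q\times\mathbb R^n_p$ with the standard inner product $\langle\cdot,\cdot\rangle$, the symplectic form $\omega=\sum dq_i\wedge dp_i$ and $J(q,p)=(-p,q)$. A convex body is a compact convex set with non-empty interior. For a loop $\gamma:\mathbb R/2\pi\mathbb Z\to\mathbb R^{2n}$ let $A(\gamma)=\frac12\int_0^{2\pi}\langle J\gamma(t),\dot\gamma(t)\rangle\,dt$. For a convex body $\Sigma'$ with smooth boundary, a closed characteristic is an embedded circle in $\partial\Sigma'$ which is tangent to the line bundle $\ker(\omega|_{\partial\Sigma'})$, and $c_{EHZ}(\Sigma')$ is the minimum of $|A(\gamma)|$ over all closed characteristics $\gamma$ on $\partial\Sigma'$. For an arbitrary convex body $\Sigma\subset\mathbb R^{2n}$ put $$\widetilde c_{EHZ}(\Sigma)=\inf\{c_{EHZ}(\Sigma') : \Sigma'\supseteq\Sigma \text{ a convex body with smooth boundary}\}.$$ Let $h_\Sigma(u)=\sup\{\langle x,u\rangle : x\in\Sigma\}$, let $N_\Sigma(x)=\{u : \langle u,x-y\rangle\ge 0 \text{ for all } y\in\Sigma\}$,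 and let $\mathcal E$ be the set of absolutely continuous $2\pi$-periodic $z:\mathbb R\to\mathbb R^{2n}$ with $\dot z\in L^2(0,2\pi)$, $\int_0^{2\pi}z\,dt=0$ and $A(z)=1$. A generalized closed characteristic on $\partial\Sigma$ is (the image of) a non-constant continuous loop $\gamma:\mathbb R/2\pi\mathbb Z\to\partial\Sigma$ which is differentiable off a null set, has left and right derivatives $\dot\gamma^{\pm}(t)$ at every $t$, and satisfies $\dot\gamma^{\pm}(t)\in JN_\Sigma(\gamma(t))$ for every $t$ (the velocity may vanish at some times). Put $\widetilde{\mathcal L}(\Sigma)=\{|A(\gamma)| : \gamma \text{ a generalized closed characteristic on } \partial\Sigma\}$. Then for every convex body $\Sigma\subset\mathbb R^{2n}$, smooth or not, $\widetilde c_{EHZ}(\Sigma)$ is finite and $$\widetilde c_{EHZ}(\Sigma)=\min\widetilde{\mathcal L}(\Sigma),$$ and if moreover $0\in\operatorname{int}\Sigma$, then also $$\widetilde c_{EHZ}(\Sigma)=\min_{z\in\mathcal E}\frac{\pi}{2}\int_0^{2\pi}h_\Sigma^2(\dot z(t))\,dt .$$ In particular all the minima are attained. -/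

import Mathlib

open MeasureTheory Set
open scoped ContDiff

noncomputable section

/-- The Euclidean phase space `ℝ²ⁿ`: `x (Sum.inl i)` is the position coordinate `qᵢ` and
`x (Sum.inr i)` the momentum coordinate `pᵢ`. -/
abbrev PhaseSpace (n : ℕ) : Type := EuclideanSpace ℝ (Fin n ⊕ Fin n)

/-- The standard complex structure `J(q, p) = (-p, q)`. -/
def stdJ {n : ℕ} (x : PhaseSpace n) : PhaseSpace n :=
  WithLp.toLp 2 (Sum.elim (fun i => -x (Sum.inr i)) (fun i => x (Sum.inl i)))

/-- The standard symplectic form `∑ dqᵢ ∧ dpᵢ`. -/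
def stdOmega {n : ℕ} (x y : PhaseSpace n) : ℝ :=
  ∑ i : Fin n, (x (Sum.inl i) * y (Sum.inr i) - x (Sum.inr i) * y (Sum.inl i))

/-- A convex body: a compact convex set with non-empty interior. -/
def IsConvexBody {n : ℕ} (S : Set (PhaseSpace n)) : Prop :=
  Convex ℝ S ∧ IsCompact S ∧ (interior S).Nonempty

/-- `ρ` is a smooth function which near `x` defines `S` as a regular sublevel set `{ρ ≤ 0}`. -/
def IsLocalDefiningFunction {n : ℕ} (S : Set (PhaseSpace n)) (x : PhaseSpace n)
    (ρ : PhaseSpace n → ℝ) : Prop :=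
  ContDiff ℝ ∞ ρ ∧ ρ x = 0 ∧ fderiv ℝ ρ x ≠ 0 ∧
    ∃ U : Set (PhaseSpace n), IsOpen U ∧ x ∈ U ∧ ∀ y ∈ U, y ∈ S ↔ ρ y ≤ 0

/-- A convex body with smooth boundary. -/
def IsSmoothConvexBody {n : ℕ} (S : Set (PhaseSpace n)) : Prop :=
  IsConvexBody S ∧ ∀ x ∈ frontier S, ∃ ρ : PhaseSpace n → ℝ, IsLocalDefiningFunction S x ρ

/-- The tangent space of the (smooth) boundary of `S` at `x`: the kernel of the differential of a
local defining function (all of them have the same kernel at `x`). -/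
def boundaryTangentSpace {n : ℕ} (S : Set (PhaseSpace n)) (x : PhaseSpace n) :
    Set (PhaseSpace n) :=
  {v | ∀ ρ : PhaseSpace n → ℝ, IsLocalDefiningFunction S x ρ → fderiv ℝ ρ x v = 0}

/-- The fibre at `x` of the characteristic line bundle of the boundary of `S`. -/
def characteristicLine {n : ℕ} (S : Set (PhaseSpace n)) (x : PhaseSpace n) :
    Set (PhaseSpace n) :=
  {ξ | ξ ∈ boundaryTangentSpace S x ∧ ∀ η ∈ boundaryTangentSpace S x, stdOmega ξ η = 0}

/-- The action `A(γ) = ½ ∫₀^{2π} ⟨J γ(t), γ'(t)⟩ dt`. -/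
def loopAction {n : ℕ} (γ : ℝ → PhaseSpace n) : ℝ :=
  (1 / 2 : ℝ) * ∫ t in (0 : ℝ)..(2 * Real.pi), inner ℝ (stdJ (γ t)) (deriv γ t)

/-- `γ`, a `2π`-periodic function, parametrizes a closed characteristic on the smooth boundary of
`S`: an embedded circle tangent to the characteristic line bundle. -/
def IsClosedCharacteristic {n : ℕ} (S : Set (PhaseSpace n)) (γ : ℝ → PhaseSpace n) : Prop :=
  ContDiff ℝ ∞ γ ∧ Function.Periodic γ (2 * Real.pi) ∧
    InjOn γ (Ico 0 (2 * Real.pi)) ∧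
    ∀ t, deriv γ t ≠ 0 ∧ γ t ∈ frontier S ∧ deriv γ t ∈ characteristicLine S (γ t)

/-- The action spectrum of a convex body with smooth boundary. -/
def actionSpectrum {n : ℕ} (S : Set (PhaseSpace n)) : Set ℝ :=
  {a | ∃ γ : ℝ → PhaseSpace n, IsClosedCharacteristic S γ ∧ a = |loopAction γ|}

/-- The Ekeland-Hofer-Zehnder capacity of a convex body with smooth boundary: the least element of
the action spectrum. -/
def cEHZ {n : ℕ} (S : Set (PhaseSpace n)) : ENNReal :=
  ⨅ a ∈ actionSpectrum S, ENNReal.ofReal a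

/-- The extension of the Ekeland-Hofer-Zehnder capacity to all convex bodies: the infimum of the
capacities of the convex bodies with smooth boundary that contain `S`. -/
def cEHZExt {n : ℕ} (S : Set (PhaseSpace n)) : ENNReal :=
  ⨅ (S' : Set (PhaseSpace n)) (_ : IsSmoothConvexBody S' ∧ S ⊆ S'), cEHZ S'

/-- The support function `h_S(u) = sup {⟨x, u⟩ : x ∈ S}`. -/
def supportFn {n : ℕ} (S : Set (PhaseSpace n)) (u : PhaseSpace n) : ℝ :=
  sSup ((fun x : PhaseSpace n => (inner ℝ x u : ℝ)) '' S)

/-- The loop space `𝓔`: absolutely continuous `2π`-periodic functions with square integrable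
derivative, with mean zero and action one. -/
def loopSpace (n : ℕ) : Set (ℝ → PhaseSpace n) :=
  {z | Function.Periodic z (2 * Real.pi) ∧
    AbsolutelyContinuousOnInterval z 0 (2 * Real.pi) ∧
    MemLp (deriv z) 2 (volume.restrict (Ioc 0 (2 * Real.pi))) ∧
    (∫ t in (0 : ℝ)..(2 * Real.pi), z t) = 0 ∧ loopAction z = 1}

/-- The functional `I_S(z) = ∫₀^{2π} h_S(z'(t))² dt`. -/
def dualFunctional {n : ℕ} (S : Set (PhaseSpace n)) (z : ℝ → PhaseSpace n) : ℝ :=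
  ∫ t in (0 : ℝ)..(2 * Real.pi), supportFn S (deriv z t) ^ 2

/-- The outward normal cone of `S` at `x`. -/
def normalCone {n : ℕ} (S : Set (PhaseSpace n)) (x : PhaseSpace n) : Set (PhaseSpace n) :=
  {u | ∀ y ∈ S, 0 ≤ (inner ℝ u (x - y) : ℝ)}

/-- `γ`, a `2π`-periodic function, parametrizes a generalized closed characteristic on the boundary
of `S`: a non-constant continuous loop in the boundary, differentiable off a null set, which at
every time has a left and a right derivative, both in `J N_S(γ(t))`. -/
def IsGenClosedCharacteristic {n : ℕ} (S : Set (PhaseSpace n)) (γ : ℝ → PhaseSpace n) : Prop :=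
  Continuous γ ∧ Function.Periodic γ (2 * Real.pi) ∧ (∃ s t, γ s ≠ γ t) ∧
    (∀ t, γ t ∈ frontier S) ∧
    (∃ F : Set ℝ, volume F = 0 ∧ ∀ t ∉ F, DifferentiableAt ℝ γ t) ∧
    ∀ t, (∃ v ∈ stdJ '' normalCone S (γ t), HasDerivWithinAt γ v (Iio t) t) ∧
      (∃ v ∈ stdJ '' normalCone S (γ t), HasDerivWithinAt γ v (Ioi t) t)

/-- The generalized action spectrum of a convex body. -/
def genActionSpectrum {n : ℕ} (S : Set (PhaseSpace n)) : Set ℝ :=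
  {a | ∃ γ : ℝ → PhaseSpace n, IsGenClosedCharacteristic S γ ∧ a = |loopAction γ|}

end

/-! ### The complex structure -/

section ComplexStructure

variable {n : ℕ}

/-! Every quantity in the theorem is computed from one maximization. Translate so that
$0\in\operatorname{int}\Sigma$, and let $a$ be the largest action of a $2\pi$-periodic loop based at
the origin whose velocity $u$ satisfies $h_\Sigma(u)\le 1$ (`unitSpeedLoops`). These loops are
uniformly Lipschitz and form a compact set for pointwise convergence, on which the action is
continuous. So $a$ is attained, and a small circle shows $a>0$. The common value is $\pi^2/a$.

Parametrizing by $h_\Sigma$-length turns maximality into an isoperimetric inequality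
(`integral_inner_stdJ_le`): a closed curve of $h_\Sigma$-length $\ell$ has action at most
$a(\ell/2\pi)^2$. With Cauchy-Schwarz this bounds the dual functional from below, with equality at a
rescaled maximizer (`isLeast_dualFunctional`). If $\dot\gamma=J\nu$ with $\nu$ normal, then
$\langle\gamma,\nu\rangle=h_\Sigma(\nu)$, so the action of $\gamma$ is half the $h_\Sigma$-length of
$-J\gamma$. Since $-J\gamma$ has the same action as $\gamma$, that action is at least $\pi^2/a$
(`genClosedCharacteristic_lower_bound`).

Conversely, let $\Gamma$ be a maximizer and $c$ the Lagrange multiplier of the closing condition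
$\int\dot\Gamma=0$. The curve $y=J\Gamma+c$ has constant gauge with respect to $\Sigma$, and after
rescaling it runs in $\partial\Sigma$ and satisfies the inclusion almost everywhere with action
$\pi^2/a$ (`exists_isWeakCharacteristic`). To get derivatives at every time, it is reparametrized by
an everywhere differentiable homeomorphism whose derivative vanishes wherever its value is an
exceptional time (`exists_differentiable_homeomorph_deriv_eq_zero`).

For the capacity, a closed characteristic on a smooth $\Sigma'\supseteq\Sigma$ is a generalized one
up to orientation, and $a$ decreases as the body grows; this gives $\ge$ (`le_cEHZExt`). For $\le$,
mollify the gauge to get a smooth body between $\Sigma$ and $\lambda\Sigma$. There the weak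
characteristic solves a smooth autonomous equation, so it covers an embedded closed characteristic
of action at most $\lambda^2\pi^2/a$ (`cEHZExt_le_of_one_lt`); then let $\lambda\to1$. -/

theorem stdJ_inl (x : PhaseSpace n) (i : Fin n) : stdJ x (Sum.inl i) = -x (Sum.inr i) := rfl

theorem stdJ_inr (x : PhaseSpace n) (i : Fin n) : stdJ x (Sum.inr i) = x (Sum.inl i) := rfl

/-- The complex structure as a continuous linear map. -/
noncomputable def stdJL (n : ℕ) : PhaseSpace n →L[ℝ] PhaseSpace n :=
  LinearMap.toContinuousLinearMap
    { toFun := stdJ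
      map_add' := fun x y => by
        ext i; cases i <;> simp [stdJ_inl, stdJ_inr, add_comm]
      map_smul' := fun c x => by
        ext i; cases i <;> simp [stdJ_inl, stdJ_inr] }

theorem stdJ_add (x y : PhaseSpace n) : stdJ (x + y) = stdJ x + stdJ y := map_add (stdJL n) x y

theorem stdJ_sub (x y : PhaseSpace n) : stdJ (x - y) = stdJ x - stdJ y := map_sub (stdJL n) x y

theorem stdJ_neg (x : PhaseSpace n) : stdJ (-x) = -stdJ x := map_neg (stdJL n) x

theorem stdJ_smul (c : ℝ) (x : PhaseSpace n) : stdJ (c • x) = c • stdJ x :=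
  map_smul (stdJL n) c x

theorem stdJ_zero : stdJ (0 : PhaseSpace n) = 0 := map_zero (stdJL n)

theorem continuous_stdJ : Continuous (stdJ : PhaseSpace n → PhaseSpace n) := (stdJL n).continuous

theorem stdJ_stdJ (x : PhaseSpace n) : stdJ (stdJ x) = -x := by
  ext i; cases i <;> simp [stdJ_inl, stdJ_inr]

theorem inner_eq_sum_sum (x y : PhaseSpace n) : (inner ℝ x y : ℝ) =
    ∑ i : Fin n, (x (Sum.inl i) * y (Sum.inl i)) + ∑ i : Fin n, (x (Sum.inr i) * y (Sum.inr i)) := by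
  simp [PiLp.inner_apply, mul_comm]

theorem inner_stdJ_stdJ (x y : PhaseSpace n) :
    (inner ℝ (stdJ x) (stdJ y) : ℝ) = inner ℝ x y := by
  simp [inner_eq_sum_sum, stdJ_inl, stdJ_inr, add_comm]

theorem inner_stdJ_left (x y : PhaseSpace n) :
    (inner ℝ (stdJ x) y : ℝ) = -inner ℝ x (stdJ y) := by
  rw [← inner_stdJ_stdJ x (stdJ y), stdJ_stdJ, inner_neg_right, neg_neg]

theorem inner_stdJ_self (x : PhaseSpace n) : (inner ℝ (stdJ x) x : ℝ) = 0 := by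
  have h := inner_stdJ_left x x
  rw [real_inner_comm] at h
  rw [real_inner_comm]
  linarith

theorem norm_stdJ (x : PhaseSpace n) : ‖stdJ x‖ = ‖x‖ := by
  rw [← sq_eq_sq₀ (norm_nonneg _) (norm_nonneg _), ← real_inner_self_eq_norm_sq,
    ← real_inner_self_eq_norm_sq, inner_stdJ_stdJ]

theorem stdOmega_eq_inner (x y : PhaseSpace n) : stdOmega x y = inner ℝ (stdJ x) y := by
  simp only [stdOmega, inner_eq_sum_sum, stdJ_inl, stdJ_inr, ← Finset.sum_add_distrib]
  exact Finset.sum_congr rfl fun i _ => by ring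

end ComplexStructure

/-! ### Support functions and polar bodies -/

section Support

variable {n : ℕ} {S : Set (PhaseSpace n)}

/-- A convex body containing the origin in its interior. -/
def IsCenteredBody (S : Set (PhaseSpace n)) : Prop :=
  Convex ℝ S ∧ IsCompact S ∧ (0 : PhaseSpace n) ∈ interior S

theorem IsCenteredBody.zero_mem (hS : IsCenteredBody S) : (0 : PhaseSpace n) ∈ S :=
  interior_subset hS.2.2

theorem IsCenteredBody.isConvexBody (hS : IsCenteredBody S) : IsConvexBody S :=
  ⟨hS.1, hS.2.1, 0, hS.2.2⟩

theorem IsCenteredBody.exists_closedBall_subset (hS : IsCenteredBody S) :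
    ∃ r > 0, Metric.closedBall (0 : PhaseSpace n) r ⊆ S :=
  Metric.nhds_basis_closedBall.mem_iff.1 (mem_interior_iff_mem_nhds.1 hS.2.2)

theorem IsCenteredBody.exists_norm_le (hS : IsCenteredBody S) : ∃ R > 0, ∀ x ∈ S, ‖x‖ ≤ R :=
  hS.2.1.isBounded.exists_pos_norm_le

theorem bddAbove_inner_image (hS : IsCompact S) (u : PhaseSpace n) :
    BddAbove ((fun x : PhaseSpace n => (inner ℝ x u : ℝ)) '' S) :=
  (hS.image (by fun_prop)).bddAbove

theorem inner_le_supportFn (hS : IsCompact S) {x : PhaseSpace n} (hx : x ∈ S) (u : PhaseSpace n) :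
    (inner ℝ x u : ℝ) ≤ supportFn S u :=
  le_csSup (bddAbove_inner_image hS u) ⟨x, hx, rfl⟩

theorem supportFn_le (hS : S.Nonempty) {u : PhaseSpace n} {c : ℝ}
    (h : ∀ x ∈ S, (inner ℝ x u : ℝ) ≤ c) : supportFn S u ≤ c := by
  refine csSup_le (hS.image _) ?_
  rintro _ ⟨x, hx, rfl⟩
  exact h x hx

theorem exists_inner_eq_supportFn (hS : IsCompact S) (hne : S.Nonempty) (u : PhaseSpace n) :
    ∃ x ∈ S, (inner ℝ x u : ℝ) = supportFn S u := by
  obtain ⟨x, hx, h⟩ := hS.exists_isMaxOn hne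
    (f := fun x : PhaseSpace n => (inner ℝ x u : ℝ)) (by fun_prop)
  exact ⟨x, hx, le_antisymm (inner_le_supportFn hS hx u) (supportFn_le hne fun y hy => h hy)⟩

theorem supportFn_mono {S' : Set (PhaseSpace n)} (hS' : IsCompact S') (hne : S.Nonempty)
    (h : S ⊆ S') (u : PhaseSpace n) : supportFn S u ≤ supportFn S' u :=
  supportFn_le hne fun _ hx => inner_le_supportFn hS' (h hx) u

theorem supportFn_add_le (hS : IsCompact S) (hne : S.Nonempty) (u v : PhaseSpace n) :
    supportFn S (u + v) ≤ supportFn S u + supportFn S v := by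
  refine supportFn_le hne fun x hx => ?_
  rw [inner_add_right]
  exact add_le_add (inner_le_supportFn hS hx u) (inner_le_supportFn hS hx v)

theorem supportFn_smul (hS : IsCompact S) (hne : S.Nonempty) {c : ℝ} (hc : 0 ≤ c)
    (u : PhaseSpace n) : supportFn S (c • u) = c * supportFn S u := by
  obtain ⟨x, hx, h⟩ := exists_inner_eq_supportFn hS hne u
  refine le_antisymm (supportFn_le hne fun y hy => ?_) ?_
  · rw [inner_smul_right]
    exact mul_le_mul_of_nonneg_left (inner_le_supportFn hS hy u) hc
  · rw [← h, ← inner_smul_right]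
    exact inner_le_supportFn hS hx _

theorem supportFn_zero (hne : S.Nonempty) : supportFn S (0 : PhaseSpace n) = 0 := by
  have : (fun x : PhaseSpace n => (inner ℝ x (0 : PhaseSpace n) : ℝ)) '' S = {0} := by
    simp only [inner_zero_right]
    exact hne.image_const 0
  rw [supportFn, this, csSup_singleton]

theorem supportFn_le_mul_norm (hne : S.Nonempty) {R : ℝ} (hR : ∀ x ∈ S, ‖x‖ ≤ R)
    (u : PhaseSpace n) : supportFn S u ≤ R * ‖u‖ :=
  supportFn_le hne fun x hx => (real_inner_le_norm x u).trans
    (mul_le_mul_of_nonneg_right (hR x hx) (norm_nonneg u))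

theorem mul_norm_le_supportFn (hS : IsCompact S) {r : ℝ} (hr : 0 < r)
    (hrS : Metric.closedBall (0 : PhaseSpace n) r ⊆ S) (u : PhaseSpace n) :
    r * ‖u‖ ≤ supportFn S u := by
  rcases eq_or_ne u 0 with rfl | hu
  · rw [norm_zero, mul_zero, supportFn_zero ⟨0, hrS (by simp [hr.le])⟩]
  have hu' : ‖u‖ ≠ 0 := norm_ne_zero_iff.2 hu
  have hmem : (r / ‖u‖) • u ∈ S := hrS (by
    rw [mem_closedBall_zero_iff, norm_smul, norm_div, norm_norm, Real.norm_of_nonneg hr.le,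
      div_mul_cancel₀ _ hu'])
  have h := inner_le_supportFn hS hmem u
  rw [real_inner_smul_left, real_inner_self_eq_norm_sq] at h
  calc r * ‖u‖ = r / ‖u‖ * ‖u‖ ^ 2 := by field_simp
    _ ≤ _ := h

theorem supportFn_sub_le (hS : IsCompact S) (hne : S.Nonempty) {R : ℝ} (hR : ∀ x ∈ S, ‖x‖ ≤ R)
    (u v : PhaseSpace n) : supportFn S u - supportFn S v ≤ R * ‖u - v‖ := by
  have h1 := supportFn_add_le hS hne (u - v) v
  rw [sub_add_cancel] at h1
  linarith [supportFn_le_mul_norm hne hR (u - v)]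

theorem abs_supportFn_sub_le (hS : IsCompact S) (hne : S.Nonempty) {R : ℝ}
    (hR : ∀ x ∈ S, ‖x‖ ≤ R) (u v : PhaseSpace n) :
    |supportFn S u - supportFn S v| ≤ R * ‖u - v‖ := by
  refine abs_sub_le_iff.2 ⟨supportFn_sub_le hS hne hR u v, ?_⟩
  rw [norm_sub_rev]
  exact supportFn_sub_le hS hne hR v u

theorem lipschitzWith_supportFn (hS : IsCompact S) (hne : S.Nonempty) :
    ∃ C, LipschitzWith C (supportFn S) := by
  obtain ⟨R, hR0, hR⟩ := hS.isBounded.exists_pos_norm_le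
  refine ⟨⟨R, hR0.le⟩, LipschitzWith.of_dist_le_mul fun u v => ?_⟩
  rw [Real.dist_eq, dist_eq_norm]
  exact abs_supportFn_sub_le hS hne hR u v

theorem continuous_supportFn (hS : IsCompact S) (hne : S.Nonempty) : Continuous (supportFn S) := by
  obtain ⟨C, hC⟩ := lipschitzWith_supportFn hS hne
  exact hC.continuous

theorem convexOn_supportFn (hS : IsCompact S) (hne : S.Nonempty) :
    ConvexOn ℝ univ (supportFn S) := by
  refine ⟨convex_univ, fun u _ v _ a b ha hb _ => ?_⟩
  simpa [supportFn_smul hS hne ha, supportFn_smul hS hne hb] using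
    supportFn_add_le hS hne (a • u) (b • v)

namespace IsCenteredBody

variable (hS : IsCenteredBody S)
include hS

theorem supportFn_nonneg (u : PhaseSpace n) : 0 ≤ supportFn S u := by
  simpa using inner_le_supportFn hS.2.1 hS.zero_mem u

theorem supportFn_pos {u : PhaseSpace n} (hu : u ≠ 0) : 0 < supportFn S u := by
  obtain ⟨r, hr, hrS⟩ := hS.exists_closedBall_subset
  exact (mul_pos hr (norm_pos_iff.2 hu)).trans_le (mul_norm_le_supportFn hS.2.1 hr hrS u)

theorem eq_zero_of_supportFn_le_zero {u : PhaseSpace n} (hu : supportFn S u ≤ 0) : u = 0 := by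
  by_contra h
  exact (hS.supportFn_pos h).not_ge hu

end IsCenteredBody

/-- The polar body. -/
def polarBody (S : Set (PhaseSpace n)) : Set (PhaseSpace n) := {w | supportFn S w ≤ 1}

theorem IsCenteredBody.polarBody (hS : IsCenteredBody S) : IsCenteredBody (polarBody S) := by
  have hc := continuous_supportFn hS.2.1 ⟨0, hS.zero_mem⟩
  refine ⟨?_, Metric.isCompact_of_isClosed_isBounded (isClosed_le hc continuous_const) ?_, ?_⟩
  · simpa [_root_.polarBody] using (convexOn_supportFn hS.2.1 ⟨0, hS.zero_mem⟩).convex_le 1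
  · obtain ⟨r, hr, hrS⟩ := hS.exists_closedBall_subset
    refine (Metric.isBounded_closedBall (x := (0 : PhaseSpace n)) (r := 1 / r)).subset
      fun w hw => ?_
    rw [mem_closedBall_zero_iff, le_div_iff₀ hr, mul_comm]
    exact (mul_norm_le_supportFn hS.2.1 hr hrS w).trans hw
  · refine interior_mono (fun w (hw : supportFn S w < 1) => hw.le)
      ((isOpen_lt hc continuous_const).interior_eq.symm ▸ ?_)
    simp [supportFn_zero ⟨0, hS.zero_mem⟩]

/-- The bipolar theorem: the support function of the polar body is the gauge of `S`. A point outside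
is cut off by Hahn-Banach, and the separating functional, normalized to level one, lies in the
polar. -/
theorem IsCenteredBody.mem_iff_supportFn_polarBody_le (hS : IsCenteredBody S) {x : PhaseSpace n} :
    x ∈ S ↔ supportFn (_root_.polarBody S) x ≤ 1 := by
  constructor
  · intro hx
    refine supportFn_le ⟨0, hS.polarBody.zero_mem⟩ fun w hw => ?_
    rw [real_inner_comm]
    exact (inner_le_supportFn hS.2.1 hx w).trans hw
  · intro hx
    by_contra hxS
    obtain ⟨f, u, hu, hfx⟩ := geometric_hahn_banach_closed_point hS.1 hS.2.1.isClosed hxS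
    obtain ⟨w, rfl⟩ := (InnerProductSpace.toDual ℝ (PhaseSpace n)).surjective f
    simp only [InnerProductSpace.toDual_apply_apply] at hu hfx
    have hu0 : 0 < u := by simpa using hu 0 hS.zero_mem
    have hw : u⁻¹ • w ∈ _root_.polarBody S := by
      refine supportFn_le ⟨0, hS.zero_mem⟩ fun y hy => ?_
      rw [inner_smul_right, real_inner_comm, inv_mul_le_iff₀ hu0, mul_one]
      exact (hu y hy).le
    have h := (inner_le_supportFn hS.polarBody.2.1 hw x).trans hx
    rw [real_inner_smul_left, inv_mul_le_iff₀ hu0, mul_one] at h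
    linarith

/-- A normal vector at `x` is one whose linear functional is maximal over `S` at `x`; this turns the
action density of a characteristic into a support function. -/
theorem inner_eq_supportFn_of_mem_normalCone (hS : IsCompact S) {x u : PhaseSpace n} (hx : x ∈ S)
    (hu : u ∈ normalCone S x) : (inner ℝ x u : ℝ) = supportFn S u := by
  refine le_antisymm (inner_le_supportFn hS hx u) (supportFn_le ⟨x, hx⟩ fun y hy => ?_)
  have h := hu y hy
  rw [inner_sub_right, real_inner_comm, real_inner_comm y u] at h
  linarith

theorem mem_normalCone_of_supportFn_le (hS : IsCompact S) {x u : PhaseSpace n}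
    (hu : supportFn S u ≤ inner ℝ x u) : u ∈ normalCone S x := fun y hy => by
  have h := (inner_le_supportFn hS hy u).trans hu
  rw [inner_sub_right, real_inner_comm, real_inner_comm y u]
  linarith

theorem zero_mem_normalCone (S : Set (PhaseSpace n)) (x : PhaseSpace n) : 0 ∈ normalCone S x :=
  fun y _ => by simp

theorem smul_mem_normalCone {x u : PhaseSpace n} {c : ℝ} (hc : 0 ≤ c) (hu : u ∈ normalCone S x) :
    c • u ∈ normalCone S x := fun y hy => by
  rw [real_inner_smul_left]
  exact mul_nonneg hc (hu y hy)

theorem intervalIntegrable_clm_comp {E F : Type*} [NormedAddCommGroup E] [NormedSpace ℝ E]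
    [NormedAddCommGroup F] [NormedSpace ℝ F] (L : E →L[ℝ] F) {u : ℝ → E} {a b : ℝ}
    (hu : IntervalIntegrable u volume a b) : IntervalIntegrable (fun t => L (u t)) volume a b :=
  ⟨L.integrable_comp hu.1, L.integrable_comp hu.2⟩

/-- Jensen's inequality for a sublinear function: test against each point of `S`, then take the
supremum. -/
theorem supportFn_intervalIntegral_le (hS : IsCompact S) (hne : S.Nonempty) {u : ℝ → PhaseSpace n}
    {a b : ℝ} (hab : a ≤ b) (hu : IntervalIntegrable u volume a b)
    (hhu : IntervalIntegrable (fun t => supportFn S (u t)) volume a b) :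
    supportFn S (∫ t in a..b, u t) ≤ ∫ t in a..b, supportFn S (u t) := by
  refine supportFn_le hne fun x hx => ?_
  have h : (inner ℝ x (∫ t in a..b, u t) : ℝ) = ∫ t in a..b, inner ℝ x (u t) :=
    ((innerSL ℝ x).intervalIntegral_comp_comm hu).symm
  rw [h]
  exact intervalIntegral.integral_mono_on hab
    (intervalIntegrable_clm_comp (innerSL ℝ x) hu) hhu fun t _ => inner_le_supportFn hS hx _

theorem intervalIntegrable_supportFn (hS : IsCompact S) (hne : S.Nonempty) {u : ℝ → PhaseSpace n}
    {a b : ℝ} (hu : IntervalIntegrable u volume a b) :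
    IntervalIntegrable (fun t => supportFn S (u t)) volume a b := by
  obtain ⟨R, hR0, hR⟩ := hS.isBounded.exists_pos_norm_le
  have key : ∀ t, ‖supportFn S (u t)‖ ≤ ‖R * ‖u t‖‖ := fun t => by
    have := abs_supportFn_sub_le hS hne hR (u t) 0
    rw [supportFn_zero hne, sub_zero, sub_zero] at this
    exact this.trans (le_abs_self _)
  have hc := continuous_supportFn hS hne
  exact ⟨Integrable.mono (hu.norm.const_mul R).1 (hc.comp_aestronglyMeasurable hu.1.aestronglyMeasurable)
      (Filter.Eventually.of_forall key),
    Integrable.mono (hu.norm.const_mul R).2 (hc.comp_aestronglyMeasurable hu.2.aestronglyMeasurable)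
      (Filter.Eventually.of_forall key)⟩

end Support

/-! ### Absolutely continuous curves -/

section Curves

variable {n : ℕ}

theorem AbsolutelyContinuousOnInterval.clm_comp {E F : Type*} [NormedAddCommGroup E]
    [NormedSpace ℝ E] [NormedAddCommGroup F] [NormedSpace ℝ F] {f : ℝ → E} {a b : ℝ}
    (hf : AbsolutelyContinuousOnInterval f a b) (L : E →L[ℝ] F) :
    AbsolutelyContinuousOnInterval (fun t => L (f t)) a b := by
  have h := Filter.Tendsto.const_mul ‖L‖ (show Filter.Tendsto _ _ _ from hf)
  rw [mul_zero] at h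
  refine squeeze_zero (fun E => Finset.sum_nonneg fun i _ => dist_nonneg) (fun E => ?_) h
  rw [Finset.mul_sum]
  exact Finset.sum_le_sum fun i _ => L.dist_le_opNorm _ _

theorem AbsolutelyContinuousOnInterval.ae_hasDerivAt {f : ℝ → PhaseSpace n} {a b : ℝ}
    (hf : AbsolutelyContinuousOnInterval f a b) :
    ∀ᵐ t, t ∈ uIcc a b → HasDerivAt f (deriv f t) t := by
  filter_upwards [hf.boundedVariationOn.ae_differentiableAt_of_mem_uIcc] with t ht hmem
  exact (ht hmem).hasDerivAt

theorem norm_le_sum_abs_coord (x : PhaseSpace n) : ‖x‖ ≤ ∑ i, |x i| := by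
  conv_lhs => rw [← (EuclideanSpace.basisFun (Fin n ⊕ Fin n) ℝ).sum_repr x]
  refine (norm_sum_le _ _).trans (Finset.sum_le_sum fun i _ => ?_)
  simp [norm_smul]

/-- The coordinates are absolutely continuous real functions, and the sum of the absolute values of
their derivatives dominates the norm. -/
theorem AbsolutelyContinuousOnInterval.intervalIntegrable_deriv_phaseSpace
    {f : ℝ → PhaseSpace n} {a b : ℝ} (hf : AbsolutelyContinuousOnInterval f a b) :
    IntervalIntegrable (deriv f) volume a b := by
  have hc : ∀ i, AbsolutelyContinuousOnInterval (fun t => f t i) a b := fun i =>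
    hf.clm_comp (EuclideanSpace.proj i)
  have hint : IntervalIntegrable (fun t => ∑ i, |deriv (fun s => f s i) t|) volume a b := by
    have h := IntervalIntegrable.sum Finset.univ fun i (_ : i ∈ Finset.univ) =>
      (hc i).intervalIntegrable_deriv.abs
    rwa [show (∑ i, fun t => |deriv (fun s => f s i) t|) =
      fun t => ∑ i, |deriv (fun s => f s i) t| from by ext t; simp] at h
  refine hint.mono_fun (measurable_deriv f).aestronglyMeasurable ?_
  filter_upwards [ae_restrict_of_ae hf.ae_hasDerivAt, ae_restrict_mem measurableSet_uIoc]
    with t ht hmem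
  have h := ht (uIoc_subset_uIcc hmem)
  have hi : ∀ i, deriv (fun s => f s i) t = deriv f t i := fun i =>
    ((EuclideanSpace.proj (𝕜 := ℝ) i).hasFDerivAt.comp_hasDerivAt t h).deriv
  rw [Real.norm_of_nonneg (Finset.sum_nonneg fun i _ => abs_nonneg _)]
  simp only [hi]
  exact norm_le_sum_abs_coord _

theorem AbsolutelyContinuousOnInterval.integral_deriv_eq_sub_phaseSpace
    {f : ℝ → PhaseSpace n} {a b : ℝ} (hf : AbsolutelyContinuousOnInterval f a b) :
    ∫ t in a..b, deriv f t = f b - f a := by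
  ext i
  have hc : AbsolutelyContinuousOnInterval (fun t => f t i) a b :=
    hf.clm_comp (EuclideanSpace.proj i)
  have h1 : (∫ t in a..b, deriv f t) i = ∫ t in a..b, deriv f t i :=
    ((EuclideanSpace.proj (𝕜 := ℝ) i).intervalIntegral_comp_comm
      hf.intervalIntegrable_deriv_phaseSpace).symm
  rw [h1, PiLp.sub_apply, ← hc.integral_deriv_eq_sub]
  refine intervalIntegral.integral_congr_ae ?_
  filter_upwards [hf.ae_hasDerivAt] with t ht hmem
  exact ((EuclideanSpace.proj (𝕜 := ℝ) i).hasFDerivAt.comp_hasDerivAt t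
    (ht (uIoc_subset_uIcc hmem))).deriv.symm

theorem LipschitzWith.absolutelyContinuousOnInterval' {E : Type*} [PseudoMetricSpace E]
    {f : ℝ → E} {C : NNReal} (hf : LipschitzWith C f) (a b : ℝ) :
    AbsolutelyContinuousOnInterval f a b :=
  (hf.lipschitzOnWith (s := uIcc a b)).absolutelyContinuousOnInterval

theorem absolutelyContinuousOnInterval_inner {f g : ℝ → PhaseSpace n} {a b : ℝ}
    (hf : AbsolutelyContinuousOnInterval f a b) (hg : AbsolutelyContinuousOnInterval g a b) :
    AbsolutelyContinuousOnInterval (fun t => (inner ℝ (f t) (g t) : ℝ)) a b := by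
  have hsum : ∀ s : Finset (Fin n ⊕ Fin n),
      AbsolutelyContinuousOnInterval (fun t => ∑ i ∈ s, f t i * g t i) a b := by
    intro s
    induction s using Finset.induction_on with
    | empty =>
      simpa using (LipschitzWith.const (0 : ℝ)).absolutelyContinuousOnInterval' a b
    | insert i s hi ih =>
      simp only [Finset.sum_insert hi]
      exact ((hf.clm_comp (EuclideanSpace.proj i)).mul
        (hg.clm_comp (EuclideanSpace.proj i))).add ih
  convert hsum Finset.univ using 2 with t
  simp [PiLp.inner_apply, mul_comm]

theorem intervalIntegrable_inner_continuousOn {f u : ℝ → PhaseSpace n} {a b : ℝ}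
    (hf : ContinuousOn f (uIcc a b)) (hu : IntervalIntegrable u volume a b) :
    IntervalIntegrable (fun t => (inner ℝ (f t) (u t) : ℝ)) volume a b := by
  rw [intervalIntegrable_iff] at hu ⊢
  obtain ⟨C, hC⟩ := isCompact_uIcc.exists_bound_of_continuousOn hf
  refine Integrable.mono' (hu.norm.const_mul C) (((hf.mono uIoc_subset_uIcc).aestronglyMeasurable
    measurableSet_uIoc).inner hu.aestronglyMeasurable) ?_
  filter_upwards [ae_restrict_mem measurableSet_uIoc] with t ht
  exact (norm_inner_le_norm _ _).trans
    (mul_le_mul_of_nonneg_right (hC t (uIoc_subset_uIcc ht)) (norm_nonneg _))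

/-- Integration by parts for the inner product of absolutely continuous curves. -/
theorem integral_inner_deriv_eq {f g : ℝ → PhaseSpace n} {a b : ℝ}
    (hf : AbsolutelyContinuousOnInterval f a b) (hg : AbsolutelyContinuousOnInterval g a b) :
    ∫ t in a..b, (inner ℝ (f t) (deriv g t) : ℝ) =
      inner ℝ (f b) (g b) - inner ℝ (f a) (g a) - ∫ t in a..b, (inner ℝ (deriv f t) (g t) : ℝ) := by
  have h1 := intervalIntegrable_inner_continuousOn hf.continuousOn
    hg.intervalIntegrable_deriv_phaseSpace
  have h2 := intervalIntegrable_inner_continuousOn hg.continuousOn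
    hf.intervalIntegrable_deriv_phaseSpace
  simp only [fun t => real_inner_comm (deriv f t) (g t)] at h2
  rw [eq_sub_iff_add_eq, ← intervalIntegral.integral_add h1 h2,
    ← (absolutelyContinuousOnInterval_inner hf hg).integral_deriv_eq_sub]
  refine intervalIntegral.integral_congr_ae ?_
  filter_upwards [hf.ae_hasDerivAt, hg.ae_hasDerivAt] with t htf htg hmem
  exact ((htf (uIoc_subset_uIcc hmem)).inner ℝ (htg (uIoc_subset_uIcc hmem))).deriv.symm

/-- The action of a curve is approximated by that of inscribed polygons. -/
theorem abs_integral_inner_sub_sum_le {z u : ℝ → PhaseSpace n} {T : ℝ}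
    (hz : ContinuousOn z (Icc 0 T)) (hu : IntervalIntegrable u volume 0 T)
    (hzu : ∀ a ∈ Icc 0 T, ∀ b ∈ Icc 0 T, z b - z a = ∫ t in a..b, u t)
    {s : ℕ → ℝ} {N : ℕ} (hs : Monotone s) (h0 : s 0 = 0) (hN : s N = T) {ε : ℝ}
    (hε : ∀ i < N, ∀ t ∈ Icc (s i) (s (i + 1)), ‖z t - z (s i)‖ ≤ ε) :
    |(∫ t in (0 : ℝ)..T, (inner ℝ (stdJ (z t)) (u t) : ℝ)) -
      ∑ i ∈ Finset.range N, (inner ℝ (stdJ (z (s i))) (z (s (i + 1)) - z (s i)) : ℝ)| ≤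
      ε * ∫ t in (0 : ℝ)..T, ‖u t‖ := by
  have hmem : ∀ i ≤ N, s i ∈ Icc 0 T := fun i hi => ⟨h0 ▸ hs (Nat.zero_le i), hN ▸ hs hi⟩
  have hsub : ∀ i < N, uIcc (s i) (s (i + 1)) ⊆ uIcc 0 T := fun i hi => by
    rw [uIcc_of_le (hs (Nat.le_succ i)), uIcc_of_le ((hmem 0 N.zero_le).1.trans (hmem 0 N.zero_le).2)]
    exact Icc_subset_Icc (hmem i hi.le).1 (hmem (i + 1) hi).2
  have hT : (0 : ℝ) ≤ T := (hmem 0 N.zero_le).1.trans (hmem 0 N.zero_le).2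
  have hJz : ContinuousOn (fun t => stdJ (z t)) (uIcc 0 T) := by
    rw [uIcc_of_le hT]
    exact continuous_stdJ.comp_continuousOn hz
  have hint := intervalIntegrable_inner_continuousOn hJz hu
  have e1 := intervalIntegral.sum_integral_adjacent_intervals (a := s) (n := N)
    fun k hk => hint.mono_set (hsub k hk)
  have e2 := intervalIntegral.sum_integral_adjacent_intervals (a := s) (n := N)
    fun k hk => hu.norm.mono_set (hsub k hk)
  rw [h0, hN] at e1 e2
  rw [← e1, ← e2, ← Finset.sum_sub_distrib, Finset.mul_sum]
  refine (Finset.abs_sum_le_sum_abs _ _).trans (Finset.sum_le_sum fun i hi => ?_)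
  have hi' := Finset.mem_range.1 hi
  have hui := hu.mono_set (hsub i hi')
  -- On each piece the polygon term is the same integral with `z` frozen at the left node, so the
  -- error is at most `ε` times the integral of the speed.
  rw [hzu _ (hmem i hi'.le) _ (hmem (i + 1) hi')]
  have e3 : (inner ℝ (stdJ (z (s i))) (∫ t in s i..s (i + 1), u t) : ℝ) =
      ∫ t in s i..s (i + 1), (inner ℝ (stdJ (z (s i))) (u t) : ℝ) :=
    ((innerSL ℝ (stdJ (z (s i)))).intervalIntegral_comp_comm hui).symm
  rw [e3, ← intervalIntegral.integral_sub (hint.mono_set (hsub i hi'))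
    (intervalIntegrable_inner_continuousOn continuousOn_const hui),
    ← intervalIntegral.integral_const_mul, ← Real.norm_eq_abs]
  refine intervalIntegral.norm_integral_le_of_norm_le (hs (Nat.le_succ i)) ?_ (hui.norm.const_mul ε)
  refine Filter.Eventually.of_forall fun t ht => ?_
  rw [← inner_sub_left, ← stdJ_sub]
  refine (norm_inner_le_norm _ _).trans ?_
  rw [norm_stdJ]
  exact mul_le_mul_of_nonneg_right (hε i hi' t (Ioc_subset_Icc_self ht)) (norm_nonneg _)

end Curves

/-! ### The space of loops with velocity in the polar body -/

section UnitSpeedLoops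

variable {n : ℕ} {S : Set (PhaseSpace n)}

/-- The `2π`-periodic loops based at the origin whose velocity lies in the polar body of `S`. -/
def unitSpeedLoops (S : Set (PhaseSpace n)) : Set (ℝ → PhaseSpace n) :=
  {Γ | Γ 0 = 0 ∧ Function.Periodic Γ (2 * Real.pi) ∧
    ∀ a b, a ≤ b → supportFn S (Γ b - Γ a) ≤ b - a}

theorem IsCenteredBody.exists_lipschitz_unitSpeedLoops (hS : IsCenteredBody S) :
    ∃ C : NNReal, ∀ Γ ∈ unitSpeedLoops S, LipschitzWith C Γ := by
  obtain ⟨r, hr, hrS⟩ := hS.exists_closedBall_subset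
  have key : ∀ Γ ∈ unitSpeedLoops S, ∀ a b, a ≤ b → ‖Γ b - Γ a‖ ≤ r⁻¹ * (b - a) :=
    fun Γ hΓ a b hab => by
      rw [le_inv_mul_iff₀ hr]
      exact (mul_norm_le_supportFn hS.2.1 hr hrS _).trans (hΓ.2.2 a b hab)
  refine ⟨⟨r⁻¹, (inv_pos.2 hr).le⟩, fun Γ hΓ => LipschitzWith.of_dist_le_mul fun a b => ?_⟩
  rw [dist_eq_norm, Real.dist_eq]
  rcases le_total a b with hab | hab
  · rw [norm_sub_rev, abs_sub_comm, abs_of_nonneg (sub_nonneg.2 hab)]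
    exact key Γ hΓ a b hab
  · rw [abs_of_nonneg (sub_nonneg.2 hab)]
    exact key Γ hΓ b a hab

/-- Arzelà-Ascoli in the product topology: each defining condition involves finitely many values and
is closed, while the common Lipschitz constant and the base point place the loops in a product of
balls, compact by Tychonoff. -/
theorem IsCenteredBody.isCompact_unitSpeedLoops (hS : IsCenteredBody S) :
    IsCompact (unitSpeedLoops S) := by
  obtain ⟨C, hC⟩ := hS.exists_lipschitz_unitSpeedLoops
  have hcl : IsClosed (unitSpeedLoops S) := by
    have e : unitSpeedLoops S = {Γ | Γ 0 = 0} ∩ ((⋂ t : ℝ, {Γ | Γ (t + 2 * Real.pi) = Γ t}) ∩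
        ⋂ (a : ℝ) (b : ℝ) (_ : a ≤ b), {Γ | supportFn S (Γ b - Γ a) ≤ b - a}) := by
      ext Γ
      simp [unitSpeedLoops, Function.Periodic]
    rw [e]
    refine (isClosed_eq (continuous_apply 0) continuous_const).inter (IsClosed.inter ?_ ?_)
    · exact isClosed_iInter fun t => isClosed_eq (continuous_apply _) (continuous_apply _)
    · refine isClosed_iInter fun a => isClosed_iInter fun b => isClosed_iInter fun _ => ?_
      exact isClosed_le ((continuous_supportFn hS.2.1 ⟨0, hS.zero_mem⟩).comp
        ((continuous_apply b).sub (continuous_apply a))) continuous_const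
  refine (isCompact_univ_pi fun t : ℝ => isCompact_closedBall (0 : PhaseSpace n)
    (C * |t|)).of_isClosed_subset hcl fun Γ hΓ t _ => ?_
  have h := (hC Γ hΓ).dist_le_mul t 0
  rwa [hΓ.1, Real.dist_eq, sub_zero] at h

theorem two_pi_partition_monotone (N : ℕ) :
    Monotone fun i : ℕ => 2 * Real.pi * i / N := fun i j hij => by
  have : (i : ℝ) ≤ j := by exact_mod_cast hij
  have := Real.pi_pos
  dsimp only
  gcongr

theorem LipschitzWith.norm_deriv_le' {f : ℝ → PhaseSpace n} {C : NNReal} (hf : LipschitzWith C f)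
    (t : ℝ) : ‖deriv f t‖ ≤ C := norm_deriv_le_of_lipschitz hf

theorem LipschitzWith.sub_eq_integral_deriv {f : ℝ → PhaseSpace n} {C : NNReal}
    (hf : LipschitzWith C f) (a b : ℝ) : f b - f a = ∫ t in a..b, deriv f t :=
  (hf.absolutelyContinuousOnInterval' a b).integral_deriv_eq_sub_phaseSpace.symm

/-- The error depends on the loop only through its Lipschitz constant, so inscribed polygons
approximate the action uniformly over the whole compact class. -/
theorem LipschitzWith.abs_loopAction_sub_le {f : ℝ → PhaseSpace n} {C : NNReal}
    (hf : LipschitzWith C f) {N : ℕ} (hN : 0 < N) :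
    |loopAction f - 1 / 2 * ∑ i ∈ Finset.range N,
      (inner ℝ (stdJ (f (2 * Real.pi * (i : ℕ) / N)))
        (f (2 * Real.pi * (i + 1 : ℕ) / N) - f (2 * Real.pi * (i : ℕ) / N)) : ℝ)| ≤
      2 * Real.pi ^ 2 * C ^ 2 / N := by
  have hN' : (0 : ℝ) < N := by exact_mod_cast hN
  have hpi := Real.pi_pos
  have hd := (hf.absolutelyContinuousOnInterval' 0 (2 * Real.pi)).intervalIntegrable_deriv_phaseSpace
  have h := abs_integral_inner_sub_sum_le (T := 2 * Real.pi) (N := N) (ε := C * (2 * Real.pi / N))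
    hf.continuous.continuousOn hd
    (fun a _ b _ => hf.sub_eq_integral_deriv a b) (two_pi_partition_monotone N) (by simp)
    (by field_simp) (fun i _ t ht => by
      have h1 := hf.dist_le_mul t (2 * Real.pi * (i : ℕ) / N)
      rw [dist_eq_norm, Real.dist_eq, abs_of_nonneg (sub_nonneg.2 ht.1)] at h1
      refine h1.trans (mul_le_mul_of_nonneg_left ?_ C.2)
      have h2 : t ≤ 2 * Real.pi * (i + 1 : ℕ) / N := ht.2
      push_cast at h2
      rw [sub_le_iff_le_add]
      refine h2.trans_eq ?_
      ring)
  have h3 : ∫ t in (0 : ℝ)..(2 * Real.pi), ‖deriv f t‖ ≤ 2 * Real.pi * C := by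
    calc ∫ t in (0 : ℝ)..(2 * Real.pi), ‖deriv f t‖ ≤ ∫ t in (0 : ℝ)..(2 * Real.pi), (C : ℝ) :=
          intervalIntegral.integral_mono_on (by positivity) hd.norm (by simp)
            fun t _ => hf.norm_deriv_le' t
      _ = 2 * Real.pi * C := by simp
  rw [loopAction, ← mul_sub, abs_mul, abs_of_pos (by norm_num : (0 : ℝ) < 1 / 2)]
  calc _ ≤ 1 / 2 * (C * (2 * Real.pi / N) * ∫ t in (0 : ℝ)..(2 * Real.pi), ‖deriv f t‖) :=
        mul_le_mul_of_nonneg_left h (by norm_num)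
    _ ≤ 1 / 2 * (C * (2 * Real.pi / N) * (2 * Real.pi * C)) := by gcongr
    _ = _ := by ring

/-- The action involves derivatives, which pointwise limits do not control. The polygonal actions
depend on finitely many values, hence are continuous, and they converge uniformly. -/
theorem IsCenteredBody.continuousOn_loopAction (hS : IsCenteredBody S) :
    ContinuousOn loopAction (unitSpeedLoops S) := by
  obtain ⟨C, hC⟩ := hS.exists_lipschitz_unitSpeedLoops
  let F : ℕ → (ℝ → PhaseSpace n) → ℝ := fun N f => 1 / 2 * ∑ i ∈ Finset.range N,
      (inner ℝ (stdJ (f (2 * Real.pi * (i : ℕ) / N)))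
        (f (2 * Real.pi * (i + 1 : ℕ) / N) - f (2 * Real.pi * (i : ℕ) / N)) : ℝ)
  have hF : ∀ N, Continuous (F N) := fun N => by
    have hc : ∀ t : ℝ, Continuous fun f : ℝ → PhaseSpace n => f t := fun t => continuous_apply t
    refine continuous_const.mul (continuous_finsetSum _ fun i _ => ?_)
    exact (continuous_stdJ.comp (hc _)).inner ((hc _).sub (hc _))
  have hlim : TendstoUniformlyOn F loopAction Filter.atTop (unitSpeedLoops S) := by
    rw [Metric.tendstoUniformlyOn_iff]
    intro ε hε
    have h0 : Filter.Tendsto (fun N : ℕ => 2 * Real.pi ^ 2 * (C : ℝ) ^ 2 / N) Filter.atTop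
        (nhds 0) := tendsto_const_div_atTop_nhds_zero_nat _
    filter_upwards [h0.eventually (gt_mem_nhds hε), Filter.eventually_gt_atTop 0] with N hN hN0 f hf
    exact ((hC f hf).abs_loopAction_sub_le hN0).trans_lt hN
  exact hlim.continuousOn (Filter.Frequently.of_forall fun N => (hF N).continuousOn)

theorem zero_mem_unitSpeedLoops (hS : IsCenteredBody S) : 0 ∈ unitSpeedLoops S :=
  ⟨rfl, fun _ => rfl, fun a b hab => by
    simpa [supportFn_zero (⟨0, hS.zero_mem⟩ : S.Nonempty)] using hab⟩

theorem IsCenteredBody.exists_isGreatest_loopAction (hS : IsCenteredBody S) :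
    ∃ a, IsGreatest (loopAction '' unitSpeedLoops S) a :=
  (hS.isCompact_unitSpeedLoops.image_of_continuousOn hS.continuousOn_loopAction).exists_isGreatest
    ⟨_, mem_image_of_mem _ (zero_mem_unitSpeedLoops hS)⟩

theorem IsCenteredBody.exists_loopAction_pos (hn : 1 ≤ n) (hS : IsCenteredBody S) :
    ∃ Γ ∈ unitSpeedLoops S, 0 < loopAction Γ := by
  obtain ⟨R, hR0, hR⟩ := hS.exists_norm_le
  let e : PhaseSpace n := EuclideanSpace.single (Sum.inl ⟨0, hn⟩) 1
  have he : ‖e‖ = 1 := by simp [e]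
  have hee : (inner ℝ e e : ℝ) = 1 := by rw [real_inner_self_eq_norm_sq, he, one_pow]
  have hJee : (inner ℝ (stdJ e) e : ℝ) = 0 := inner_stdJ_self e
  have heJe : (inner ℝ e (stdJ e) : ℝ) = 0 := by rw [real_inner_comm, hJee]
  -- A circle in the plane of `e` and `stdJ e`. Its speed is crudely bounded by `ρ * 2`, and `S`
  -- lies in the ball of radius `R`, so this radius makes it admissible.
  let ρ : ℝ := 1 / (2 * R)
  have hρ : 0 < ρ := by positivity
  let Γ : ℝ → PhaseSpace n := fun t => ρ • ((Real.cos t - 1) • e + Real.sin t • stdJ e)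
  have hd : ∀ t, HasDerivAt Γ (ρ • ((-Real.sin t) • e + Real.cos t • stdJ e)) t := fun t =>
    ((((Real.hasDerivAt_cos t).sub_const 1).smul_const e).add
      ((Real.hasDerivAt_sin t).smul_const (stdJ e))).const_smul ρ
  refine ⟨Γ, ⟨by simp [Γ], fun t => by simp [Γ], fun a b hab => ?_⟩, ?_⟩
  · have h1 : ‖Γ b - Γ a‖ ≤ ρ * 2 * (b - a) := by
      have := Convex.norm_image_sub_le_of_norm_hasDerivWithin_le (f := Γ) (s := univ) (C := ρ * 2)
        (x := a) (y := b) (fun t _ => (hd t).hasDerivWithinAt) (fun t _ => ?_) convex_univ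
        (mem_univ _) (mem_univ _)
      · rwa [Real.norm_of_nonneg (sub_nonneg.2 hab)] at this
      · rw [norm_smul, Real.norm_of_nonneg hρ.le]
        refine mul_le_mul_of_nonneg_left ((norm_add_le _ _).trans ?_) hρ.le
        rw [norm_smul, norm_smul, norm_stdJ, he, norm_neg, mul_one, mul_one]
        exact (add_le_add (Real.abs_sin_le_one t) (Real.abs_cos_le_one t)).trans (by norm_num)
    calc supportFn S (Γ b - Γ a) ≤ R * ‖Γ b - Γ a‖ :=
          supportFn_le_mul_norm ⟨0, hS.zero_mem⟩ hR _
      _ ≤ R * (ρ * 2 * (b - a)) := by gcongr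
      _ = b - a := by simp only [ρ]; field_simp
  · have hint : ∀ t, (inner ℝ (stdJ (Γ t)) (deriv Γ t) : ℝ) = ρ ^ 2 * (1 - Real.cos t) := fun t => by
      rw [(hd t).deriv]
      simp only [Γ, stdJ_smul, stdJ_add, stdJ_stdJ, inner_add_left, inner_add_right,
        real_inner_smul_left, real_inner_smul_right, inner_neg_left, hee, hJee, heJe,
        inner_stdJ_stdJ]
      linear_combination ρ ^ 2 * Real.sin_sq_add_cos_sq t
    have hval : ∫ t in (0 : ℝ)..(2 * Real.pi), ρ ^ 2 * (1 - Real.cos t) = ρ ^ 2 * (2 * Real.pi) := by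
      rw [intervalIntegral.integral_const_mul, intervalIntegral.integral_sub (by simp)
        (Real.continuous_cos.intervalIntegrable _ _)]
      simp
    simp only [loopAction, hint, hval]
    have := Real.pi_pos
    positivity

end UnitSpeedLoops

/-! ### Lagrange multipliers -/

/-- A Lagrange multiplier rule for a convex set of pairs (value, constraint). -/
theorem exists_multiplier_of_convex {E : Type*} [NormedAddCommGroup E] [InnerProductSpace ℝ E]
    [FiniteDimensional ℝ E] {D : Set (ℝ × E)} (hD : Convex ℝ D) {p : ℝ}
    (hp0 : (p, (0 : E)) ∈ D) (hp : ∀ r, (r, (0 : E)) ∈ D → r ≤ p) {δ C : ℝ} (hδ : 0 < δ)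
    (hball : ∀ v : E, ‖v‖ < δ → ∃ r, -C ≤ r ∧ (r, v) ∈ D) :
    ∃ c : E, ∀ q ∈ D, q.1 + inner ℝ c q.2 ≤ p := by
  -- Separation needs interior, which `D` may lack. Adding everything below `D` supplies it, and
  -- `(p, 0)` stays outside the interior because `p` is maximal.
  let A : Set (ℝ × E) := {q | ∃ r, q.1 ≤ r ∧ (r, q.2) ∈ D}
  have hA : Convex ℝ A := by
    rintro ⟨r₁, v₁⟩ ⟨s₁, h₁, hD₁⟩ ⟨r₂, v₂⟩ ⟨s₂, h₂, hD₂⟩ a b ha hb hab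
    exact ⟨a * s₁ + b * s₂, add_le_add (mul_le_mul_of_nonneg_left h₁ ha)
      (mul_le_mul_of_nonneg_left h₂ hb), hD hD₁ hD₂ ha hb hab⟩
  have hint : ((-C - 1, 0) : ℝ × E) ∈ interior A := by
    refine mem_interior.2 ⟨Iio (-C) ×ˢ Metric.ball 0 δ, ?_, isOpen_Iio.prod Metric.isOpen_ball,
      by simp, by simpa using hδ⟩
    rintro ⟨r, v⟩ ⟨hr, hv⟩
    obtain ⟨s, hs, hsD⟩ := hball v (by simpa using hv)
    exact ⟨s, (le_of_lt hr).trans hs, hsD⟩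
  have hpA : ((p, 0) : ℝ × E) ∉ interior A := fun h => by
    obtain ⟨ε, hε, hsub⟩ := Metric.mem_nhds_iff.1 (mem_interior_iff_mem_nhds.1 h)
    have hmem : ((p + ε / 2, 0) : ℝ × E) ∈ A := hsub (by
      rw [Metric.mem_ball, Prod.dist_eq]
      simp [abs_of_pos hε, hε])
    obtain ⟨s, hs, hsD⟩ := hmem
    have := hp s hsD
    simp only at hs
    linarith
  obtain ⟨f, hf0, hf⟩ := geometric_hahn_banach_of_nonempty_interior_point hA hpA ⟨_, hint⟩
  have hsplit : ∀ (r : ℝ) (v : E), f (r, v) = r * f (1, 0) + f (0, v) := fun r v => by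
    rw [← smul_eq_mul, ← map_smul, ← map_add]
    simp
  have hα : 0 ≤ f (1, 0) := by
    have := hf (p - 1, 0) ⟨p, by simp, hp0⟩
    rw [hsplit (p - 1), hsplit p] at this
    linarith
  -- The separating hyperplane is not vertical: otherwise `f` would be nonpositive on a whole ball
  -- of constraint values, hence zero.
  have hα' : f (1, 0) ≠ 0 := fun h0 => hf0 (by
    have hle : ∀ v : E, ‖v‖ < δ → f (0, v) ≤ 0 := fun v hv => by
      obtain ⟨s, hs, hsD⟩ := hball v hv
      have := hf (s, v) ⟨s, le_rfl, hsD⟩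
      rw [hsplit s, hsplit p, h0, show ((0 : ℝ), (0 : E)) = 0 from rfl, map_zero] at this
      linarith
    have hzero : ∀ v : E, f (0, v) = 0 := fun v => by
      have hpos : 0 < δ / (2 * (‖v‖ + 1)) := by positivity
      have hsm : ‖(δ / (2 * (‖v‖ + 1))) • v‖ < δ := by
        rw [norm_smul, Real.norm_of_nonneg hpos.le, div_mul_eq_mul_div, div_lt_iff₀ (by positivity)]
        nlinarith [norm_nonneg v]
      have h1 := hle _ hsm
      have h2 := hle (-((δ / (2 * (‖v‖ + 1))) • v)) (by rwa [norm_neg])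
      have e : ∀ w : E, f (0, -w) = -f (0, w) := fun w => by
        rw [← map_neg]; simp
      have e' : ∀ (k : ℝ) (w : E), f (0, k • w) = k * f (0, w) := fun k w => by
        rw [← smul_eq_mul, ← map_smul]; simp
      rw [e, e'] at h2
      rw [e'] at h1
      have : δ / (2 * (‖v‖ + 1)) * f (0, v) = 0 := le_antisymm h1 (by linarith)
      exact (mul_eq_zero.1 this).resolve_left hpos.ne'
    refine ContinuousLinearMap.ext fun q => ?_
    rw [show q = (q.1, q.2) from rfl, hsplit, h0, hzero]
    simp)
  have hαpos : 0 < f (1, 0) := lt_of_le_of_ne hα (Ne.symm hα')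
  refine ⟨(InnerProductSpace.toDual ℝ E).symm
    ((f (1, 0))⁻¹ • f.comp (ContinuousLinearMap.inr ℝ ℝ E)), ?_⟩
  rintro ⟨r, v⟩ hq
  have h := hf (r, v) ⟨r, le_rfl, hq⟩
  rw [hsplit r, hsplit p, show ((0 : ℝ), (0 : E)) = 0 from rfl, map_zero, add_zero] at h
  rw [InnerProductSpace.toDual_symm_apply]
  simp only [smul_apply, ContinuousLinearMap.comp_apply,
    ContinuousLinearMap.inr_apply, smul_eq_mul]
  rw [← mul_le_mul_iff_left₀ hαpos]
  calc (r + (f (1, 0))⁻¹ * f (0, v)) * f (1, 0) = r * f (1, 0) + f (0, v) := by field_simp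
    _ ≤ p * f (1, 0) := h

/-! ### Construction of loops from velocities -/

section Velocities

variable {n : ℕ} {S : Set (PhaseSpace n)}

/-- Periodize. Only pairs of times in different periods need an argument: the increment splits at
the common endpoint, and subadditivity applies. -/
theorem IsCenteredBody.exists_unitSpeedLoop_of_slopes (hS : IsCenteredBody S)
    {f : ℝ → PhaseSpace n}
    (hf : ∀ a ∈ Icc 0 (2 * Real.pi), ∀ b ∈ Icc 0 (2 * Real.pi), a ≤ b →
      supportFn S (f b - f a) ≤ b - a) (h0 : f (2 * Real.pi) = f 0) :
    ∃ Γ ∈ unitSpeedLoops S, ∀ t ∈ Icc 0 (2 * Real.pi), Γ t = f t - f 0 := by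
  have hp := Real.two_pi_pos
  have hmem := fun t => toIcoMod_mem_Ico' hp t
  refine ⟨fun t => f (toIcoMod hp 0 t) - f 0, ⟨?_, fun t => ?_, fun a b hab => ?_⟩, fun t ht => ?_⟩
  · simp
  · simp only [toIcoMod_add_right]
  · have ha := toIcoMod_add_toIcoDiv_zsmul hp 0 a
    have hb := toIcoMod_add_toIcoDiv_zsmul hp 0 b
    have hma := hmem a
    have hmb := hmem b
    set α := toIcoMod hp 0 a
    set β := toIcoMod hp 0 b
    set k := toIcoDiv hp 0 a
    set l := toIcoDiv hp 0 b
    rw [zsmul_eq_mul] at ha hb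
    rw [sub_sub_sub_cancel_right]
    have hkl : k ≤ l := by
      by_contra hlt
      have : (l : ℝ) + 1 ≤ k := by exact_mod_cast not_le.1 hlt
      nlinarith [hma.1, hmb.2]
    rcases hkl.eq_or_lt with hkl | hkl
    · rw [hkl] at ha
      have := hf α ⟨hma.1, hma.2.le⟩ β ⟨hmb.1, hmb.2.le⟩ (by linarith)
      linarith
    · have hk1 : (k : ℝ) + 1 ≤ l := by exact_mod_cast hkl
      have h1 := hf α ⟨hma.1, hma.2.le⟩ _ ⟨hp.le, le_rfl⟩ hma.2.le
      have h2 := hf 0 ⟨le_rfl, hp.le⟩ β ⟨hmb.1, hmb.2.le⟩ hmb.1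
      have h3 := supportFn_add_le hS.2.1 ⟨0, hS.zero_mem⟩ (f β - f 0) (f (2 * Real.pi) - f α)
      -- The two pieces take time `2π - α` and `β`, at most `b - a` in total; any full periods in
      -- between contribute no increment.
      rw [show f β - f 0 + (f (2 * Real.pi) - f α) = f β - f α by rw [h0]; abel] at h3
      nlinarith
  · rcases ht.2.eq_or_lt with rfl | hlt
    · have := toIcoMod_apply_right hp (0 : ℝ)
      rw [zero_add] at this
      simp only [this, h0]
    · have : toIcoMod hp 0 t = t := (toIcoMod_eq_self hp).2 (by simpa using ⟨ht.1, hlt⟩)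
      simp only [this]

theorem supportFn_deriv_le_one (hS : IsCenteredBody S) {Γ : ℝ → PhaseSpace n}
    (hΓ : Γ ∈ unitSpeedLoops S) (t : ℝ) : supportFn S (deriv Γ t) ≤ 1 := by
  by_cases hd : DifferentiableAt ℝ Γ t
  · have h := hd.hasDerivAt.tendsto_slope_zero_right
    refine le_of_tendsto (((continuous_supportFn hS.2.1 ⟨0, hS.zero_mem⟩).tendsto _).comp h) ?_
    filter_upwards [self_mem_nhdsWithin] with s hs
    have hs' : 0 < s := hs
    have := hΓ.2.2 t (t + s) (by linarith)
    simp only [Function.comp]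
    rw [supportFn_smul hS.2.1 ⟨0, hS.zero_mem⟩ (inv_nonneg.2 hs'.le), inv_mul_le_iff₀ hs']
    linarith
  -- `deriv` is zero where the loop is not differentiable, so the bound holds at every time and
  -- `deriv Γ` is itself an admissible velocity field.
  · rw [deriv_zero_of_not_differentiableAt hd, supportFn_zero ⟨0, hS.zero_mem⟩]
    exact zero_le_one

/-- Measurable velocity fields with values in the polar body. -/
def admissibleVelocities (S : Set (PhaseSpace n)) : Set (ℝ → PhaseSpace n) :=
  {u | Measurable u ∧ ∀ t, supportFn S (u t) ≤ 1}

theorem deriv_mem_admissibleVelocities (hS : IsCenteredBody S) {Γ : ℝ → PhaseSpace n}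
    (hΓ : Γ ∈ unitSpeedLoops S) : deriv Γ ∈ admissibleVelocities S :=
  ⟨measurable_deriv Γ, supportFn_deriv_le_one hS hΓ⟩

theorem IsCenteredBody.exists_norm_admissible_le (hS : IsCenteredBody S) :
    ∃ C > 0, ∀ w, supportFn S w ≤ 1 → ‖w‖ ≤ C :=
  hS.polarBody.exists_norm_le

theorem intervalIntegrable_of_mem_admissibleVelocities (hS : IsCenteredBody S)
    {u : ℝ → PhaseSpace n} (hu : u ∈ admissibleVelocities S) (a b : ℝ) :
    IntervalIntegrable u volume a b := by
  obtain ⟨C, -, hC⟩ := hS.exists_norm_admissible_le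
  refine (intervalIntegrable_const (c := C)).mono_fun hu.1.aestronglyMeasurable
    (Filter.Eventually.of_forall fun t => ?_)
  exact (hC _ (hu.2 t)).trans (le_abs_self C)

theorem IsCenteredBody.exists_unitSpeedLoop_of_velocity (hS : IsCenteredBody S)
    {u : ℝ → PhaseSpace n} (hu : u ∈ admissibleVelocities S)
    (h0 : ∫ t in (0 : ℝ)..(2 * Real.pi), u t = 0) :
    ∃ Γ ∈ unitSpeedLoops S, ∀ᵐ t, t ∈ uIoc 0 (2 * Real.pi) → deriv Γ t = u t := by
  have hint := intervalIntegrable_of_mem_admissibleVelocities hS hu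
  obtain ⟨Γ, hΓ, hΓu⟩ := hS.exists_unitSpeedLoop_of_slopes (f := fun t => ∫ s in (0 : ℝ)..t, u s)
    (fun a _ b _ hab => by
      rw [intervalIntegral.integral_interval_sub_left (hint _ _) (hint _ _)]
      have hh := intervalIntegrable_supportFn hS.2.1 ⟨0, hS.zero_mem⟩ (hint a b)
      refine (supportFn_intervalIntegral_le hS.2.1 ⟨0, hS.zero_mem⟩ hab (hint a b) hh).trans ?_
      calc ∫ t in a..b, supportFn S (u t) ≤ ∫ _ in a..b, (1 : ℝ) :=
            intervalIntegral.integral_mono_on hab hh (by simp) fun t _ => hu.2 t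
        _ = b - a := by simp) (by simpa using h0)
  refine ⟨Γ, hΓ, ?_⟩
  have h2 : ∀ᵐ t : ℝ, t ≠ 2 * Real.pi := by simp [ae_iff, measure_singleton]
  filter_upwards [(hint 0 (2 * Real.pi)).ae_hasDerivAt_integral, h2] with t ht htne hmem
  rw [uIoc_of_le Real.two_pi_pos.le] at hmem
  have hIoo : Ioo 0 (2 * Real.pi) ∈ nhds t := Ioo_mem_nhds hmem.1 (lt_of_le_of_ne hmem.2 htne)
  have hd := ht (by rw [uIcc_of_le Real.two_pi_pos.le]; exact Ioc_subset_Icc_self hmem) 0 (by simp)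
  refine (hd.congr_of_eventuallyEq ?_).deriv
  filter_upwards [hIoo] with s hs
  rw [hΓu s (Ioo_subset_Icc_self hs)]
  simp

end Velocities

/-! ### First variation of the action -/

section Variation

variable {n : ℕ} {S : Set (PhaseSpace n)}

theorem LipschitzWith.intervalIntegrable_inner_stdJ_deriv {f g : ℝ → PhaseSpace n} {C D : NNReal}
    (hf : LipschitzWith C f) (hg : LipschitzWith D g) (a b : ℝ) :
    IntervalIntegrable (fun t => (inner ℝ (stdJ (f t)) (deriv g t) : ℝ)) volume a b :=
  intervalIntegrable_inner_continuousOn (continuous_stdJ.comp hf.continuous).continuousOn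
    (hg.absolutelyContinuousOnInterval' a b).intervalIntegrable_deriv_phaseSpace

theorem LipschitzWith.ae_hasDerivAt {f : ℝ → PhaseSpace n} {C : NNReal} (hf : LipschitzWith C f) :
    ∀ᵐ t, HasDerivAt f (deriv f t) t := by
  filter_upwards [hf.ae_differentiableAt_real] with t ht
  exact ht.hasDerivAt

/-- Integration by parts: on closed loops the bilinear form behind the action is symmetric, since
`J` is antisymmetric and the boundary terms cancel. -/
theorem integral_inner_stdJ_deriv_symm {f g : ℝ → PhaseSpace n} {C D : NNReal}
    (hf : LipschitzWith C f) (hg : LipschitzWith D g) (hfp : f (2 * Real.pi) = f 0)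
    (hgp : g (2 * Real.pi) = g 0) :
    ∫ t in (0 : ℝ)..(2 * Real.pi), (inner ℝ (stdJ (f t)) (deriv g t) : ℝ) =
      ∫ t in (0 : ℝ)..(2 * Real.pi), (inner ℝ (stdJ (g t)) (deriv f t) : ℝ) := by
  have hJ : ∀ a b, AbsolutelyContinuousOnInterval (fun t => stdJ (f t)) a b := fun a b =>
    (hf.absolutelyContinuousOnInterval' a b).clm_comp (stdJL n)
  rw [integral_inner_deriv_eq (hJ _ _) (hg.absolutelyContinuousOnInterval' _ _), hfp, hgp, sub_self,
    zero_sub, ← intervalIntegral.integral_neg]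
  refine intervalIntegral.integral_congr_ae ?_
  filter_upwards [hf.ae_hasDerivAt] with t ht _
  have h1 : deriv (fun s => stdJ (f s)) t = stdJ (deriv f t) :=
    ((stdJL n).hasFDerivAt.comp_hasDerivAt t ht).deriv
  rw [h1, real_inner_comm, inner_stdJ_left (g t), real_inner_comm]

theorem loopAction_add_smul {f g : ℝ → PhaseSpace n} {C D : NNReal}
    (hf : LipschitzWith C f) (hg : LipschitzWith D g) (hfp : f (2 * Real.pi) = f 0)
    (hgp : g (2 * Real.pi) = g 0) (s : ℝ) :
    loopAction (fun t => f t + s • g t) = loopAction f +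
      s * (∫ t in (0 : ℝ)..(2 * Real.pi), (inner ℝ (stdJ (f t)) (deriv g t) : ℝ)) +
      s ^ 2 * loopAction g := by
  have h1 : ∫ t in (0 : ℝ)..(2 * Real.pi), (inner ℝ (stdJ (f t + s • g t))
      (deriv (fun t => f t + s • g t) t) : ℝ) =
      ∫ t in (0 : ℝ)..(2 * Real.pi), ((inner ℝ (stdJ (f t)) (deriv f t) +
        s * inner ℝ (stdJ (f t)) (deriv g t)) + s * inner ℝ (stdJ (g t)) (deriv f t)) +
        s ^ 2 * inner ℝ (stdJ (g t)) (deriv g t) := by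
    refine intervalIntegral.integral_congr_ae ?_
    filter_upwards [hf.ae_hasDerivAt, hg.ae_hasDerivAt] with t htf htg _
    rw [(htf.fun_add (htg.fun_const_smul s)).deriv]
    simp only [stdJ_add, stdJ_smul, inner_add_left, inner_add_right, real_inner_smul_left,
      real_inner_smul_right]
    ring
  have i1 := hf.intervalIntegrable_inner_stdJ_deriv hf 0 (2 * Real.pi)
  have i2 := hf.intervalIntegrable_inner_stdJ_deriv hg 0 (2 * Real.pi)
  have i3 := hg.intervalIntegrable_inner_stdJ_deriv hf 0 (2 * Real.pi)
  have i4 := hg.intervalIntegrable_inner_stdJ_deriv hg 0 (2 * Real.pi)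
  rw [loopAction, h1, intervalIntegral.integral_add ((i1.add (i2.const_mul s)).add (i3.const_mul s))
    (i4.const_mul _), intervalIntegral.integral_add (i1.add (i2.const_mul s)) (i3.const_mul s),
    intervalIntegral.integral_add i1 (i2.const_mul s), intervalIntegral.integral_const_mul,
    intervalIntegral.integral_const_mul, intervalIntegral.integral_const_mul,
    integral_inner_stdJ_deriv_symm hg hf hgp hfp, loopAction, loopAction]
  ring

theorem unitSpeedLoops_closing {Γ : ℝ → PhaseSpace n} (hΓ : Γ ∈ unitSpeedLoops S) :
    Γ (2 * Real.pi) = Γ 0 := by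
  have := hΓ.2.1 0
  rwa [zero_add] at this

theorem convex_unitSpeedLoops (hS : IsCenteredBody S) : Convex ℝ (unitSpeedLoops S) := by
  rintro Γ hΓ Δ hΔ a b ha hb hab
  refine ⟨by simp [hΓ.1, hΔ.1], fun t => by simp [hΓ.2.1 t, hΔ.2.1 t], fun s t hst => ?_⟩
  have h := supportFn_add_le hS.2.1 ⟨0, hS.zero_mem⟩ (a • (Γ t - Γ s)) (b • (Δ t - Δ s))
  rw [supportFn_smul hS.2.1 ⟨0, hS.zero_mem⟩ ha, supportFn_smul hS.2.1 ⟨0, hS.zero_mem⟩ hb] at h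
  have e : (a • Γ + b • Δ) t - (a • Γ + b • Δ) s = a • (Γ t - Γ s) + b • (Δ t - Δ s) := by
    simp only [Pi.add_apply, Pi.smul_apply, smul_sub]
    abel
  rw [e]
  have h1 := mul_le_mul_of_nonneg_left (hΓ.2.2 s t hst) ha
  have h2 := mul_le_mul_of_nonneg_left (hΔ.2.2 s t hst) hb
  have h3 : a * (t - s) + b * (t - s) = t - s := by rw [← add_mul, hab, one_mul]
  linarith

/-- The class is convex, so `Γ + s (Δ - Γ)` competes for small `s > 0`. The action is quadratic in
`s`; dividing by `s` and letting it tend to zero leaves the linear term. -/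
theorem first_variation_unitSpeedLoops (hS : IsCenteredBody S) {Γ : ℝ → PhaseSpace n}
    (hΓ : Γ ∈ unitSpeedLoops S) (hmax : ∀ Δ ∈ unitSpeedLoops S, loopAction Δ ≤ loopAction Γ)
    {Δ : ℝ → PhaseSpace n} (hΔ : Δ ∈ unitSpeedLoops S) :
    ∫ t in (0 : ℝ)..(2 * Real.pi), (inner ℝ (stdJ (Γ t)) (deriv Δ t) : ℝ) ≤
      ∫ t in (0 : ℝ)..(2 * Real.pi), (inner ℝ (stdJ (Γ t)) (deriv Γ t) : ℝ) := by
  obtain ⟨C, hC⟩ := hS.exists_lipschitz_unitSpeedLoops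
  have hl : LipschitzWith (C + C) (fun t => Δ t - Γ t) := (hC Δ hΔ).sub (hC Γ hΓ)
  have hclos : Δ (2 * Real.pi) - Γ (2 * Real.pi) = Δ 0 - Γ 0 := by
    rw [unitSpeedLoops_closing hΓ, unitSpeedLoops_closing hΔ]
  set I := ∫ t in (0 : ℝ)..(2 * Real.pi),
    (inner ℝ (stdJ (Γ t)) (deriv (fun t => Δ t - Γ t) t) : ℝ) with hI
  have key : ∀ s ∈ Ioc (0 : ℝ) 1, I ≤ -s * loopAction (fun t => Δ t - Γ t) := fun s hs => by
    have h1 := loopAction_add_smul (hC Γ hΓ) hl (unitSpeedLoops_closing hΓ) hclos s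
    have h2 := hmax _ (convex_unitSpeedLoops hS hΓ hΔ (sub_nonneg.2 hs.2) hs.1.le (by ring))
    have e : (fun t => Γ t + s • (Δ t - Γ t)) = (1 - s) • Γ + s • Δ := by
      ext1 t
      change _ = (1 - s) • Γ t + s • Δ t
      module
    rw [← e, h1] at h2
    have h3 : s * (I + s * loopAction (fun t => Δ t - Γ t)) ≤ s * 0 := by
      rw [mul_zero]
      linarith [h2]
    have := le_of_mul_le_mul_left h3 hs.1
    linarith
  have hI0 : I ≤ 0 := by
    have hlim : Filter.Tendsto (fun s : ℝ => -s * loopAction (fun t => Δ t - Γ t))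
        (nhdsWithin 0 (Ioi 0)) (nhds 0) := by
      have : Continuous (fun s : ℝ => -s * loopAction (fun t => Δ t - Γ t)) := by fun_prop
      simpa using (this.tendsto 0).mono_left nhdsWithin_le_nhds
    refine ge_of_tendsto hlim ?_
    filter_upwards [Ioc_mem_nhdsGT (zero_lt_one' ℝ)] with s hs using key s hs
  have hsplit : I = (∫ t in (0 : ℝ)..(2 * Real.pi), (inner ℝ (stdJ (Γ t)) (deriv Δ t) : ℝ)) -
      ∫ t in (0 : ℝ)..(2 * Real.pi), (inner ℝ (stdJ (Γ t)) (deriv Γ t) : ℝ) := by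
    rw [hI, ← intervalIntegral.integral_sub ((hC Γ hΓ).intervalIntegrable_inner_stdJ_deriv
      (hC Δ hΔ) _ _) ((hC Γ hΓ).intervalIntegrable_inner_stdJ_deriv (hC Γ hΓ) _ _)]
    refine intervalIntegral.integral_congr_ae ?_
    filter_upwards [(hC Γ hΓ).ae_hasDerivAt, (hC Δ hΔ).ae_hasDerivAt] with t h1 h2 _
    rw [(h2.fun_sub h1).deriv, inner_sub_right]
  linarith

end Variation

/-! ### The Euler-Lagrange inclusion -/

section EulerLagrange

variable {n : ℕ} {S : Set (PhaseSpace n)}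

theorem intervalIntegrable_inner_admissible (hS : IsCenteredBody S) {f u : ℝ → PhaseSpace n}
    (hf : Continuous f) (hu : u ∈ admissibleVelocities S) (a b : ℝ) :
    IntervalIntegrable (fun t => (inner ℝ (f t) (u t) : ℝ)) volume a b :=
  intervalIntegrable_inner_continuousOn hf.continuousOn
    (intervalIntegrable_of_mem_admissibleVelocities hS hu a b)

theorem integral_inner_const_left {u : ℝ → PhaseSpace n} {a b : ℝ}
    (hu : IntervalIntegrable u volume a b) (c : PhaseSpace n) :
    ∫ t in a..b, (inner ℝ c (u t) : ℝ) = inner ℝ c (∫ t in a..b, u t) :=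
  (innerSL ℝ c).intervalIntegral_comp_comm hu

theorem convex_admissibleVelocities (hS : IsCenteredBody S) :
    Convex ℝ (admissibleVelocities S) := by
  rintro u hu v hv a b ha hb hab
  exact ⟨(hu.1.const_smul a).add (hv.1.const_smul b), fun t =>
    hS.polarBody.1 (hu.2 t) (hv.2 t) ha hb hab⟩

/-- The first variation only compares velocities of mean zero. The multiplier rule, applied to the
pairs formed by the linearized action and the total displacement, trades this restriction for a
constant vector `c` added to `stdJ (Γ t)`. -/
theorem exists_multiplier_unitSpeedLoops (hS : IsCenteredBody S) {Γ : ℝ → PhaseSpace n}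
    (hΓ : Γ ∈ unitSpeedLoops S) (hmax : ∀ Δ ∈ unitSpeedLoops S, loopAction Δ ≤ loopAction Γ) :
    ∃ c : PhaseSpace n, ∀ u ∈ admissibleVelocities S,
      ∫ t in (0 : ℝ)..(2 * Real.pi), (inner ℝ (stdJ (Γ t) + c) (u t) : ℝ) ≤
        ∫ t in (0 : ℝ)..(2 * Real.pi), (inner ℝ (stdJ (Γ t) + c) (deriv Γ t) : ℝ) := by
  obtain ⟨C, hC⟩ := hS.exists_lipschitz_unitSpeedLoops
  obtain ⟨R, hR0, hR⟩ := hS.exists_norm_le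
  have hpi := Real.two_pi_pos
  have hcont : Continuous fun t => stdJ (Γ t) := continuous_stdJ.comp (hC Γ hΓ).continuous
  have hi := fun {u : ℝ → PhaseSpace n} (hu : u ∈ admissibleVelocities S) =>
    intervalIntegrable_of_mem_admissibleVelocities hS hu 0 (2 * Real.pi)
  have hiJ := fun {u : ℝ → PhaseSpace n} (hu : u ∈ admissibleVelocities S) =>
    intervalIntegrable_inner_admissible hS hcont hu 0 (2 * Real.pi)
  have hclosed : ∫ t in (0 : ℝ)..(2 * Real.pi), deriv Γ t = 0 := by
    rw [← (hC Γ hΓ).sub_eq_integral_deriv, unitSpeedLoops_closing hΓ, sub_self]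
  let Φ : (ℝ → PhaseSpace n) → ℝ × PhaseSpace n := fun u =>
    (∫ t in (0 : ℝ)..(2 * Real.pi), (inner ℝ (stdJ (Γ t)) (u t) : ℝ),
      ∫ t in (0 : ℝ)..(2 * Real.pi), u t)
  have hD : Convex ℝ (Φ '' admissibleVelocities S) := by
    rintro _ ⟨u, hu, rfl⟩ _ ⟨v, hv, rfl⟩ a b ha hb hab
    refine ⟨a • u + b • v, convex_admissibleVelocities hS hu hv ha hb hab, ?_⟩
    simp only [Φ, Pi.add_apply, Pi.smul_apply, inner_add_right, real_inner_smul_right,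
      Prod.smul_mk, Prod.mk_add_mk, Prod.mk.injEq, smul_eq_mul]
    constructor
    · rw [intervalIntegral.integral_add ((hiJ hu).const_mul a) ((hiJ hv).const_mul b),
        intervalIntegral.integral_const_mul, intervalIntegral.integral_const_mul]
    · rw [← intervalIntegral.integral_smul, ← intervalIntegral.integral_smul]
      exact intervalIntegral.integral_add ((hi hu).smul a) ((hi hv).smul b)
  have hp : ∀ r, (r, (0 : PhaseSpace n)) ∈ Φ '' admissibleVelocities S →
      r ≤ ∫ t in (0 : ℝ)..(2 * Real.pi), (inner ℝ (stdJ (Γ t)) (deriv Γ t) : ℝ) := by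
    rintro r ⟨u, hu, hur⟩
    have h0 : ∫ t in (0 : ℝ)..(2 * Real.pi), u t = 0 := congrArg Prod.snd hur
    have hr : ∫ t in (0 : ℝ)..(2 * Real.pi), (inner ℝ (stdJ (Γ t)) (u t) : ℝ) = r :=
      congrArg Prod.fst hur
    obtain ⟨Δ, hΔ, hΔu⟩ := hS.exists_unitSpeedLoop_of_velocity hu h0
    rw [← hr]
    refine Eq.trans_le (intervalIntegral.integral_congr_ae ?_)
      (first_variation_unitSpeedLoops hS hΓ hmax hΔ)
    filter_upwards [hΔu] with t ht hmem
    rw [ht hmem]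
  -- Constant velocities `v / 2π` already realize all small displacements, and they are admissible
  -- for this radius.
  have hball : ∀ v : PhaseSpace n, ‖v‖ < 2 * Real.pi / R →
      ∃ r, -(‖∫ t in (0 : ℝ)..(2 * Real.pi), stdJ (Γ t)‖ * (1 / R)) ≤ r ∧
        (r, v) ∈ Φ '' admissibleVelocities S := by
    intro v hv
    have hadm : (fun _ : ℝ => (2 * Real.pi)⁻¹ • v) ∈ admissibleVelocities S := by
      refine ⟨measurable_const, fun _ => (supportFn_le_mul_norm ⟨0, hS.zero_mem⟩ hR _).trans ?_⟩
      rw [norm_smul, Real.norm_of_nonneg (inv_nonneg.2 hpi.le)]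
      rw [lt_div_iff₀ hR0] at hv
      rw [mul_left_comm, inv_mul_le_iff₀ hpi]
      linarith
    refine ⟨_, ?_, ⟨_, hadm, Prod.ext rfl ?_⟩⟩
    · have e : ∫ t in (0 : ℝ)..(2 * Real.pi), (inner ℝ (stdJ (Γ t)) ((2 * Real.pi)⁻¹ • v) : ℝ) =
          inner ℝ ((2 * Real.pi)⁻¹ • v) (∫ t in (0 : ℝ)..(2 * Real.pi), stdJ (Γ t)) := by
        rw [← integral_inner_const_left (hcont.intervalIntegrable _ _)]
        simp only [real_inner_comm]
      dsimp only
      rw [e]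
      have h1 := abs_real_inner_le_norm ((2 * Real.pi)⁻¹ • v)
        (∫ t in (0 : ℝ)..(2 * Real.pi), stdJ (Γ t))
      have h2 : ‖(2 * Real.pi)⁻¹ • v‖ ≤ 1 / R := by
        rw [norm_smul, Real.norm_of_nonneg (inv_nonneg.2 hpi.le), inv_mul_le_iff₀ hpi]
        refine hv.le.trans_eq ?_
        ring
      have h3 := mul_le_mul_of_nonneg_right h2
        (norm_nonneg (∫ t in (0 : ℝ)..(2 * Real.pi), stdJ (Γ t)))
      linarith [neg_abs_le (inner ℝ ((2 * Real.pi)⁻¹ • v)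
        (∫ t in (0 : ℝ)..(2 * Real.pi), stdJ (Γ t)) : ℝ)]
    · change ∫ _ in (0 : ℝ)..(2 * Real.pi), (2 * Real.pi)⁻¹ • v = v
      rw [intervalIntegral.integral_const, sub_zero, smul_smul, mul_inv_cancel₀ hpi.ne', one_smul]
  obtain ⟨c, hc⟩ := exists_multiplier_of_convex hD
    ⟨deriv Γ, deriv_mem_admissibleVelocities hS hΓ, Prod.ext rfl hclosed⟩ hp (by positivity) hball
  refine ⟨c, fun u hu => ?_⟩
  have h := hc _ ⟨u, hu, rfl⟩
  have hsplit : ∀ w ∈ admissibleVelocities S,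
      ∫ t in (0 : ℝ)..(2 * Real.pi), (inner ℝ (stdJ (Γ t) + c) (w t) : ℝ) =
      (∫ t in (0 : ℝ)..(2 * Real.pi), (inner ℝ (stdJ (Γ t)) (w t) : ℝ)) +
        inner ℝ c (∫ t in (0 : ℝ)..(2 * Real.pi), w t) := fun w hw => by
    simp only [inner_add_left]
    rw [intervalIntegral.integral_add (hiJ hw)
      (intervalIntegrable_inner_continuousOn continuousOn_const (hi hw)),
      integral_inner_const_left (hi hw)]
  rw [hsplit u hu, hsplit _ (deriv_mem_admissibleVelocities hS hΓ), hclosed, inner_zero_right,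
    add_zero]
  exact h

/-- A needle variation localizes the integral inequality: change the velocity to `w` on `(t, t + s]`
only, divide by `s` and let `s` tend to zero. Freezing the continuous weight at time `t` costs an
error of order `s`. -/
theorem inner_le_inner_of_multiplier (hS : IsCenteredBody S) {Γ : ℝ → PhaseSpace n}
    (hΓ : Γ ∈ unitSpeedLoops S) {c : PhaseSpace n}
    (hc : ∀ u ∈ admissibleVelocities S,
      ∫ t in (0 : ℝ)..(2 * Real.pi), (inner ℝ (stdJ (Γ t) + c) (u t) : ℝ) ≤
        ∫ t in (0 : ℝ)..(2 * Real.pi), (inner ℝ (stdJ (Γ t) + c) (deriv Γ t) : ℝ))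
    {t : ℝ} (ht : t ∈ Ioo 0 (2 * Real.pi)) {v : PhaseSpace n} (hv : HasDerivAt Γ v t)
    {w : PhaseSpace n} (hw : supportFn S w ≤ 1) :
    (inner ℝ (stdJ (Γ t) + c) w : ℝ) ≤ inner ℝ (stdJ (Γ t) + c) v := by
  obtain ⟨C, hC⟩ := hS.exists_lipschitz_unitSpeedLoops
  obtain ⟨B, hB0, hB⟩ := hS.exists_norm_admissible_le
  have hΓC := hC Γ hΓ
  have hadm := deriv_mem_admissibleVelocities hS hΓ
  set y : ℝ → PhaseSpace n := fun τ => stdJ (Γ τ) + c with hy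
  have hyc : Continuous y := (continuous_stdJ.comp hΓC.continuous).add continuous_const
  have hylip : ∀ τ, ‖y τ - y t‖ ≤ C * |τ - t| := fun τ => by
    simp only [hy, add_sub_add_right_eq_sub, ← stdJ_sub, norm_stdJ]
    have := hΓC.dist_le_mul τ t
    rwa [dist_eq_norm, Real.dist_eq] at this
  have key : ∀ s, 0 < s → t + s < 2 * Real.pi →
      (inner ℝ (y t) w : ℝ) ≤ inner ℝ (y t) (s⁻¹ • (Γ (t + s) - Γ t)) + s * (C * (2 * B)) := by
    intro s hs hs'
    let u : ℝ → PhaseSpace n := (Ioc t (t + s)).piecewise (fun _ => w) (deriv Γ)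
    have hu : u ∈ admissibleVelocities S := by
      refine ⟨Measurable.piecewise measurableSet_Ioc measurable_const hadm.1, fun τ => ?_⟩
      by_cases hτ : τ ∈ Ioc t (t + s)
      · simpa [u, hτ] using hw
      · simpa [u, hτ] using hadm.2 τ
    have h1 := hc u hu
    have iu := fun a b => intervalIntegrable_inner_admissible hS hyc hu a b
    have iΓ := fun a b => intervalIntegrable_inner_admissible hS hyc hadm a b
    rw [← intervalIntegral.integral_add_adjacent_intervals (iu 0 t) (iu t _),
      ← intervalIntegral.integral_add_adjacent_intervals (iu t (t + s)) (iu (t + s) _),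
      ← intervalIntegral.integral_add_adjacent_intervals (iΓ 0 t) (iΓ t _),
      ← intervalIntegral.integral_add_adjacent_intervals (iΓ t (t + s)) (iΓ (t + s) _)] at h1
    have e1 : ∫ τ in (0 : ℝ)..t, (inner ℝ (y τ) (u τ) : ℝ) =
        ∫ τ in (0 : ℝ)..t, (inner ℝ (y τ) (deriv Γ τ) : ℝ) := by
      refine intervalIntegral.integral_congr_ae (Filter.Eventually.of_forall fun τ hτ => ?_)
      rw [uIoc_of_le ht.1.le] at hτ
      have : τ ∉ Ioc t (t + s) := fun h => h.1.not_ge hτ.2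
      simp [u, this]
    have e2 : ∫ τ in (t + s)..(2 * Real.pi), (inner ℝ (y τ) (u τ) : ℝ) =
        ∫ τ in (t + s)..(2 * Real.pi), (inner ℝ (y τ) (deriv Γ τ) : ℝ) := by
      refine intervalIntegral.integral_congr_ae (Filter.Eventually.of_forall fun τ hτ => ?_)
      rw [uIoc_of_le hs'.le] at hτ
      have : τ ∉ Ioc t (t + s) := fun h => h.2.not_gt hτ.1
      simp [u, this]
    have e3 : ∫ τ in t..(t + s), (inner ℝ (y τ) (u τ) : ℝ) =
        ∫ τ in t..(t + s), (inner ℝ (y τ) w : ℝ) := by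
      refine intervalIntegral.integral_congr_ae (Filter.Eventually.of_forall fun τ hτ => ?_)
      rw [uIoc_of_le (by linarith)] at hτ
      simp [u, hτ]
    have hw' : (fun _ : ℝ => w) ∈ admissibleVelocities S := ⟨measurable_const, fun _ => hw⟩
    have iw := intervalIntegrable_inner_admissible hS hyc hw' t (t + s)
    have h2 : ∫ τ in t..(t + s), (inner ℝ (y τ) (w - deriv Γ τ) : ℝ) ≤ 0 := by
      simp only [inner_sub_right]
      rw [intervalIntegral.integral_sub iw (iΓ _ _)]
      linarith
    have iwd : IntervalIntegrable (fun τ => w - deriv Γ τ) volume t (t + s) :=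
      intervalIntegrable_const.sub (intervalIntegrable_of_mem_admissibleVelocities hS hadm _ _)
    have h3 : ∫ τ in t..(t + s), (inner ℝ (y t) (w - deriv Γ τ) : ℝ) =
        s * inner ℝ (y t) w - inner ℝ (y t) (Γ (t + s) - Γ t) := by
      rw [integral_inner_const_left iwd, intervalIntegral.integral_sub intervalIntegrable_const
        (intervalIntegrable_of_mem_admissibleVelocities hS hadm _ _),
        ← hΓC.sub_eq_integral_deriv, intervalIntegral.integral_const, add_sub_cancel_left,
        inner_sub_right, real_inner_smul_right]
    have h4 : ‖∫ τ in t..(t + s), (inner ℝ (y t - y τ) (w - deriv Γ τ) : ℝ)‖ ≤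
        C * s * (2 * B) * |t + s - t| := by
      refine intervalIntegral.norm_integral_le_of_norm_le_const fun τ hτ => ?_
      rw [uIoc_of_le (by linarith)] at hτ
      refine (norm_inner_le_norm _ _).trans ?_
      rw [norm_sub_rev]
      refine mul_le_mul ((hylip τ).trans ?_) ((norm_sub_le _ _).trans ?_) (norm_nonneg _)
        (by positivity)
      · rw [abs_of_pos (sub_pos.2 hτ.1)]
        exact mul_le_mul_of_nonneg_left (by linarith [hτ.2]) C.2
      · linarith [hB w hw, hB _ (hadm.2 τ)]
    have h5 : ∫ τ in t..(t + s), (inner ℝ (y t - y τ) (w - deriv Γ τ) : ℝ) =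
        (∫ τ in t..(t + s), (inner ℝ (y t) (w - deriv Γ τ) : ℝ)) -
          ∫ τ in t..(t + s), (inner ℝ (y τ) (w - deriv Γ τ) : ℝ) := by
      rw [← intervalIntegral.integral_sub
        (intervalIntegrable_inner_continuousOn continuousOn_const iwd)
        (intervalIntegrable_inner_continuousOn hyc.continuousOn iwd)]
      simp only [inner_sub_left]
    rw [add_sub_cancel_left, abs_of_pos hs] at h4
    have h6 := (le_abs_self _).trans h4
    rw [h5, h3] at h6
    rw [real_inner_smul_right, ← mul_le_mul_iff_right₀ hs, mul_add, mul_inv_cancel_left₀ hs.ne']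
    nlinarith
  have hlim1 := hv.tendsto_slope_zero_right
  have hlim2 : Filter.Tendsto (fun s : ℝ => (inner ℝ (y t) (s⁻¹ • (Γ (t + s) - Γ t)) : ℝ) +
      s * (C * (2 * B))) (nhdsWithin 0 (Ioi 0)) (nhds (inner ℝ (y t) v + 0 * (C * (2 * B)))) := by
    refine ((continuous_const.inner continuous_id).tendsto v |>.comp hlim1).add ?_
    exact ((continuous_id.mul continuous_const).tendsto (0 : ℝ)).mono_left nhdsWithin_le_nhds
  rw [zero_mul, add_zero] at hlim2
  refine ge_of_tendsto hlim2 ?_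
  filter_upwards [Ioo_mem_nhdsGT (sub_pos.2 ht.2)] with s hs
  exact key s hs.1 (by linarith [hs.2])

/-- A Lipschitz loop on the boundary of `S` whose velocity lies almost everywhere in `J N_S`, with
the normalization `⟨γ, ν⟩ = π / a`. -/
def IsWeakCharacteristic (S : Set (PhaseSpace n)) (a : ℝ) (γ : ℝ → PhaseSpace n) : Prop :=
  (∃ C, LipschitzWith C γ) ∧ Function.Periodic γ (2 * Real.pi) ∧ (∀ t, γ t ∈ frontier S) ∧
    ∀ᵐ t, ∃ ν ∈ normalCone S (γ t), HasDerivAt γ (stdJ ν) t ∧ (inner ℝ (γ t) ν : ℝ) = Real.pi / a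

theorem Function.Periodic.hasDerivAt_iff {f : ℝ → PhaseSpace n} {p : ℝ}
    (hf : Function.Periodic f p) {v : PhaseSpace n} {t : ℝ} (k : ℤ) :
    HasDerivAt f v (t + k * p) ↔ HasDerivAt f v t := by
  have h : ∀ (k : ℤ) (s : ℝ), HasDerivAt f v (s + k * p) → HasDerivAt f v s := fun k s hs => by
    have := hs.comp_add_const s (k * p)
    refine this.congr_of_eventuallyEq (Filter.Eventually.of_forall fun τ => ?_)
    exact (hf.int_mul k τ).symm
  refine ⟨h k t, fun ht => h (-k) _ ?_⟩
  convert ht using 1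
  push_cast
  ring

theorem mem_frontier_of_supportFn_polarBody_eq_one (hS : IsCenteredBody S) {x : PhaseSpace n}
    (hx : supportFn (polarBody S) x = 1) : x ∈ frontier S := by
  refine ⟨subset_closure (hS.mem_iff_supportFn_polarBody_le.2 hx.le), fun hint => ?_⟩
  have hc : Filter.Tendsto (fun s : ℝ => (1 + s) • x) (nhdsWithin 0 (Ioi 0)) (nhds x) := by
    have : Continuous fun s : ℝ => (1 + s) • x := by fun_prop
    simpa using (this.tendsto 0).mono_left nhdsWithin_le_nhds
  obtain ⟨s, hs, hs0⟩ := ((hc.eventually (mem_interior_iff_mem_nhds.1 hint)).and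
    self_mem_nhdsWithin).exists
  have hs0' : (0 : ℝ) < s := hs0
  have h := hS.mem_iff_supportFn_polarBody_le.1 hs
  rw [supportFn_smul hS.polarBody.2.1 ⟨0, hS.polarBody.zero_mem⟩ (by linarith), hx] at h
  linarith

/-- The pointwise maximum condition says that the gauge of `y = JΓ + c` equals `⟨y, Γ'⟩`, so `Γ'` is
normal to the gauge level through `y`. As `y' = JΓ'`, the curve `y` moves in a characteristic
direction. -/
theorem exists_isWeakCharacteristic (hn : 1 ≤ n) (hS : IsCenteredBody S) {a : ℝ}
    (ha : IsGreatest (loopAction '' unitSpeedLoops S) a) : ∃ γ, IsWeakCharacteristic S a γ := by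
  obtain ⟨⟨Γ, hΓ, hΓa⟩, hmax⟩ := ha
  have hmax' : ∀ Δ ∈ unitSpeedLoops S, loopAction Δ ≤ loopAction Γ := fun Δ hΔ =>
    hΓa ▸ hmax ⟨Δ, hΔ, rfl⟩
  have ha0 : 0 < a := by
    obtain ⟨Δ, hΔ, hpos⟩ := hS.exists_loopAction_pos hn
    exact hpos.trans_le (hmax ⟨Δ, hΔ, rfl⟩)
  obtain ⟨C, hC⟩ := hS.exists_lipschitz_unitSpeedLoops
  have hΓC := hC Γ hΓ
  obtain ⟨c, hc⟩ := exists_multiplier_unitSpeedLoops hS hΓ hmax'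
  have hpi := Real.two_pi_pos
  set y : ℝ → PhaseSpace n := fun t => stdJ (Γ t) + c with hy
  have hylip : LipschitzWith C y := LipschitzWith.of_dist_le_mul fun s t => by
    change dist (stdJ (Γ s) + c) (stdJ (Γ t) + c) ≤ _
    rw [dist_add_right, dist_eq_norm, ← stdJ_sub, norm_stdJ, ← dist_eq_norm]
    exact hΓC.dist_le_mul s t
  have hmaxpt : ∀ᵐ t, HasDerivAt Γ (deriv Γ t) t ∧
      ∀ w, supportFn S w ≤ 1 → (inner ℝ (y t) w : ℝ) ≤ inner ℝ (y t) (deriv Γ t) := by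
    -- The local inequality is available only inside one period, so the countably many multiples of
    -- `2π` are discarded.
    have hcount : ∀ᵐ t : ℝ, t ∉ range fun k : ℤ => (k : ℝ) * (2 * Real.pi) :=
      (countable_range _).ae_notMem _
    filter_upwards [hΓC.ae_hasDerivAt, hcount] with t ht htne
    refine ⟨ht, fun w hw => ?_⟩
    have hdec : toIcoMod hpi 0 t + toIcoDiv hpi 0 t * (2 * Real.pi) = t := by
      have := toIcoMod_add_toIcoDiv_zsmul hpi 0 t
      rwa [zsmul_eq_mul] at this
    have hmem := toIcoMod_mem_Ico' hpi t
    have hne : toIcoMod hpi 0 t ≠ 0 := fun h0 => htne ⟨toIcoDiv hpi 0 t, by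
      rw [h0, zero_add] at hdec
      exact hdec⟩
    have hΓt : Γ t = Γ (toIcoMod hpi 0 t) := by
      conv_lhs => rw [← hdec]
      exact hΓ.2.1.int_mul _ _
    have hd : HasDerivAt Γ (deriv Γ t) (toIcoMod hpi 0 t) := by
      rw [← hdec] at ht
      rw [hΓ.2.1.hasDerivAt_iff] at ht
      rwa [hdec] at ht
    have := inner_le_inner_of_multiplier hS hΓ hc
      ⟨lt_of_le_of_ne hmem.1 (Ne.symm hne), hmem.2⟩ hd hw
    rwa [← hΓt] at this
  have hP := hS.polarBody
  have hPne : (polarBody S).Nonempty := ⟨0, hP.zero_mem⟩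
  have hGeq : ∀ᵐ t, supportFn (polarBody S) (y t) = inner ℝ (y t) (deriv Γ t) := by
    filter_upwards [hmaxpt] with t ht
    refine le_antisymm (supportFn_le hPne fun w hw => ?_) ?_
    · rw [real_inner_comm]
      exact ht.2 w hw
    · rw [real_inner_comm]
      exact inner_le_supportFn hP.2.1 (supportFn_deriv_le_one hS hΓ t) _
  obtain ⟨L, hL⟩ := lipschitzWith_supportFn hP.2.1 hPne
  have hGlip : LipschitzWith (L * C) fun t => supportFn (polarBody S) (y t) := hL.comp hylip
  -- Conservation of energy without smoothness: the gauge of `y τ` minus `⟨y τ, Γ' t⟩` is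
  -- nonnegative and vanishes at `τ = t`, and the subtracted term has derivative `⟨JΓ', Γ'⟩ = 0`
  -- there.
  have hGd : ∀ᵐ t, HasDerivAt (fun t => supportFn (polarBody S) (y t)) 0 t := by
    filter_upwards [hmaxpt, hGeq, hGlip.ae_differentiableAt_real] with t ht hte htd
    have hyd : HasDerivAt y (stdJ (deriv Γ t)) t :=
      ((stdJL n).hasFDerivAt.comp_hasDerivAt t ht.1).add_const c
    have hdiff : HasDerivAt (fun τ => supportFn (polarBody S) (y τ) -
        inner ℝ (y τ) (deriv Γ t)) (deriv (fun t => supportFn (polarBody S) (y t)) t - 0) t := by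
      refine htd.hasDerivAt.sub ?_
      have := hyd.inner ℝ (hasDerivAt_const t (deriv Γ t))
      rwa [inner_zero_right, zero_add, inner_stdJ_self] at this
    have hmin : IsLocalMin (fun τ => supportFn (polarBody S) (y τ) -
        inner ℝ (y τ) (deriv Γ t)) t := Filter.Eventually.of_forall fun τ => by
      simp only [hte, sub_self, sub_nonneg]
      rw [real_inner_comm]
      exact inner_le_supportFn hP.2.1 (supportFn_deriv_le_one hS hΓ t) _
    have h0 := hmin.hasDerivAt_eq_zero hdiff
    rw [sub_zero] at h0
    rw [← h0]
    exact htd.hasDerivAt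
  have hconst : ∀ t, supportFn (polarBody S) (y t) = supportFn (polarBody S) (y 0) := fun t => by
    obtain ⟨K, hK⟩ := (hGlip.absolutelyContinuousOnInterval' 0 t).const_of_ae_hasDerivAt_zero
      (hGd.mono fun s hs _ => hs)
    rw [hK t (by simp), hK 0 (by simp)]
  set g := supportFn (polarBody S) (y 0) with hg
  -- Integrating `⟨y, Γ'⟩ = g` over a period gives twice the action, because `c` contributes nothing
  -- on a closed loop.
  have hga : a = Real.pi * g := by
    have h1 : ∫ t in (0 : ℝ)..(2 * Real.pi), (inner ℝ (y t) (deriv Γ t) : ℝ) =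
        2 * Real.pi * g := by
      have : ∫ t in (0 : ℝ)..(2 * Real.pi), (inner ℝ (y t) (deriv Γ t) : ℝ) =
          ∫ _ in (0 : ℝ)..(2 * Real.pi), g := by
        refine intervalIntegral.integral_congr_ae ?_
        filter_upwards [hGeq] with t ht _
        rw [← ht, hconst t]
      rw [this]
      simp
    have hd := (hΓC.absolutelyContinuousOnInterval' 0 (2 * Real.pi)).intervalIntegrable_deriv_phaseSpace
    have h2 : ∫ t in (0 : ℝ)..(2 * Real.pi), (inner ℝ (y t) (deriv Γ t) : ℝ) =
        ∫ t in (0 : ℝ)..(2 * Real.pi), (inner ℝ (stdJ (Γ t)) (deriv Γ t) : ℝ) := by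
      simp only [hy, inner_add_left]
      rw [intervalIntegral.integral_add (hΓC.intervalIntegrable_inner_stdJ_deriv hΓC _ _)
        (intervalIntegrable_inner_continuousOn continuousOn_const hd),
        integral_inner_const_left hd, ← hΓC.sub_eq_integral_deriv, unitSpeedLoops_closing hΓ,
        sub_self, inner_zero_right, add_zero]
    rw [← hΓa, loopAction, ← h2, h1]
    ring
  have hg0 : 0 < g := by
    rw [hga] at ha0
    exact pos_of_mul_pos_right ha0 Real.pi_pos.le
  -- Dividing by `g` puts the curve at gauge one. The normal vector is `g⁻¹ • deriv Γ t`, and its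
  -- pairing with the curve is `g⁻¹ = π / a`.
  refine ⟨fun t => g⁻¹ • y t, ⟨_, (lipschitzWith_smul g⁻¹).comp hylip⟩, fun t => ?_, fun t => ?_, ?_⟩
  · simp only [hy, hΓ.2.1 t]
  · refine mem_frontier_of_supportFn_polarBody_eq_one hS ?_
    rw [supportFn_smul hP.2.1 hPne (inv_nonneg.2 hg0.le), hconst t, inv_mul_cancel₀ hg0.ne']
  · filter_upwards [hmaxpt, hGeq] with t ht hte
    rw [hconst t] at hte
    have hone : (inner ℝ (g⁻¹ • y t) (deriv Γ t) : ℝ) = 1 := by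
      rw [real_inner_smul_left, ← hte, inv_mul_cancel₀ hg0.ne']
    refine ⟨g⁻¹ • deriv Γ t, smul_mem_normalCone (inv_nonneg.2 hg0.le)
      (mem_normalCone_of_supportFn_le hS.2.1 ?_), ?_, ?_⟩
    · rw [hone]
      exact supportFn_deriv_le_one hS hΓ t
    · rw [stdJ_smul]
      exact (((stdJL n).hasFDerivAt.comp_hasDerivAt t ht.1).add_const c).const_smul g⁻¹
    · rw [real_inner_smul_right, hone, hga]
      have := Real.pi_pos
      field_simp

end EulerLagrange

/-! ### The isoperimetric inequality for closed curves -/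

section Isoperimetric

variable {n : ℕ} {S : Set (PhaseSpace n)}

theorem integral_norm_le_integral_supportFn (hS : IsCenteredBody S) : ∃ r > 0,
    ∀ (u : ℝ → PhaseSpace n) (a b : ℝ), a ≤ b → IntervalIntegrable u volume a b →
      r * ∫ t in a..b, ‖u t‖ ≤ ∫ t in a..b, supportFn S (u t) := by
  obtain ⟨r, hr, hrS⟩ := hS.exists_closedBall_subset
  refine ⟨r, hr, fun u a b hab hu => ?_⟩
  rw [← intervalIntegral.integral_const_mul]
  exact intervalIntegral.integral_mono_on hab (hu.norm.const_mul r)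
    (intervalIntegrable_supportFn hS.2.1 ⟨0, hS.zero_mem⟩ hu)
    fun t _ => mul_norm_le_supportFn hS.2.1 hr hrS _

/-- Parametrization proportional to `h_S`-length. Where the length function is constant the curve
stands still, so composing with any right inverse of it is well defined. -/
theorem exists_unitSpeedLoop_reparametrization (hS : IsCenteredBody S) {z u : ℝ → PhaseSpace n}
    (hu : IntervalIntegrable u volume 0 (2 * Real.pi))
    (hzu : ∀ a ∈ Icc 0 (2 * Real.pi), ∀ b ∈ Icc 0 (2 * Real.pi), z b - z a = ∫ t in a..b, u t)
    (h0 : z 0 = 0) (hclosed : z (2 * Real.pi) = 0)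
    (hℓ : 0 < ∫ t in (0 : ℝ)..(2 * Real.pi), supportFn S (u t)) :
    ∃ Γ ∈ unitSpeedLoops S, ∃ σ : ℝ → ℝ, ContinuousOn σ (Icc 0 (2 * Real.pi)) ∧
      MonotoneOn σ (Icc 0 (2 * Real.pi)) ∧ σ 0 = 0 ∧ σ (2 * Real.pi) = 2 * Real.pi ∧
      ∀ t ∈ Icc 0 (2 * Real.pi),
        Γ (σ t) = (2 * Real.pi / ∫ t in (0 : ℝ)..(2 * Real.pi), supportFn S (u t)) • z t := by
  have hpi := Real.two_pi_pos
  have hne : S.Nonempty := ⟨0, hS.zero_mem⟩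
  have hhu := intervalIntegrable_supportFn hS.2.1 hne hu
  set ℓ := ∫ t in (0 : ℝ)..(2 * Real.pi), supportFn S (u t)
  have hsub : ∀ a ∈ Icc 0 (2 * Real.pi), ∀ b ∈ Icc 0 (2 * Real.pi),
      uIcc a b ⊆ uIcc 0 (2 * Real.pi) := fun a ha b hb => by
    rw [uIcc_of_le hpi.le]
    exact uIcc_subset_Icc ha hb
  have h0mem : (0 : ℝ) ∈ Icc 0 (2 * Real.pi) := ⟨le_rfl, hpi.le⟩
  have h2mem : 2 * Real.pi ∈ Icc 0 (2 * Real.pi) := ⟨hpi.le, le_rfl⟩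
  let T : ℝ → ℝ := fun t => ∫ s in (0 : ℝ)..t, supportFn S (u s)
  have hTsub : ∀ a ∈ Icc 0 (2 * Real.pi), ∀ b ∈ Icc 0 (2 * Real.pi),
      T b - T a = ∫ s in a..b, supportFn S (u s) := fun a ha b hb =>
    intervalIntegral.integral_interval_sub_left (hhu.mono_set (hsub 0 h0mem b hb))
      (hhu.mono_set (hsub 0 h0mem a ha))
  have hslope : ∀ a ∈ Icc 0 (2 * Real.pi), ∀ b ∈ Icc 0 (2 * Real.pi), a ≤ b →
      supportFn S (z b - z a) ≤ T b - T a := fun a ha b hb hab => by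
    rw [hzu a ha b hb, hTsub a ha b hb]
    exact supportFn_intervalIntegral_le hS.2.1 hne hab (hu.mono_set (hsub a ha b hb))
      (hhu.mono_set (hsub a ha b hb))
  have hTmono : MonotoneOn T (Icc 0 (2 * Real.pi)) := fun a ha b hb hab =>
    sub_nonneg.1 ((hS.supportFn_nonneg _).trans (hslope a ha b hb hab))
  have hTcont : ContinuousOn T (Icc 0 (2 * Real.pi)) := by
    have := intervalIntegral.continuousOn_primitive_interval' hhu (left_mem_uIcc)
    rwa [uIcc_of_le hpi.le] at this
  have hTeq : ∀ a ∈ Icc 0 (2 * Real.pi), ∀ b ∈ Icc 0 (2 * Real.pi), T a = T b → z a = z b := by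
    have : ∀ a ∈ Icc 0 (2 * Real.pi), ∀ b ∈ Icc 0 (2 * Real.pi), a ≤ b → T a = T b → z b = z a :=
      fun a ha b hb hab he => sub_eq_zero.1 (hS.eq_zero_of_supportFn_le_zero
        ((hslope a ha b hb hab).trans (by rw [he, sub_self])))
    intro a ha b hb he
    rcases le_total a b with hab | hab
    · exact (this a ha b hb hab he).symm
    · exact this b hb a ha hab he.symm
  have hT0 : T 0 = 0 := by simp [T]
  have hT2 : T (2 * Real.pi) = ℓ := rfl
  have hk : 0 < 2 * Real.pi / ℓ := by positivity
  let σ : ℝ → ℝ := fun t => 2 * Real.pi / ℓ * T t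
  have hσc : ContinuousOn σ (Icc 0 (2 * Real.pi)) := continuousOn_const.mul hTcont
  have hσm : MonotoneOn σ (Icc 0 (2 * Real.pi)) := fun a ha b hb hab =>
    mul_le_mul_of_nonneg_left (hTmono ha hb hab) hk.le
  have hσ0 : σ 0 = 0 := by simp [σ, hT0]
  have hσ2 : σ (2 * Real.pi) = 2 * Real.pi := by
    simp only [σ, hT2]
    field_simp
  have hsurj : ∀ s ∈ Icc 0 (2 * Real.pi), ∃ t ∈ Icc 0 (2 * Real.pi), σ t = s := fun s hs => by
    have := intermediate_value_Icc hpi.le hσc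
    rw [hσ0, hσ2] at this
    exact this hs
  -- This right inverse of `σ` may jump, but only across intervals on which `z` is constant.
  choose! τ hτmem hτ using hsurj
  have hσT : ∀ a b, σ a = σ b → T a = T b := fun a b h => mul_left_cancel₀ hk.ne' h
  obtain ⟨Γ, hΓ, hΓz⟩ := hS.exists_unitSpeedLoop_of_slopes
    (f := fun s => (2 * Real.pi / ℓ) • z (τ s)) (fun a ha b hb hab => by
      rw [← smul_sub, supportFn_smul hS.2.1 hne hk.le]
      rcases hab.eq_or_lt with rfl | hlt
      · simp [supportFn_zero hne]
      have hle : τ a ≤ τ b := by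
        by_contra hcon
        have := hσm (hτmem b hb) (hτmem a ha) (not_le.1 hcon).le
        rw [hτ a ha, hτ b hb] at this
        linarith
      have h1 := mul_le_mul_of_nonneg_left (hslope _ (hτmem a ha) _ (hτmem b hb) hle) hk.le
      have h2 : 2 * Real.pi / ℓ * (T (τ b) - T (τ a)) = b - a := by
        rw [mul_sub]
        exact congrArg₂ (· - ·) (hτ b hb) (hτ a ha)
      exact h1.trans h2.le) (by
      have e1 : z (τ (2 * Real.pi)) = z (2 * Real.pi) :=
        hTeq _ (hτmem _ h2mem) _ h2mem (hσT _ _ (by rw [hτ _ h2mem, hσ2]))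
      have e2 : z (τ 0) = z 0 := hTeq _ (hτmem _ h0mem) _ h0mem (hσT _ _ (by rw [hτ _ h0mem, hσ0]))
      simp only [e1, e2, hclosed, h0])
  refine ⟨Γ, hΓ, σ, hσc, hσm, hσ0, hσ2, fun t ht => ?_⟩
  have hσt : σ t ∈ Icc 0 (2 * Real.pi) := ⟨hσ0 ▸ hσm h0mem ht ht.1, by
    have := hσm ht h2mem ht.2
    rwa [hσ2] at this⟩
  have e2 : z (τ 0) = z 0 := hTeq _ (hτmem _ h0mem) _ h0mem (hσT _ _ (by rw [hτ _ h0mem, hσ0]))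
  have e3 : z (τ (σ t)) = z t := hTeq _ (hτmem _ hσt) _ ht (hσT _ _ (hτ _ hσt))
  rw [hΓz _ hσt, e2, e3, h0, smul_zero, sub_zero]

/-- Since `σ` is only assumed continuous and monotone, no chain rule is used: both actions are
limits of polygonal sums, and nodes matched by `σ` give the same polygon up to the factor `k`. -/
theorem integral_inner_stdJ_eq_of_reparametrization {z u : ℝ → PhaseSpace n}
    (hz : ContinuousOn z (Icc 0 (2 * Real.pi))) (hu : IntervalIntegrable u volume 0 (2 * Real.pi))
    (hzu : ∀ a ∈ Icc 0 (2 * Real.pi), ∀ b ∈ Icc 0 (2 * Real.pi), z b - z a = ∫ t in a..b, u t)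
    {Γ : ℝ → PhaseSpace n} {C : NNReal} (hΓ : LipschitzWith C Γ) {σ : ℝ → ℝ}
    (hσc : ContinuousOn σ (Icc 0 (2 * Real.pi))) (hσm : MonotoneOn σ (Icc 0 (2 * Real.pi)))
    (hσ0 : σ 0 = 0) (hσ2 : σ (2 * Real.pi) = 2 * Real.pi) {k : ℝ}
    (hΓσ : ∀ t ∈ Icc 0 (2 * Real.pi), Γ (σ t) = k • z t) :
    2 * loopAction Γ = k ^ 2 * ∫ t in (0 : ℝ)..(2 * Real.pi), (inner ℝ (stdJ (z t)) (u t) : ℝ) := by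
  have hpi := Real.two_pi_pos
  have hdΓ := (hΓ.absolutelyContinuousOnInterval' 0 (2 * Real.pi)).intervalIntegrable_deriv_phaseSpace
  set I := ∫ t in (0 : ℝ)..(2 * Real.pi), (inner ℝ (stdJ (z t)) (u t) : ℝ)
  set U := ∫ t in (0 : ℝ)..(2 * Real.pi), ‖u t‖
  set U' := ∫ t in (0 : ℝ)..(2 * Real.pi), ‖deriv Γ t‖
  have key : ∀ ε > 0, |2 * loopAction Γ - k ^ 2 * I| ≤ ε * (|k| * U' + k ^ 2 * U) := by
    intro ε hε
    obtain ⟨δ, hδ, hunif⟩ := Metric.uniformContinuousOn_iff_le.1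
      (isCompact_Icc.uniformContinuousOn_of_continuous hz) ε hε
    obtain ⟨N, hN⟩ := exists_nat_gt (2 * Real.pi / δ)
    have hN0 : (0 : ℝ) < N := lt_trans (by positivity) hN
    -- Clipping at `2π` keeps every index inside the interval, the only place where `σ` is known to
    -- be monotone.
    let t : ℕ → ℝ := fun i => min (2 * Real.pi * i / N) (2 * Real.pi)
    have htm : Monotone t := fun i j hij => min_le_min (two_pi_partition_monotone N hij) le_rfl
    have ht0 : t 0 = 0 := by simp [t, hpi.le]
    have htN : t N = 2 * Real.pi := by
      simp only [t]
      rw [mul_div_assoc, div_self hN0.ne', mul_one, min_self]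
    have htmem : ∀ i, t i ∈ Icc 0 (2 * Real.pi) := fun i => ⟨ht0 ▸ htm i.zero_le, min_le_right _ _⟩
    have hmesh : ∀ i, t (i + 1) - t i ≤ δ := fun i => by
      have h1 : 2 * Real.pi * ((i + 1 : ℕ) : ℝ) / N = 2 * Real.pi * i / N + 2 * Real.pi / N := by
        push_cast
        ring
      have h2 : 2 * Real.pi / N ≤ δ := by
        rw [div_le_iff₀ hN0]
        rw [div_lt_iff₀ hδ] at hN
        linarith
      simp only [t, h1]
      have h3 : (0 : ℝ) ≤ 2 * Real.pi / N := by positivity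
      rcases le_total (2 * Real.pi * i / N) (2 * Real.pi) with h | h
      · rw [min_eq_left h]
        linarith [min_le_left (2 * Real.pi * i / N + 2 * Real.pi / N) (2 * Real.pi)]
      · rw [min_eq_right h]
        linarith [min_le_right (2 * Real.pi * i / N + 2 * Real.pi / N) (2 * Real.pi)]
    have hclose : ∀ i, ∀ s ∈ Icc (t i) (t (i + 1)), ‖z s - z (t i)‖ ≤ ε := fun i s hs => by
      rw [← dist_eq_norm]
      refine hunif s ⟨(htmem i).1.trans hs.1, hs.2.trans (htmem (i + 1)).2⟩ _ (htmem i) ?_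
      rw [Real.dist_eq, abs_of_nonneg (sub_nonneg.2 hs.1)]
      linarith [hs.2, hmesh i]
    have h1 := abs_integral_inner_sub_sum_le hz hu hzu htm ht0 htN (fun i _ => hclose i)
    have h2 := abs_integral_inner_sub_sum_le (T := 2 * Real.pi) (s := fun i => σ (t i)) (N := N)
      (ε := |k| * ε) hΓ.continuous.continuousOn hdΓ (fun a _ b _ => hΓ.sub_eq_integral_deriv a b)
      (fun i j hij => hσm (htmem i) (htmem j) (htm hij)) (by simp only [ht0, hσ0])
      (by simp only [htN, hσ2]) (fun i _ s hs => by
        have hIcc : Icc (t i) (t (i + 1)) ⊆ Icc 0 (2 * Real.pi) :=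
          Icc_subset_Icc (htmem i).1 (htmem (i + 1)).2
        obtain ⟨r, hr, rfl⟩ := intermediate_value_Icc (htm (Nat.le_succ i)) (hσc.mono hIcc) hs
        rw [hΓσ r (hIcc hr), hΓσ _ (htmem i), ← smul_sub, norm_smul, Real.norm_eq_abs]
        exact mul_le_mul_of_nonneg_left (hclose i r hr) (abs_nonneg k))
    have hsum : ∑ i ∈ Finset.range N, (inner ℝ (stdJ (Γ (σ (t i))))
        (Γ (σ (t (i + 1))) - Γ (σ (t i))) : ℝ) = k ^ 2 * ∑ i ∈ Finset.range N,
        (inner ℝ (stdJ (z (t i))) (z (t (i + 1)) - z (t i)) : ℝ) := by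
      rw [Finset.mul_sum]
      refine Finset.sum_congr rfl fun i _ => ?_
      rw [hΓσ _ (htmem i), hΓσ _ (htmem (i + 1)), ← smul_sub, stdJ_smul, real_inner_smul_left,
        real_inner_smul_right]
      ring
    rw [hsum] at h2
    set Q := ∑ i ∈ Finset.range N, (inner ℝ (stdJ (z (t i))) (z (t (i + 1)) - z (t i)) : ℝ)
    have h3 : 2 * loopAction Γ - k ^ 2 * I = ((∫ t in (0 : ℝ)..(2 * Real.pi),
        (inner ℝ (stdJ (Γ t)) (deriv Γ t) : ℝ)) - k ^ 2 * Q) - k ^ 2 * (I - Q) := by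
      rw [loopAction]
      ring
    rw [h3]
    refine (abs_sub _ _).trans ?_
    rw [abs_mul, abs_of_nonneg (sq_nonneg k)]
    have h4 := mul_le_mul_of_nonneg_left h1 (sq_nonneg k)
    calc _ ≤ |k| * ε * U' + k ^ 2 * (ε * U) := add_le_add h2 h4
      _ = _ := by ring
  have hzero : |2 * loopAction Γ - k ^ 2 * I| ≤ 0 := by
    have hlim : Filter.Tendsto (fun ε : ℝ => ε * (|k| * U' + k ^ 2 * U)) (nhdsWithin 0 (Ioi 0))
        (nhds 0) := by
      have : Continuous fun ε : ℝ => ε * (|k| * U' + k ^ 2 * U) := by fun_prop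
      simpa using (this.tendsto 0).mono_left nhdsWithin_le_nhds
    refine ge_of_tendsto hlim ?_
    filter_upwards [self_mem_nhdsWithin] with ε hε using key ε hε
  exact sub_eq_zero.1 (abs_eq_zero.1 (le_antisymm hzero (abs_nonneg _)))

theorem integral_inner_stdJ_le_of_zero (hS : IsCenteredBody S) {a : ℝ}
    (ha : a ∈ upperBounds (loopAction '' unitSpeedLoops S)) {z u : ℝ → PhaseSpace n}
    (hz : ContinuousOn z (Icc 0 (2 * Real.pi))) (hu : IntervalIntegrable u volume 0 (2 * Real.pi))
    (hzu : ∀ a ∈ Icc 0 (2 * Real.pi), ∀ b ∈ Icc 0 (2 * Real.pi), z b - z a = ∫ t in a..b, u t)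
    (h0 : z 0 = 0) (hclosed : z (2 * Real.pi) = 0) :
    ∫ t in (0 : ℝ)..(2 * Real.pi), (inner ℝ (stdJ (z t)) (u t) : ℝ) ≤
      2 * a * ((∫ t in (0 : ℝ)..(2 * Real.pi), supportFn S (u t)) / (2 * Real.pi)) ^ 2 := by
  have hpi := Real.two_pi_pos
  have hℓ0 : 0 ≤ ∫ t in (0 : ℝ)..(2 * Real.pi), supportFn S (u t) :=
    intervalIntegral.integral_nonneg hpi.le fun t _ => hS.supportFn_nonneg _
  rcases hℓ0.eq_or_lt with hℓ | hℓ
  -- Length zero admits no normalization, but then the velocity vanishes almost everywhere and so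
  -- does the action.
  · obtain ⟨r, hr, hru⟩ := integral_norm_le_integral_supportFn hS
    have h1 := hru u 0 (2 * Real.pi) hpi.le hu
    rw [← hℓ] at h1
    have hU : ∫ t in (0 : ℝ)..(2 * Real.pi), ‖u t‖ = 0 := le_antisymm
      (nonpos_of_mul_nonpos_right h1 hr)
      (intervalIntegral.integral_nonneg hpi.le fun t _ => norm_nonneg _)
    obtain ⟨B, hB⟩ := isCompact_Icc.exists_bound_of_continuousOn hz
    rw [← hℓ, zero_div, zero_pow two_ne_zero, mul_zero]
    have h2 : ‖∫ t in (0 : ℝ)..(2 * Real.pi), (inner ℝ (stdJ (z t)) (u t) : ℝ)‖ ≤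
        ∫ t in (0 : ℝ)..(2 * Real.pi), B * ‖u t‖ := by
      refine intervalIntegral.norm_integral_le_of_norm_le hpi.le
        (Filter.Eventually.of_forall fun t ht => ?_) (hu.norm.const_mul B)
      refine (norm_inner_le_norm _ _).trans ?_
      rw [norm_stdJ]
      exact mul_le_mul_of_nonneg_right (hB t (Ioc_subset_Icc_self ht)) (norm_nonneg _)
    rw [intervalIntegral.integral_const_mul, hU, mul_zero] at h2
    exact (le_abs_self _).trans h2
  · obtain ⟨Γ, hΓ, σ, hσc, hσm, hσ0, hσ2, hΓσ⟩ :=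
      exists_unitSpeedLoop_reparametrization hS hu hzu h0 hclosed hℓ
    obtain ⟨C, hC⟩ := hS.exists_lipschitz_unitSpeedLoops
    have h1 := integral_inner_stdJ_eq_of_reparametrization hz hu hzu (hC Γ hΓ) hσc hσm hσ0 hσ2 hΓσ
    have h2 : loopAction Γ ≤ a := ha ⟨Γ, hΓ, rfl⟩
    set ℓ := ∫ t in (0 : ℝ)..(2 * Real.pi), supportFn S (u t)
    set I := ∫ t in (0 : ℝ)..(2 * Real.pi), (inner ℝ (stdJ (z t)) (u t) : ℝ)
    have h3 : I = 2 * loopAction Γ * (ℓ / (2 * Real.pi)) ^ 2 := by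
      rw [h1]
      field_simp
    rw [h3]
    gcongr

/-- The isoperimetric inequality: the action of a closed curve is bounded by the square of its
length, measured by the support function. -/
theorem integral_inner_stdJ_le (hS : IsCenteredBody S) {a : ℝ}
    (ha : a ∈ upperBounds (loopAction '' unitSpeedLoops S)) {z u : ℝ → PhaseSpace n}
    (hz : ContinuousOn z (Icc 0 (2 * Real.pi))) (hu : IntervalIntegrable u volume 0 (2 * Real.pi))
    (hzu : ∀ a ∈ Icc 0 (2 * Real.pi), ∀ b ∈ Icc 0 (2 * Real.pi), z b - z a = ∫ t in a..b, u t)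
    (hclosed : z (2 * Real.pi) = z 0) :
    ∫ t in (0 : ℝ)..(2 * Real.pi), (inner ℝ (stdJ (z t)) (u t) : ℝ) ≤
      2 * a * ((∫ t in (0 : ℝ)..(2 * Real.pi), supportFn S (u t)) / (2 * Real.pi)) ^ 2 := by
  have hpi := Real.two_pi_pos
  -- Translating a closed curve to the origin leaves its action unchanged.
  have h := integral_inner_stdJ_le_of_zero hS ha (z := fun t => z t - z 0) (u := u)
    (hz.sub continuousOn_const) hu (fun a ha b hb => by rw [sub_sub_sub_cancel_right, hzu a ha b hb])
    (sub_self _) (by rw [hclosed, sub_self])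
  refine Eq.trans_le ?_ h
  have hJz : ContinuousOn (fun t => stdJ (z t)) (uIcc 0 (2 * Real.pi)) := by
    rw [uIcc_of_le hpi.le]
    exact continuous_stdJ.comp_continuousOn hz
  simp only [stdJ_sub, inner_sub_left]
  rw [intervalIntegral.integral_sub (intervalIntegrable_inner_continuousOn hJz hu)
    (intervalIntegrable_inner_continuousOn continuousOn_const hu), integral_inner_const_left hu,
    ← hzu 0 ⟨le_rfl, hpi.le⟩ _ ⟨hpi.le, le_rfl⟩, hclosed, sub_self, inner_zero_right, sub_zero]

end Isoperimetric

/-! ### The dual variational principle -/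

section Dual

variable {n : ℕ} {S : Set (PhaseSpace n)}

/-- Action one and the isoperimetric inequality give `ℓ² / 4 ≥ π² / a` for the `h_S`-length `ℓ`;
Cauchy-Schwarz compares `ℓ²` with the dual functional. -/
theorem loopSpace_lower_bound (hS : IsCenteredBody S) {a : ℝ} (ha0 : 0 < a)
    (ha : a ∈ upperBounds (loopAction '' unitSpeedLoops S)) {z : ℝ → PhaseSpace n}
    (hz : z ∈ loopSpace n) : Real.pi ^ 2 / a ≤ Real.pi / 2 * dualFunctional S z := by
  obtain ⟨hper, hac, hmem, -, haction⟩ := hz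
  have hpi := Real.two_pi_pos
  have hpi' := Real.pi_pos
  have hne : S.Nonempty := ⟨0, hS.zero_mem⟩
  have hu := hac.intervalIntegrable_deriv_phaseSpace
  have huIcc : uIcc 0 (2 * Real.pi) = Icc 0 (2 * Real.pi) := uIcc_of_le hpi.le
  have hzu : ∀ a ∈ Icc 0 (2 * Real.pi), ∀ b ∈ Icc 0 (2 * Real.pi),
      z b - z a = ∫ t in a..b, deriv z t := fun a ha b hb =>
    (AbsolutelyContinuousOnInterval.integral_deriv_eq_sub_phaseSpace
      (hac.mono (huIcc ▸ uIcc_subset_Icc ha hb))).symm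
  have hclosed : z (2 * Real.pi) = z 0 := by
    have := hper 0
    rwa [zero_add] at this
  have h1 := integral_inner_stdJ_le hS ha (huIcc ▸ hac.continuousOn) hu hzu hclosed
  have hh := intervalIntegrable_supportFn hS.2.1 hne hu
  obtain ⟨R, hR0, hR⟩ := hS.exists_norm_le
  have hL2 : MemLp (fun t => supportFn S (deriv z t)) 2 (volume.restrict (Ioc 0 (2 * Real.pi))) := by
    refine hmem.of_le_mul (c := R) ((continuous_supportFn hS.2.1 hne).comp_aestronglyMeasurable
      hmem.1) (Filter.Eventually.of_forall fun t => ?_)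
    rw [Real.norm_of_nonneg (hS.supportFn_nonneg _)]
    exact supportFn_le_mul_norm hne hR _
  have hsq : IntervalIntegrable (fun t => supportFn S (deriv z t) ^ 2) volume 0 (2 * Real.pi) :=
    (intervalIntegrable_iff_integrableOn_Ioc_of_le hpi.le).2 hL2.integrable_sq
  set ℓ := ∫ t in (0 : ℝ)..(2 * Real.pi), supportFn S (deriv z t) with hℓ
  have hCS : ℓ ^ 2 / (2 * Real.pi) ≤ dualFunctional S z := by
    -- Cauchy-Schwarz as nonnegativity of a variance; `ℓ / 2π` is the mean of the support function.
    have h2 : 0 ≤ ∫ t in (0 : ℝ)..(2 * Real.pi),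
        (supportFn S (deriv z t) ^ 2 - (2 * (ℓ / (2 * Real.pi)) * supportFn S (deriv z t) -
          (ℓ / (2 * Real.pi)) ^ 2)) :=
      intervalIntegral.integral_nonneg hpi.le fun t _ => by
        have := sq_nonneg (supportFn S (deriv z t) - ℓ / (2 * Real.pi))
        linarith
    rw [intervalIntegral.integral_sub hsq ((hh.const_mul _).sub intervalIntegrable_const),
      intervalIntegral.integral_sub (hh.const_mul _) intervalIntegrable_const,
      intervalIntegral.integral_const_mul, intervalIntegral.integral_const, ← hℓ, sub_zero,
      smul_eq_mul] at h2
    have h3 : 2 * (ℓ / (2 * Real.pi)) * ℓ - 2 * Real.pi * (ℓ / (2 * Real.pi)) ^ 2 =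
        ℓ ^ 2 / (2 * Real.pi) := by
      field_simp
      ring
    rw [dualFunctional]
    linarith
  have h2 : ∫ t in (0 : ℝ)..(2 * Real.pi), (inner ℝ (stdJ (z t)) (deriv z t) : ℝ) = 2 := by
    rw [loopAction] at haction
    linarith
  rw [h2] at h1
  have h4 : Real.pi ^ 2 / a ≤ ℓ ^ 2 / 4 := by
    rw [div_le_iff₀ ha0]
    have h5 : 2 * a * (ℓ / (2 * Real.pi)) ^ 2 * Real.pi ^ 2 = 2 * (ℓ ^ 2 / 4 * a) := by
      field_simp
      ring
    have h6 := mul_le_mul_of_nonneg_right h1 (sq_nonneg Real.pi)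
    linarith
  refine h4.trans ?_
  calc ℓ ^ 2 / 4 = Real.pi / 2 * (ℓ ^ 2 / (2 * Real.pi)) := by
        field_simp
        norm_num
    _ ≤ _ := by gcongr

/-- The minimizer is the maximizing loop scaled by `1 / √a` to have action one, then recentered to
have mean zero. -/
theorem isLeast_dualFunctional (hS : IsCenteredBody S) {a : ℝ} (ha0 : 0 < a)
    (ha : IsGreatest (loopAction '' unitSpeedLoops S) a) :
    IsLeast ((fun z => Real.pi / 2 * dualFunctional S z) '' loopSpace n) (Real.pi ^ 2 / a) := by
  refine ⟨?_, ?_⟩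
  swap
  · rintro _ ⟨z, hz, rfl⟩
    exact loopSpace_lower_bound hS ha0 ha.2 hz
  obtain ⟨Γ, hΓ, hΓa⟩ := ha.1
  obtain ⟨C, hC⟩ := hS.exists_lipschitz_unitSpeedLoops
  have hΓC := hC Γ hΓ
  have hpi := Real.two_pi_pos
  have hpi' := Real.pi_pos
  set k := (Real.sqrt a)⁻¹ with hk
  have hk0 : 0 ≤ k := inv_nonneg.2 (Real.sqrt_nonneg a)
  have hk2 : k ^ 2 = a⁻¹ := by rw [hk, inv_pow, Real.sq_sqrt ha0.le]
  set c := (2 * Real.pi)⁻¹ • ∫ t in (0 : ℝ)..(2 * Real.pi), k • Γ t with hc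
  let z : ℝ → PhaseSpace n := fun t => k • Γ t - c
  have hlip : ∃ D, LipschitzWith D z := by
    refine ⟨_, ((lipschitzWith_smul k).comp hΓC).sub (LipschitzWith.const c)⟩
  obtain ⟨D, hD⟩ := hlip
  have hderiv : ∀ᵐ t, deriv z t = k • deriv Γ t := by
    filter_upwards [hΓC.ae_hasDerivAt] with t ht
    exact ((ht.fun_const_smul k).sub_const c).deriv
  have hzmem : z ∈ loopSpace n := by
    refine ⟨fun t => by simp only [z, hΓ.2.1 t], hD.absolutelyContinuousOnInterval' _ _, ?_, ?_, ?_⟩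
    · exact MemLp.of_bound (measurable_deriv z).aestronglyMeasurable D
        (Filter.Eventually.of_forall fun t => hD.norm_deriv_le' t)
    · have hi : IntervalIntegrable (fun t => k • Γ t) volume 0 (2 * Real.pi) :=
        (hΓC.continuous.const_smul k).intervalIntegrable _ _
      simp only [z]
      rw [intervalIntegral.integral_sub hi intervalIntegrable_const,
        intervalIntegral.integral_const, sub_zero, hc, smul_smul, mul_inv_cancel₀ hpi.ne', one_smul,
        sub_self]
    · have hd := (hΓC.absolutelyContinuousOnInterval' 0 (2 * Real.pi)).intervalIntegrable_deriv_phaseSpace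
      have e1 : ∫ t in (0 : ℝ)..(2 * Real.pi), (inner ℝ (stdJ (z t)) (deriv z t) : ℝ) =
          ∫ t in (0 : ℝ)..(2 * Real.pi), (k ^ 2 * inner ℝ (stdJ (Γ t)) (deriv Γ t) -
            k * inner ℝ (stdJ c) (deriv Γ t)) := by
        refine intervalIntegral.integral_congr_ae ?_
        filter_upwards [hderiv] with t ht _
        rw [ht]
        simp only [z, stdJ_sub, stdJ_smul, inner_sub_left, real_inner_smul_left,
          real_inner_smul_right]
        ring
      rw [loopAction, e1, intervalIntegral.integral_sub
        ((hΓC.intervalIntegrable_inner_stdJ_deriv hΓC _ _).const_mul _)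
        ((intervalIntegrable_inner_continuousOn continuousOn_const hd).const_mul _),
        intervalIntegral.integral_const_mul, intervalIntegral.integral_const_mul,
        integral_inner_const_left hd, ← hΓC.sub_eq_integral_deriv, unitSpeedLoops_closing hΓ,
        sub_self, inner_zero_right, mul_zero, sub_zero, mul_left_comm]
      change k ^ 2 * loopAction Γ = 1
      rw [hk2, hΓa, inv_mul_cancel₀ ha0.ne']
  refine ⟨z, hzmem, le_antisymm ?_ (loopSpace_lower_bound hS ha0 ha.2 hzmem)⟩
  have hle : dualFunctional S z ≤ 2 * Real.pi * a⁻¹ := by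
    have hbound : ∀ᵐ t, supportFn S (deriv z t) ^ 2 ≤ a⁻¹ := by
      filter_upwards [hderiv] with t ht
      rw [ht, supportFn_smul hS.2.1 ⟨0, hS.zero_mem⟩ hk0, mul_pow, hk2]
      refine mul_le_of_le_one_right (inv_nonneg.2 ha0.le) ?_
      exact pow_le_one₀ (hS.supportFn_nonneg _) (supportFn_deriv_le_one hS hΓ t)
    have h := intervalIntegral.norm_integral_le_of_norm_le_const_ae (a := 0) (b := 2 * Real.pi)
      (f := fun t => supportFn S (deriv z t) ^ 2) (C := a⁻¹) (by
        filter_upwards [hbound] with t ht _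
        rwa [Real.norm_of_nonneg (sq_nonneg _)])
    rw [sub_zero, abs_of_pos hpi] at h
    rw [dualFunctional]
    linarith [le_abs_self (∫ t in (0 : ℝ)..(2 * Real.pi), supportFn S (deriv z t) ^ 2),
      Real.norm_eq_abs (∫ t in (0 : ℝ)..(2 * Real.pi), supportFn S (deriv z t) ^ 2)]
  calc Real.pi / 2 * dualFunctional S z ≤ Real.pi / 2 * (2 * Real.pi * a⁻¹) := by gcongr
    _ = Real.pi ^ 2 / a := by
      field_simp

end Dual

/-! ### Lower bound for generalized closed characteristics -/

section LowerBound

variable {n : ℕ} {S : Set (PhaseSpace n)}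

/-- Continuity and one-sided derivatives alone do not make the velocity integrable; the normal cone
does. The body contains a ball of radius `r`, so `⟨γ, ν⟩ ≥ r ‖ν‖`. On short intervals a fixed linear
function of `γ` therefore has a nonnegative right derivative that dominates the speed, and such a
derivative is integrable. -/
theorem intervalIntegrable_deriv_of_genClosedCharacteristic (hS : IsCenteredBody S)
    {γ : ℝ → PhaseSpace n} (hγ : Continuous γ) (hγS : ∀ t, γ t ∈ S) {v : ℝ → PhaseSpace n}
    (hv : v =ᵐ[volume] deriv γ) {ν : ℝ → PhaseSpace n} (hν : ∀ t, ν t ∈ normalCone S (γ t))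
    (hvν : ∀ t, v t = stdJ (ν t)) (hd : ∀ t, HasDerivWithinAt γ (v t) (Ioi t) t) :
    IntervalIntegrable v volume 0 (2 * Real.pi) := by
  have hpi := Real.two_pi_pos
  obtain ⟨r, hr, hrS⟩ := hS.exists_closedBall_subset
  have hvm : AEStronglyMeasurable v volume :=
    (measurable_deriv γ).aestronglyMeasurable.congr hv.symm
  have hlow : ∀ t, r * ‖ν t‖ ≤ inner ℝ (γ t) (ν t) := fun t => by
    rw [inner_eq_supportFn_of_mem_normalCone hS.2.1 (hγS t) (hν t)]
    exact mul_norm_le_supportFn hS.2.1 hr hrS _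
  -- If `γ` moves by at most `r / 2`, replacing `γ t` by `γ a` costs only half of the bound `r ‖ν‖`.
  obtain ⟨δ, hδ, hunif⟩ := Metric.uniformContinuousOn_iff_le.1
    (isCompact_Icc.uniformContinuousOn_of_continuous (hγ.continuousOn (s := Icc 0 (2 * Real.pi))))
    (r / 2) (by positivity)
  have hlocal : ∀ a b, 0 ≤ a → a ≤ b → b ≤ 2 * Real.pi → b - a ≤ δ →
      IntervalIntegrable v volume a b := by
    intro a b ha hab hb hbδ
    have hw : ∀ t ∈ Icc a b, r / 2 * ‖v t‖ ≤ inner ℝ (stdJ (γ a)) (v t) := fun t ht => by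
      have h1 : ‖γ t - γ a‖ ≤ r / 2 := by
        rw [← dist_eq_norm]
        refine hunif t ⟨ha.trans ht.1, ht.2.trans hb⟩ a ⟨ha, hab.trans hb⟩ ?_
        rw [Real.dist_eq, abs_of_nonneg (sub_nonneg.2 ht.1)]
        linarith [ht.2]
      have h2 := real_inner_le_norm (γ t - γ a) (ν t)
      have h3 := mul_le_mul_of_nonneg_right h1 (norm_nonneg (ν t))
      rw [hvν, norm_stdJ, inner_stdJ_stdJ]
      rw [inner_sub_left] at h2
      linarith [hlow t]
    have hg : IntegrableOn (fun t => (inner ℝ (stdJ (γ a)) (v t) : ℝ)) (Ioc a b) := by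
      refine intervalIntegral.integrableOn_deriv_right_of_nonneg
        (g := fun t => (inner ℝ (stdJ (γ a)) (γ t) : ℝ))
        (by fun_prop) (fun t ht => ?_)
        fun t ht => (by positivity : 0 ≤ r / 2 * ‖v t‖).trans (hw t (Ioo_subset_Icc_self ht))
      have := (hasDerivWithinAt_const t (Ioi t) (stdJ (γ a))).inner ℝ (hd t)
      rwa [inner_zero_left, add_zero] at this
    rw [intervalIntegrable_iff_integrableOn_Ioc_of_le hab]
    refine Integrable.mono' (hg.const_mul (2 / r)) hvm.restrict ?_
    filter_upwards [ae_restrict_mem measurableSet_Ioc] with t ht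
    have := hw t (Ioc_subset_Icc_self ht)
    calc ‖v t‖ = 2 / r * (r / 2 * ‖v t‖) := by field_simp
      _ ≤ _ := by gcongr
  obtain ⟨N, hN⟩ := exists_nat_gt (2 * Real.pi / δ)
  have hN0 : (0 : ℝ) < N := lt_trans (by positivity) hN
  have hNδ : 2 * Real.pi / N ≤ δ := by
    rw [div_le_iff₀ hN0]
    rw [div_lt_iff₀ hδ] at hN
    linarith
  have h := IntervalIntegrable.trans_iterate (μ := volume) (f := v)
    (a := fun i : ℕ => 2 * Real.pi * i / N) (n := N) (fun k hk => by
      have hk' : ((k : ℝ) + 1) ≤ N := by exact_mod_cast hk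
      refine hlocal _ _ (by positivity) (two_pi_partition_monotone N (Nat.le_succ k)) ?_ ?_
      · rw [div_le_iff₀ hN0]
        push_cast
        gcongr
      · refine Eq.trans_le ?_ hNδ
        push_cast
        ring)
  have e1 : 2 * Real.pi * ((0 : ℕ) : ℝ) / N = 0 := by simp
  have e2 : 2 * Real.pi * (N : ℝ) / N = 2 * Real.pi := by field_simp
  simpa only [e1, e2] using h

/-- Both `γ` and `-Jγ` have action `ℓ / 2`, where `ℓ` is the `h_S`-length of `-Jγ`. The
isoperimetric inequality becomes `ℓ ≤ 2a (ℓ / 2π)²`, and `ℓ > 0` may be cancelled. -/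
theorem genClosedCharacteristic_lower_bound (hS : IsCenteredBody S) {a : ℝ} (ha0 : 0 < a)
    (ha : a ∈ upperBounds (loopAction '' unitSpeedLoops S)) {γ : ℝ → PhaseSpace n}
    (hγ : IsGenClosedCharacteristic S γ) : Real.pi ^ 2 / a ≤ loopAction γ := by
  obtain ⟨hcont, hper, ⟨s₀, t₀, hst⟩, hfr, ⟨F, hF, hFd⟩, hLR⟩ := hγ
  have hpi := Real.two_pi_pos
  have hγS : ∀ t, γ t ∈ S := fun t => hS.2.1.isClosed.frontier_subset (hfr t)
  choose ν hν hd using fun t => (hLR t).2.imp fun v hv => hv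
  choose ν' hν' hνeq using hν
  have hdiff : ∀ᵐ t, DifferentiableAt ℝ γ t := by
    refine measure_mono_null (fun t ht => ?_) hF
    by_contra htF
    exact ht (hFd t htF)
  have hv : ν =ᵐ[volume] deriv γ := by
    filter_upwards [hdiff] with t ht
    exact (uniqueDiffWithinAt_Ioi t).eq_deriv _ (hd t) ht.hasDerivAt.hasDerivWithinAt
  have hint := intervalIntegrable_deriv_of_genClosedCharacteristic hS hcont hγS hv hν'
    (fun t => (hνeq t).symm) hd
  have hνJ : ∀ t, ν' t = -stdJ (ν t) := fun t => by rw [← hνeq, stdJ_stdJ, neg_neg]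
  have hint' : IntervalIntegrable ν' volume 0 (2 * Real.pi) := by
    have := (intervalIntegrable_clm_comp (stdJL n) hint).neg
    refine this.congr_ae (Filter.Eventually.of_forall fun t => ?_)
    exact (hνJ t).symm
  have huIcc : uIcc 0 (2 * Real.pi) = Icc 0 (2 * Real.pi) := uIcc_of_le hpi.le
  have hFTC : ∀ a ∈ Icc 0 (2 * Real.pi), ∀ b ∈ Icc 0 (2 * Real.pi),
      γ b - γ a = ∫ t in a..b, ν t := fun a ha b hb =>
    (intervalIntegral.integral_eq_sub_of_hasDeriv_right hcont.continuousOn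
      (fun t _ => hd t) (hint.mono_set (huIcc ▸ uIcc_subset_Icc ha hb))).symm
  have hzu : ∀ a ∈ Icc 0 (2 * Real.pi), ∀ b ∈ Icc 0 (2 * Real.pi),
      -stdJ (γ b) - -stdJ (γ a) = ∫ t in a..b, ν' t := fun a ha b hb => by
    have h1 : ∫ t in a..b, ν' t = -stdJ (∫ t in a..b, ν t) := by
      simp only [hνJ, intervalIntegral.integral_neg]
      congr 1
      exact (stdJL n).intervalIntegral_comp_comm (hint.mono_set (huIcc ▸ uIcc_subset_Icc ha hb))
    rw [h1, ← hFTC a ha b hb, stdJ_sub]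
    abel
  have hclosed : γ (2 * Real.pi) = γ 0 := by
    have := hper 0
    rwa [zero_add] at this
  have hiso := integral_inner_stdJ_le hS ha (z := fun t => -stdJ (γ t))
    ((continuous_stdJ.comp hcont).neg.continuousOn) hint' hzu (by simp only [hclosed])
  have hsupp : ∀ t, (inner ℝ (stdJ (-stdJ (γ t))) (ν' t) : ℝ) = supportFn S (ν' t) := fun t => by
    rw [stdJ_neg, stdJ_stdJ, neg_neg]
    exact inner_eq_supportFn_of_mem_normalCone hS.2.1 (hγS t) (hν' t)
  simp only [hsupp] at hiso
  set ℓ := ∫ t in (0 : ℝ)..(2 * Real.pi), supportFn S (ν' t) with hℓ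
  have haction : loopAction γ = ℓ / 2 := by
    have : ∫ t in (0 : ℝ)..(2 * Real.pi), (inner ℝ (stdJ (γ t)) (deriv γ t) : ℝ) = ℓ := by
      refine intervalIntegral.integral_congr_ae ?_
      filter_upwards [hv] with t ht _
      rw [← ht, ← hνeq, inner_stdJ_stdJ]
      exact inner_eq_supportFn_of_mem_normalCone hS.2.1 (hγS t) (hν' t)
    rw [loopAction, this]
    ring
  -- Length zero would force zero total speed, hence a constant loop.
  have hℓpos : 0 < ℓ := by
    by_contra hcon
    obtain ⟨r, hr, hru⟩ := integral_norm_le_integral_supportFn hS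
    have h1 := hru ν' 0 (2 * Real.pi) hpi.le hint'
    have hconst : ∀ t ∈ Icc 0 (2 * Real.pi), γ t = γ 0 := fun t ht => by
      have h2 := hFTC 0 ⟨le_rfl, hpi.le⟩ t ht
      have h3 : ‖γ t - γ 0‖ ≤ ∫ s in (0 : ℝ)..(2 * Real.pi), ‖ν' s‖ := by
        rw [h2]
        refine (intervalIntegral.norm_integral_le_integral_norm ht.1).trans ?_
        have e : ∀ s, ‖ν s‖ = ‖ν' s‖ := fun s => by rw [← hνeq, norm_stdJ]
        simp only [e]
        exact intervalIntegral.integral_mono_interval le_rfl ht.1 ht.2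
          (Filter.Eventually.of_forall fun s => norm_nonneg _) hint'.norm
      have h4 : ∫ s in (0 : ℝ)..(2 * Real.pi), ‖ν' s‖ ≤ 0 :=
        nonpos_of_mul_nonpos_right (h1.trans (not_lt.1 hcon)) hr
      exact sub_eq_zero.1 (norm_le_zero_iff.1 (h3.trans h4))
    have hall : ∀ t, γ t = γ 0 := fun t => by
      obtain ⟨y, hy, hyt⟩ := hper.exists_mem_Ico₀ hpi t
      rw [hyt]
      exact hconst y (Ico_subset_Icc_self hy)
    exact hst ((hall s₀).trans (hall t₀).symm)
  rw [haction, div_le_iff₀ ha0]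
  have hpi' := Real.pi_pos
  have h5 : 2 * a * (ℓ / (2 * Real.pi)) ^ 2 * (Real.pi ^ 2 / ℓ) = ℓ / 2 * a := by
    field_simp
  have h6 := mul_le_mul_of_nonneg_right hiso (by positivity : 0 ≤ Real.pi ^ 2 / ℓ)
  rw [h5, mul_div_cancel₀ _ hℓpos.ne'] at h6
  exact h6

end LowerBound

/-! ### Approximately continuous functions -/

section ApproximateContinuity

/-- The set `A` has density zero at `x`. -/
def HasDensityZero (A : Set ℝ) (x : ℝ) : Prop :=
  ∀ η : ℝ, 0 < η → ∀ᶠ r in nhdsWithin (0 : ℝ) (Ioi 0),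
    volume (A ∩ Metric.closedBall x r) ≤ ENNReal.ofReal (η * r)

/-- `A` is contained in `B` and has density zero outside `B`. -/
def DensityPrec (A B : Set ℝ) : Prop := A ⊆ B ∧ ∀ x ∉ B, HasDensityZero A x

theorem HasDensityZero.union {A B : Set ℝ} {x : ℝ} (hA : HasDensityZero A x)
    (hB : HasDensityZero B x) : HasDensityZero (A ∪ B) x := fun η hη => by
  filter_upwards [hA (η / 2) (by positivity), hB (η / 2) (by positivity), self_mem_nhdsWithin]
    with r h1 h2 hr
  have hr' : 0 < r := hr
  rw [union_inter_distrib_right]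
  refine (measure_union_le _ _).trans ((add_le_add h1 h2).trans ?_)
  rw [← ENNReal.ofReal_add (by positivity) (by positivity)]
  exact ENNReal.ofReal_le_ofReal (by linarith)

theorem hasDensityZero_of_le_sq {A : Set ℝ} {x c : ℝ} (hc : 0 < c)
    (h : ∀ r > 0, volume (A ∩ Metric.closedBall x r) ≤ ENNReal.ofReal (c * r ^ 2)) :
    HasDensityZero A x := fun η hη => by
  filter_upwards [Ioo_mem_nhdsGT (show (0 : ℝ) < η / c by positivity)] with r hr
  refine (h r hr.1).trans (ENNReal.ofReal_le_ofReal ?_)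
  have := hr.2
  rw [lt_div_iff₀ hc] at this
  nlinarith [hr.1]

theorem ae_hasDensityZero {A : Set ℝ} (hA : MeasurableSet A) :
    ∀ᵐ x, x ∉ A → HasDensityZero A x := by
  filter_upwards [Besicovitch.ae_tendsto_measure_inter_div_of_measurableSet volume hA]
    with x hx hxA η hη
  rw [indicator_of_notMem hxA] at hx
  have hη' : (0 : ENNReal) < ENNReal.ofReal (η / 2) := ENNReal.ofReal_pos.2 (by positivity)
  filter_upwards [hx.eventually (gt_mem_nhds hη'), self_mem_nhdsWithin] with r h1 hr
  have hr' : 0 < r := hr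
  rw [Real.volume_closedBall] at h1
  have h2 := (ENNReal.div_le_iff (by simpa using hr') ENNReal.ofReal_ne_top).1 h1.le
  rw [← ENNReal.ofReal_mul (by positivity)] at h2
  refine h2.trans (ENNReal.ofReal_le_ofReal (by linarith))

/-- A null set inside an open set `B` has an open neighbourhood in `B` which is quadratically small
near the complement of `B`. -/
theorem exists_isOpen_small_nhd {N B : Set ℝ} (hN : volume N = 0) (hB : IsOpen B) (hNB : N ⊆ B)
    {c : ℝ} (hc : 0 < c) : ∃ O, IsOpen O ∧ N ⊆ O ∧ O ⊆ B ∧ volume O ≤ ENNReal.ofReal c ∧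
      ∀ x ∉ B, ∀ r > 0, volume (O ∩ Metric.closedBall x r) ≤ ENNReal.ofReal (c * r ^ 2) := by
  have hex : ∀ k : ℕ, ∃ U, N ⊆ U ∧ IsOpen U ∧
      volume U < ENNReal.ofReal (c * (1 / 2) ^ (k + 1) / (k + 1) ^ 2) := fun k => by
    refine Set.exists_isOpen_lt_of_lt N _ ?_
    rw [hN]
    exact ENNReal.ofReal_pos.2 (by positivity)
  choose U hNU hUo hUv using hex
  -- A ball of radius `r` centered off `B` meets layer `k` only if `1 / (k + 1) < r`. The factor `1
  -- / (k + 1)²` in the measure of `U k` is thus absorbed by `r²`, and the factors `2^-(k+1)` sum to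
  -- one.
  let D : ℕ → Set ℝ := fun k => {x | ENNReal.ofReal (1 / (k + 1)) < Metric.infEDist x Bᶜ}
  have hDo : ∀ k, IsOpen (D k) := fun k => isOpen_lt continuous_const Metric.continuous_infEDist
  have hDB : ∀ k, D k ⊆ B := fun k x hx => by
    by_contra hxB
    have : Metric.infEDist x Bᶜ = 0 := Metric.infEDist_zero_of_mem hxB
    simp [D, this] at hx
  have hgeom : ∑' k : ℕ, ENNReal.ofReal ((1 / 2) ^ (k + 1)) = 1 := by
    rw [← ENNReal.ofReal_tsum_of_nonneg (fun k => by positivity)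
      ((summable_nat_add_iff 1).2 summable_geometric_two)]
    have : ∑' k : ℕ, ((1 : ℝ) / 2) ^ (k + 1) = 1 := by
      simp only [pow_succ]
      rw [tsum_mul_right, tsum_geometric_two]
      norm_num
    rw [this, ENNReal.ofReal_one]
  refine ⟨⋃ k, U k ∩ D k, isOpen_iUnion fun k => (hUo k).inter (hDo k), fun x hx => ?_,
    iUnion_subset fun k => inter_subset_right.trans (hDB k), ?_, fun x hx r hr => ?_⟩
  · have hpos : 0 < Metric.infEDist x Bᶜ := by
      rw [pos_iff_ne_zero]
      intro h0
      have := Metric.mem_closure_iff_infEDist_zero.2 h0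
      rw [hB.isClosed_compl.closure_eq] at this
      exact this (hNB hx)
    obtain ⟨k, hk⟩ : ∃ k : ℕ, ENNReal.ofReal (1 / ((k : ℝ) + 1)) < Metric.infEDist x Bᶜ := by
      have hlim : Filter.Tendsto (fun k : ℕ => ENNReal.ofReal (1 / ((k : ℝ) + 1))) Filter.atTop
          (nhds 0) := by
        have := ENNReal.tendsto_ofReal (tendsto_one_div_add_atTop_nhds_zero_nat (𝕜 := ℝ))
        rwa [ENNReal.ofReal_zero] at this
      exact (hlim.eventually (gt_mem_nhds hpos)).exists
    exact mem_iUnion.2 ⟨k, hNU k hx, hk⟩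
  · refine (measure_iUnion_le _).trans ?_
    calc ∑' k, volume (U k ∩ D k) ≤ ∑' k : ℕ, ENNReal.ofReal c * ENNReal.ofReal ((1 / 2) ^ (k + 1)) := by
          refine ENNReal.tsum_le_tsum fun k => (measure_mono inter_subset_left).trans
            ((hUv k).le.trans ?_)
          rw [← ENNReal.ofReal_mul hc.le]
          refine ENNReal.ofReal_le_ofReal (div_le_self (by positivity) ?_)
          exact one_le_pow₀ (by linarith [(k.cast_nonneg : (0 : ℝ) ≤ k)])
      _ = ENNReal.ofReal c := by rw [ENNReal.tsum_mul_left, hgeom, mul_one]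
  · rw [iUnion_inter]
    refine (measure_iUnion_le _).trans ?_
    calc ∑' k, volume (U k ∩ D k ∩ Metric.closedBall x r) ≤
          ∑' k : ℕ, ENNReal.ofReal (c * r ^ 2) * ENNReal.ofReal ((1 / 2) ^ (k + 1)) := by
          refine ENNReal.tsum_le_tsum fun k => ?_
          rcases (U k ∩ D k ∩ Metric.closedBall x r).eq_empty_or_nonempty with he | ⟨y, ⟨-, hyD⟩, hyr⟩
          · rw [he, measure_empty]
            exact zero_le
          have h1 : ENNReal.ofReal (1 / (k + 1)) < ENNReal.ofReal r := by
            refine lt_of_lt_of_le hyD ((Metric.infEDist_le_edist_of_mem hx).trans ?_)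
            rw [edist_dist]
            exact ENNReal.ofReal_le_ofReal hyr
          have h2 : 1 / ((k : ℝ) + 1) < r := (ENNReal.ofReal_lt_ofReal_iff hr).1 h1
          refine (measure_mono (inter_subset_left.trans inter_subset_left)).trans
            ((hUv k).le.trans ?_)
          rw [← ENNReal.ofReal_mul (by positivity)]
          refine ENNReal.ofReal_le_ofReal ?_
          have h3 : (1 / ((k : ℝ) + 1)) ^ 2 ≤ r ^ 2 := by gcongr
          calc c * (1 / 2) ^ (k + 1) / ((k : ℝ) + 1) ^ 2
              = c * (1 / 2) ^ (k + 1) * (1 / ((k : ℝ) + 1)) ^ 2 := by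
                field_simp
            _ ≤ c * (1 / 2) ^ (k + 1) * r ^ 2 := by gcongr
            _ = c * r ^ 2 * (1 / 2) ^ (k + 1) := by ring
      _ = ENNReal.ofReal (c * r ^ 2) := by rw [ENNReal.tsum_mul_left, hgeom, mul_one]

/-- By Lebesgue's density theorem, only a null set of points of `B` outside `A` fails to be a
zero-density point of `A`. Adding to `A` a neighborhood of that null set, quadratically thin near
the complement of `B`, gives the intermediate set. -/
theorem DensityPrec.exists_between {A B : Set ℝ} (hA : IsOpen A) (hB : IsOpen B)
    (h : DensityPrec A B) : ∃ C, IsOpen C ∧ DensityPrec A C ∧ DensityPrec C B := by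
  have hN : volume {x | x ∈ B ∧ x ∉ A ∧ ¬HasDensityZero A x} = 0 := by
    refine measure_mono_null (fun x hx => ?_) (ae_hasDensityZero hA.measurableSet)
    intro hcon
    exact hx.2.2 (hcon hx.2.1)
  obtain ⟨O, hO, hNO, hOB, -, hsmall⟩ := exists_isOpen_small_nhd hN hB (fun x hx => hx.1) one_pos
  refine ⟨A ∪ O, hA.union hO, ⟨subset_union_left, fun x hx => ?_⟩, ⟨union_subset h.1 hOB,
    fun x hx => (h.2 x hx).union (hasDensityZero_of_le_sq one_pos (hsmall x hx))⟩⟩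
  by_cases hxB : x ∈ B
  · by_contra hcon
    exact hx (Or.inr (hNO ⟨hxB, fun hxA => hx (Or.inl hxA), hcon⟩))
  · exact h.2 x hxB

open Classical in
/-- An open set between two open sets `A ≺ B`. -/
noncomputable def densityMid (A B : Set ℝ) : Set ℝ :=
  if h : ∃ C, IsOpen C ∧ DensityPrec A C ∧ DensityPrec C B then h.choose else A

theorem densityMid_spec {A B : Set ℝ} (hA : IsOpen A) (hB : IsOpen B) (h : DensityPrec A B) :
    IsOpen (densityMid A B) ∧ DensityPrec A (densityMid A B) ∧ DensityPrec (densityMid A B) B := by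
  have hex := h.exists_between hA hB
  rw [densityMid, dif_pos hex]
  exact hex.choose_spec

/-- The mean oscillation of `f` at `x` is asymptotically at most `ε`. -/
def OscLE (f : ℝ → ℝ) (x ε : ℝ) : Prop :=
  ∀ η : ℝ, ε < η → ∀ᶠ r in nhdsWithin (0 : ℝ) (Ioi 0),
    ∫⁻ y in Metric.closedBall x r, ‖f y - f x‖ₑ ≤ ENNReal.ofReal (η * r)

theorem oscLE_of_abs_le {f : ℝ → ℝ} {x c : ℝ} (h : ∀ y, |f y - f x| ≤ c) :
    OscLE f x (2 * c) := fun η hη => by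
  filter_upwards [self_mem_nhdsWithin] with r hr
  have hr' : (0 : ℝ) < r := hr
  have hc : 0 ≤ c := (abs_nonneg _).trans (h x)
  calc ∫⁻ y in Metric.closedBall x r, ‖f y - f x‖ₑ
      ≤ ∫⁻ _ in Metric.closedBall x r, ENNReal.ofReal c := lintegral_mono fun y => by
        rw [← ofReal_norm]
        exact ENNReal.ofReal_le_ofReal (h y)
    _ = ENNReal.ofReal (c * (2 * r)) := by
        rw [setLIntegral_const, Real.volume_closedBall, ENNReal.ofReal_mul hc]
    _ ≤ _ := ENNReal.ofReal_le_ofReal (by nlinarith)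

theorem oscLE_zero_of_eventually_eq {f : ℝ → ℝ} {x : ℝ} (h : ∀ᶠ y in nhds x, f y = f x) :
    OscLE f x 0 := fun η hη => by
  obtain ⟨δ, hδ, hball⟩ := Metric.eventually_nhds_iff_ball.1 h
  filter_upwards [Ioo_mem_nhdsGT hδ] with r hr
  rw [setLIntegral_congr_fun (g := fun _ => 0) measurableSet_closedBall fun y hy => ?_]
  · simp
  · simp only
    rw [hball y (Metric.closedBall_subset_ball hr.2 hy), sub_self, enorm_zero]

theorem oscLE_indicator_of_hasDensityZero {A : Set ℝ} (hA : MeasurableSet A) {x : ℝ} (hx : x ∉ A)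
    (h : HasDensityZero A x) : OscLE (A.indicator 1) x 0 := fun η hη => by
  filter_upwards [h η hη] with r hr
  refine le_trans (le_of_eq ?_) hr
  have : ∀ y, ‖A.indicator (1 : ℝ → ℝ) y - A.indicator (1 : ℝ → ℝ) x‖ₑ =
      A.indicator (1 : ℝ → ENNReal) y := fun y => by
    by_cases hy : y ∈ A <;> simp [hx, hy]
  simp only [this]
  rw [lintegral_indicator_one hA, Measure.restrict_apply hA]

theorem OscLE.half_add {f g : ℝ → ℝ} {x ε ε' : ℝ} (hε : 0 ≤ ε) (hε' : 0 ≤ ε')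
    (hfm : Measurable f) (hf : OscLE f x ε)
    (hg : OscLE g x ε') : OscLE (fun y => (f y + g y) / 2) x ((ε + ε') / 2) := fun η hη => by
  have hd : 0 < η - (ε + ε') / 2 := sub_pos.2 hη
  filter_upwards [hf (ε + (η - (ε + ε') / 2)) (by linarith),
    hg (ε' + (η - (ε + ε') / 2)) (by linarith), self_mem_nhdsWithin] with r h1 h2 hr
  have hpt : ∀ y, ‖(f y + g y) / 2 - (f x + g x) / 2‖ₑ ≤
      ENNReal.ofReal (1 / 2) * (‖f y - f x‖ₑ + ‖g y - g x‖ₑ) := fun y => by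
    rw [← ofReal_norm, ← ofReal_norm, ← ofReal_norm,
      ← ENNReal.ofReal_add (norm_nonneg _) (norm_nonneg _), ← ENNReal.ofReal_mul (by norm_num)]
    refine ENNReal.ofReal_le_ofReal ?_
    rw [show (f y + g y) / 2 - (f x + g x) / 2 = 1 / 2 * ((f y - f x) + (g y - g x)) by ring,
      norm_mul, Real.norm_of_nonneg (by norm_num : (0 : ℝ) ≤ 1 / 2)]
    exact mul_le_mul_of_nonneg_left (norm_add_le _ _) (by norm_num)
  have hm : Measurable fun y => ‖f y - f x‖ₑ := (hfm.sub_const _).enorm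
  have h3 : ∫⁻ y in Metric.closedBall x r, ‖(f y + g y) / 2 - (f x + g x) / 2‖ₑ ≤
      ENNReal.ofReal (1 / 2) * (ENNReal.ofReal ((ε + (η - (ε + ε') / 2)) * r) +
        ENNReal.ofReal ((ε' + (η - (ε + ε') / 2)) * r)) := by
    refine (lintegral_mono hpt).trans ?_
    rw [lintegral_const_mul' _ _ ENNReal.ofReal_ne_top, lintegral_add_left hm]
    gcongr
  have hr' : 0 < r := hr
  refine h3.trans (le_of_eq ?_)
  rw [← ENNReal.ofReal_add (by positivity) (by positivity), ← ENNReal.ofReal_mul (by norm_num)]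
  congr 1
  ring

/-- Dyadic interpolation between `0` off `B` and `1` on `A`. -/
noncomputable def densityInterp : ℕ → Set ℝ → Set ℝ → ℝ → ℝ
  | 0, A, _ => A.indicator 1
  | k + 1, A, B => fun x =>
      (densityInterp k A (densityMid A B) x + densityInterp k (densityMid A B) B x) / 2

theorem densityInterp_mem_Icc (k : ℕ) : ∀ (A B : Set ℝ) (x : ℝ),
    densityInterp k A B x ∈ Icc (0 : ℝ) 1 := by
  induction k with
  | zero =>
    intro A B x
    by_cases hx : x ∈ A <;> simp [densityInterp, hx]
  | succ k ih =>
    intro A B x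
    have h1 := ih A (densityMid A B) x
    have h2 := ih (densityMid A B) B x
    simp only [densityInterp, mem_Icc] at *
    constructor <;> linarith [h1.1, h1.2, h2.1, h2.2]

theorem densityInterp_spec (k : ℕ) : ∀ {A B : Set ℝ}, IsOpen A → IsOpen B → DensityPrec A B →
    Measurable (densityInterp k A B) ∧ (∀ x ∈ A, densityInterp k A B x = 1) ∧
      (∀ x ∉ B, densityInterp k A B x = 0) ∧ ∀ x ∉ B, OscLE (densityInterp k A B) x 0 := by
  induction k with
  | zero =>
    intro A B hA hB h
    refine ⟨measurable_one.indicator hA.measurableSet, fun x hx => ?_, fun x hx => ?_,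
      fun x hx => ?_⟩
    · simp [densityInterp, hx]
    · have : x ∉ A := fun h' => hx (h.1 h')
      simp [densityInterp, this]
    · exact oscLE_indicator_of_hasDensityZero hA.measurableSet (fun h' => hx (h.1 h')) (h.2 x hx)
  | succ k ih =>
    intro A B hA hB h
    obtain ⟨hC, hAC, hCB⟩ := densityMid_spec hA hB h
    obtain ⟨m1, a1, b1, o1⟩ := ih hA hC hAC
    obtain ⟨m2, a2, b2, o2⟩ := ih hC hB hCB
    refine ⟨(m1.add m2).div_const 2, fun x hx => ?_, fun x hx => ?_, fun x hx => ?_⟩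
    · simp only [densityInterp]
      rw [a1 x hx, a2 x (hAC.1 hx)]
      norm_num
    · simp only [densityInterp]
      rw [b1 x (fun h' => hx (hCB.1 h')), b2 x hx]
      norm_num
    · have := (o1 x (fun h' => hx (hCB.1 h'))).half_add le_rfl le_rfl m1 (o2 x hx)
      simpa [densityInterp] using this

/-- At any point only one of the two halves can change: on the middle set the outer half is
identically one, off it the inner half is zero. Averaging halves the error at each level. -/
theorem abs_densityInterp_succ_sub_le (k : ℕ) : ∀ {A B : Set ℝ}, IsOpen A → IsOpen B →
    DensityPrec A B → ∀ x, |densityInterp (k + 1) A B x - densityInterp k A B x| ≤ 1 / 2 / 2 ^ k := by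
  induction k with
  | zero =>
    intro A B hA hB h x
    have h1 := densityInterp_mem_Icc 0 A (densityMid A B) x
    have h2 := densityInterp_mem_Icc 0 (densityMid A B) B x
    simp only [densityInterp, mem_Icc] at *
    rw [abs_le]
    constructor <;> norm_num <;> linarith [h1.1, h1.2, h2.1, h2.2]
  | succ k ih =>
    intro A B hA hB h x
    obtain ⟨hC, hAC, hCB⟩ := densityMid_spec hA hB h
    have e : densityInterp (k + 1 + 1) A B x - densityInterp (k + 1) A B x =
        ((densityInterp (k + 1) A (densityMid A B) x - densityInterp k A (densityMid A B) x) +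
        (densityInterp (k + 1) (densityMid A B) B x - densityInterp k (densityMid A B) B x)) / 2 := by
      rw [densityInterp, densityInterp.eq_2 A B k]
      ring
    have h1 := ih hA hC hAC x
    have h2 := ih hC hB hCB x
    have e2 : (1 : ℝ) / 2 / 2 ^ (k + 1) = (1 / 2 / 2 ^ k) / 2 := by
      rw [pow_succ]; field_simp
    rw [e, e2, abs_div, abs_two]
    gcongr
    by_cases hx : x ∈ densityMid A B
    · rw [(densityInterp_spec (k + 1) hC hB hCB).2.1 x hx, (densityInterp_spec k hC hB hCB).2.1 x hx,
        sub_self, add_zero]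
      exact h1
    · rw [(densityInterp_spec (k + 1) hA hC hAC).2.2.1 x hx,
        (densityInterp_spec k hA hC hAC).2.2.1 x hx, sub_self, zero_add]
      exact h2

/-- The same dichotomy for oscillation: on the open middle set the outer half is locally constant,
and off it the inner half has oscillation zero. -/
theorem oscLE_densityInterp (k : ℕ) : ∀ {A B : Set ℝ}, IsOpen A → IsOpen B →
    DensityPrec A B → ∀ x, OscLE (densityInterp k A B) x (2 / 2 ^ k) := by
  induction k with
  | zero =>
    intro A B hA hB h x
    have := oscLE_of_abs_le (f := densityInterp 0 A B) (x := x) (c := 1) fun y => by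
      have h1 := densityInterp_mem_Icc 0 A B x
      have h2 := densityInterp_mem_Icc 0 A B y
      rw [abs_le]
      constructor <;> linarith [h1.1, h1.2, h2.1, h2.2]
    simpa using this
  | succ k ih =>
    intro A B hA hB h x
    obtain ⟨hC, hAC, hCB⟩ := densityMid_spec hA hB h
    have hm := (densityInterp_spec k hA hC hAC).1
    have h0 : (0 : ℝ) ≤ 2 / 2 ^ k := by positivity
    have e2 : (2 : ℝ) / 2 ^ (k + 1) = (2 / 2 ^ k) / 2 := by
      rw [pow_succ]; field_simp
    rw [e2]
    by_cases hx : x ∈ densityMid A B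
    · have h2 : OscLE (densityInterp k (densityMid A B) B) x 0 := by
        refine oscLE_zero_of_eventually_eq ?_
        filter_upwards [hC.mem_nhds hx] with y hy
        rw [(densityInterp_spec k hC hB hCB).2.1 x hx, (densityInterp_spec k hC hB hCB).2.1 y hy]
      have := (ih hA hC hAC x).half_add h0 le_rfl hm h2
      rw [add_zero] at this
      exact this
    · have h1 := (densityInterp_spec k hA hC hAC).2.2.2 x hx
      have := h1.half_add le_rfl h0 hm (ih hC hB hCB x)
      rw [zero_add] at this
      exact this

/-- **Interpolation by approximately continuous functions.** -/
theorem DensityPrec.exists_approxContinuous {A B : Set ℝ} (hA : IsOpen A) (hB : IsOpen B)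
    (h : DensityPrec A B) : ∃ ψ : ℝ → ℝ, Measurable ψ ∧ (∀ x, ψ x ∈ Icc (0 : ℝ) 1) ∧
      (∀ x ∈ A, ψ x = 1) ∧ (∀ x ∉ B, ψ x = 0) ∧ ∀ x, OscLE ψ x 0 := by
  have hd : ∀ x k, dist (densityInterp k A B x) (densityInterp (k + 1) A B x) ≤ 1 / 2 / 2 ^ k :=
    fun x k => by
      rw [dist_comm, Real.dist_eq]
      exact abs_densityInterp_succ_sub_le k hA hB h x
  have hex : ∀ x, ∃ y, Filter.Tendsto (fun k => densityInterp k A B x) Filter.atTop (nhds y) :=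
    fun x => cauchySeq_tendsto_of_complete (cauchySeq_of_le_geometric_two (hd x))
  choose ψ hψ using hex
  have hdist : ∀ x k, |densityInterp k A B x - ψ x| ≤ 1 / 2 ^ k := fun x k => by
    rw [← Real.dist_eq]
    exact dist_le_of_le_geometric_two_of_tendsto (hd x) (hψ x) k
  refine ⟨ψ, ?_, fun x => ?_, fun x hx => ?_, fun x hx => ?_, fun x η hη => ?_⟩
  · exact measurable_of_tendsto_metrizable (fun k => (densityInterp_spec k hA hB h).1)
      (tendsto_pi_nhds.2 hψ)
  · exact isClosed_Icc.mem_of_tendsto (hψ x)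
      (Filter.Eventually.of_forall fun k => densityInterp_mem_Icc k A B x)
  · refine tendsto_nhds_unique (hψ x) (tendsto_const_nhds.congr fun k => ?_)
    rw [(densityInterp_spec k hA hB h).2.1 x hx]
  · refine tendsto_nhds_unique (hψ x) (tendsto_const_nhds.congr fun k => ?_)
    rw [(densityInterp_spec k hA hB h).2.2.1 x hx]
  -- The approximant contributes `3 · 2^-k` and the uniform error `2 · 2^-k` on an interval of
  -- length `2r` contributes `4 · 2^-k`, seven in all.
  · obtain ⟨k, hk⟩ : ∃ k : ℕ, (1 / 2 : ℝ) ^ k < η / 7 :=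
      exists_pow_lt_of_lt_one (by positivity) (by norm_num)
    have hk' : (1 : ℝ) / 2 ^ k < η / 7 := by rwa [one_div_pow] at hk
    have hp : (0 : ℝ) < 1 / 2 ^ k := by positivity
    filter_upwards [oscLE_densityInterp k hA hB h x (3 * (1 / 2 ^ k)) (by
      rw [show (2 : ℝ) / 2 ^ k = 2 * (1 / 2 ^ k) by ring]; linarith), self_mem_nhdsWithin] with r h1 hr
    have hr' : 0 < r := hr
    have hpt : ∀ y, ‖ψ y - ψ x‖ₑ ≤ ‖densityInterp k A B y - densityInterp k A B x‖ₑ +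
        ENNReal.ofReal (2 * (1 / 2 ^ k)) := fun y => by
      rw [← ofReal_norm, ← ofReal_norm, ← ENNReal.ofReal_add (norm_nonneg _) (by positivity)]
      refine ENNReal.ofReal_le_ofReal ?_
      have e1 := abs_le.1 (hdist x k)
      have e2 := abs_le.1 (hdist y k)
      have e3 := abs_le.1 (le_refl |densityInterp k A B y - densityInterp k A B x|)
      rw [Real.norm_eq_abs, Real.norm_eq_abs, abs_le]
      constructor <;> linarith [e1.1, e1.2, e2.1, e2.2, e3.1, e3.2]
    calc ∫⁻ y in Metric.closedBall x r, ‖ψ y - ψ x‖ₑ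
        ≤ ∫⁻ y in Metric.closedBall x r, (‖densityInterp k A B y - densityInterp k A B x‖ₑ +
          ENNReal.ofReal (2 * (1 / 2 ^ k))) := lintegral_mono hpt
      _ ≤ ENNReal.ofReal (3 * (1 / 2 ^ k) * r) + ENNReal.ofReal (2 * (1 / 2 ^ k) * (2 * r)) := by
          rw [lintegral_add_right _ measurable_const, setLIntegral_const, Real.volume_closedBall,
            ← ENNReal.ofReal_mul (by positivity)]
          gcongr
      _ ≤ ENNReal.ofReal (η * r) := by
          rw [← ENNReal.ofReal_add (by positivity) (by positivity)]
          refine ENNReal.ofReal_le_ofReal ?_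
          nlinarith

/-- Zero mean oscillation makes `x` a Lebesgue point with the actual value `ψ x`, so the primitive
is differentiable there even if `ψ` is discontinuous. -/
theorem OscLE.hasDerivAt_integral {ψ : ℝ → ℝ} (hm : Measurable ψ) (hb : ∀ x, ψ x ∈ Icc (0 : ℝ) 1)
    {x : ℝ} (h : OscLE ψ x 0) : HasDerivAt (fun x => ∫ y in (0 : ℝ)..x, ψ y) (ψ x) x := by
  have hint : ∀ a b, IntervalIntegrable ψ volume a b := fun a b => by
    refine (intervalIntegrable_const (c := (1 : ℝ))).mono_fun hm.aestronglyMeasurable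
      (Filter.Eventually.of_forall fun y => ?_)
    change ‖ψ y‖ ≤ ‖(1 : ℝ)‖
    rw [Real.norm_of_nonneg (hb y).1, norm_one]
    exact (hb y).2
  rw [hasDerivAt_iff_isLittleO, Asymptotics.isLittleO_iff]
  intro η hη
  have h1 := h η hη
  obtain ⟨δ, hδ, hball⟩ := mem_nhdsGT_iff_exists_Ioo_subset.1 h1
  filter_upwards [Metric.ball_mem_nhds x hδ] with y hy
  rcases eq_or_ne y x with rfl | hne
  · simp
  have hr : 0 < |y - x| := abs_pos.2 (sub_ne_zero.2 hne)
  have h2 : ∫⁻ z in Metric.closedBall x |y - x|, ‖ψ z - ψ x‖ₑ ≤ ENNReal.ofReal (η * |y - x|) :=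
    hball ⟨hr, by simpa [Real.dist_eq] using hy⟩
  have e1 : (∫ z in (0 : ℝ)..y, ψ z) - (∫ z in (0 : ℝ)..x, ψ z) - (y - x) • ψ x =
      ∫ z in x..y, (ψ z - ψ x) := by
    rw [intervalIntegral.integral_interval_sub_left (hint _ _) (hint _ _),
      intervalIntegral.integral_sub (hint _ _) intervalIntegrable_const,
      intervalIntegral.integral_const]
  rw [e1, Real.norm_eq_abs (y - x)]
  have hsub : uIoc x y ⊆ Metric.closedBall x |y - x| := fun z hz => by
    rw [Metric.mem_closedBall, Real.dist_eq]
    have := uIoc_subset_uIcc hz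
    exact abs_sub_left_of_mem_uIcc this
  rw [intervalIntegral.norm_intervalIntegral_eq]
  have h3 := norm_integral_le_lintegral_norm (μ := volume.restrict (uIoc x y)) fun z => ψ z - ψ x
  refine h3.trans (ENNReal.toReal_le_of_le_ofReal (by positivity) ?_)
  simp only [ofReal_norm]
  exact (lintegral_mono_set hsub).trans h2

end ApproximateContinuity

/-! ### Zahorski's theorem on derivatives vanishing over a null set -/

section Zahorski

/-- Iterate the thin neighborhood construction from the whole line, with geometrically decreasing
constants. -/
theorem exists_nested_small_nhds {E : Set ℝ} (hE : volume E = 0) : ∃ G : ℕ → Set ℝ,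
    (∀ k, IsOpen (G k)) ∧ (∀ k, E ⊆ G k) ∧ (∀ k, G (k + 1) ⊆ G k) ∧
    (∀ k, volume (G (k + 1)) ≤ ENNReal.ofReal ((1 / 2) ^ k)) ∧
    ∀ k, ∀ x ∉ G k, ∀ r > 0,
      volume (G (k + 1) ∩ Metric.closedBall x r) ≤ ENNReal.ofReal ((1 / 2) ^ k * r ^ 2) := by
  have step : ∀ (k : ℕ) (B : {B : Set ℝ // IsOpen B ∧ E ⊆ B}),
      ∃ O : {B : Set ℝ // IsOpen B ∧ E ⊆ B}, O.1 ⊆ B.1 ∧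
        volume O.1 ≤ ENNReal.ofReal ((1 / 2) ^ k) ∧ ∀ x ∉ B.1, ∀ r > 0,
        volume (O.1 ∩ Metric.closedBall x r) ≤ ENNReal.ofReal ((1 / 2) ^ k * r ^ 2) :=
    fun k B => by
      obtain ⟨O, h1, h2, h3, h4, h5⟩ := exists_isOpen_small_nhd hE B.2.1 B.2.2
        (show (0 : ℝ) < (1 / 2) ^ k by positivity)
      exact ⟨⟨O, h1, h2⟩, h3, h4, h5⟩
  choose next h1 h2 h3 using step
  let G : ℕ → {B : Set ℝ // IsOpen B ∧ E ⊆ B} := fun k =>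
    Nat.rec ⟨univ, isOpen_univ, subset_univ _⟩ next k
  exact ⟨fun k => (G k).1, fun k => (G k).2.1, fun k => (G k).2.2, fun k => h1 k (G k),
    fun k => h2 k (G k), fun k => h3 k (G k)⟩

theorem integral_le_of_forall_notMem_eq_zero {ψ : ℝ → ℝ}
    (hb : ∀ x, ψ x ∈ Icc (0 : ℝ) 1) {A : Set ℝ} (hA : MeasurableSet A) (h0 : ∀ x ∉ A, ψ x = 0)
    {a b c : ℝ} (hc : 0 ≤ c) (hv : volume (A ∩ uIcc a b) ≤ ENNReal.ofReal c) :
    |∫ y in a..b, ψ y| ≤ c := by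
  rw [← Real.norm_eq_abs, intervalIntegral.norm_intervalIntegral_eq]
  refine (norm_integral_le_lintegral_norm _).trans (ENNReal.toReal_le_of_le_ofReal hc ?_)
  calc ∫⁻ y in uIoc a b, ENNReal.ofReal ‖ψ y‖
      ≤ ∫⁻ y in uIoc a b, A.indicator 1 y := lintegral_mono fun y => by
        by_cases hy : y ∈ A
        · rw [indicator_of_mem hy, Real.norm_of_nonneg (hb y).1, Pi.one_apply]
          exact ENNReal.ofReal_le_one.2 (hb y).2
        · rw [h0 y hy]; simp
    _ = volume (A ∩ uIoc a b) := by
        rw [lintegral_indicator_one hA, Measure.restrict_apply hA]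
    _ ≤ volume (A ∩ uIcc a b) := measure_mono (inter_subset_inter_right _ uIoc_subset_uIcc)
    _ ≤ _ := hv

/-- **Zahorski's theorem**: every null set is the image of zeros of the derivative of an everywhere
differentiable homeomorphism of the line. -/
theorem exists_differentiable_homeomorph_deriv_eq_zero {E : Set ℝ} (hE : volume E = 0) :
    ∃ h : ℝ → ℝ, StrictMono h ∧ Function.Surjective h ∧ LipschitzWith 1 h ∧ Differentiable ℝ h ∧
      ∀ t, h t ∈ E → deriv h t = 0 := by
  obtain ⟨G, hGo, hEG, hGn, hGv, hGs⟩ := exists_nested_small_nhds hE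
  have hprec : ∀ k, DensityPrec (G (k + 1)) (G k) := fun k =>
    ⟨hGn k, fun x hx => hasDensityZero_of_le_sq (by positivity) (hGs k x hx)⟩
  -- The shift makes `ψ k` vanish off `G (k + 1)`, whose measure is controlled, whereas nothing
  -- bounds the measure of `G 0`.
  have hex := fun k => (hprec (k + 1)).exists_approxContinuous (hGo _) (hGo _)
  choose ψ hψm hψb hψ1 hψ0 hψo using hex
  have hint : ∀ k a b, IntervalIntegrable (ψ k) volume a b := fun k a b => by
    refine (intervalIntegrable_const (c := (1 : ℝ))).mono_fun (hψm k).aestronglyMeasurable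
      (Filter.Eventually.of_forall fun y => ?_)
    change ‖ψ k y‖ ≤ ‖(1 : ℝ)‖
    rw [Real.norm_of_nonneg (hψb k y).1, norm_one]
    exact (hψb k y).2
  let F : ℕ → ℝ → ℝ := fun k x => ∫ y in (0 : ℝ)..x, ψ k y
  have hFd : ∀ k x, HasDerivAt (F k) (ψ k x) x := fun k x =>
    (hψo k x).hasDerivAt_integral (hψm k) (hψb k)
  have hFsub : ∀ k x y, F k y - F k x = ∫ z in x..y, ψ k z := fun k x y =>
    intervalIntegral.integral_interval_sub_left (hint _ _ _) (hint _ _ _)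
  have hFmono : ∀ k, Monotone (F k) := fun k x y hxy => by
    rw [← sub_nonneg, hFsub]
    exact intervalIntegral.integral_nonneg hxy fun z _ => (hψb k z).1
  have hFbd : ∀ k x y, |F k y - F k x| ≤ (1 / 2) ^ k := fun k x y => by
    rw [hFsub]
    exact integral_le_of_forall_notMem_eq_zero (hψb k) (hGo (k + 1)).measurableSet (hψ0 k)
      (by positivity) ((measure_mono inter_subset_left).trans (hGv k))
  have hF0 : ∀ k, F k 0 = 0 := fun k => intervalIntegral.integral_same
  have hFbd0 : ∀ k x, ‖F k x‖ ≤ (1 / 2) ^ k := fun k x => by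
    have := hFbd k 0 x
    rwa [hF0, sub_zero] at this
  have hFsum : ∀ x, Summable fun k => F k x := fun x =>
    Summable.of_norm_bounded summable_geometric_two fun k => hFbd0 k x
  -- The desired homeomorphism is the inverse of `g`. The summand `x` makes `g` expanding, and the
  -- derivatives of the partial sums grow without bound on the intersection of the `G k`, which
  -- contains `E`.
  let g : ℝ → ℝ := fun x => x + ∑' k, F k x
  have hgsub : ∀ x y, g y - g x = (y - x) + ∑' k, (F k y - F k x) := fun x y => by
    rw [(hFsum y).tsum_sub (hFsum x)]
    simp only [g]
    ring
  have hgge : ∀ x y (M : ℕ), x ≤ y →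
      (y - x) + ∑ k ∈ Finset.range M, (F k y - F k x) ≤ g y - g x := fun x y M hxy => by
    rw [hgsub]
    gcongr
    exact ((hFsum y).sub (hFsum x)).sum_le_tsum _ fun k _ => sub_nonneg.2 (hFmono k hxy)
  have hgge1 : ∀ x y, x ≤ y → y - x ≤ g y - g x := fun x y hxy => by simpa using hgge x y 0 hxy
  have hgabs : ∀ x y (M : ℕ), ∑ k ∈ Finset.range M, |F k y - F k x| ≤ |g y - g x| :=
    fun x y M => by
      rcases le_total x y with hxy | hxy
      · have := hgge x y M hxy
        rw [Finset.sum_congr rfl fun k _ => abs_of_nonneg (sub_nonneg.2 (hFmono k hxy))]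
        exact le_trans (by linarith) (le_abs_self _)
      · have := hgge y x M hxy
        rw [abs_sub_comm, Finset.sum_congr rfl fun k _ => by
          rw [abs_sub_comm, abs_of_nonneg (sub_nonneg.2 (hFmono k hxy))]]
        exact le_trans (by linarith) (le_abs_self _)
  have hgmono : StrictMono g := fun x y hxy => by have := hgge1 x y hxy.le; linarith
  have hgc : Continuous g := continuous_id.add
    (continuous_tsum (fun k => continuous_iff_continuousAt.2 fun x => (hFd k x).continuousAt)
      summable_geometric_two hFbd0)
  have hg0 : g 0 = 0 := by simp [g, hF0]
  have hgsurj : Function.Surjective g := by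
    refine hgc.surjective ?_ ?_
    · refine Filter.tendsto_atTop_mono' _ ?_ Filter.tendsto_id
      filter_upwards [Filter.eventually_ge_atTop 0] with x hx
      have := hgge1 0 x hx
      simp only [id]; linarith
    · refine Filter.tendsto_atBot_mono' _ ?_ Filter.tendsto_id
      filter_upwards [Filter.eventually_le_atBot 0] with x hx
      have := hgge1 x 0 hx
      simp only [id]; linarith
  let e := hgmono.orderIsoOfSurjective g hgsurj
  have hge : ∀ t, g (e.symm t) = t := fun t => e.apply_symm_apply t
  have heg : ∀ x, e.symm (g x) = x := fun x => e.symm_apply_apply x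
  have hec : Continuous e.symm := e.symm.continuous
  -- the two kinds of points
  have hA : ∀ x K, x ∉ G K → ∃ d, 1 ≤ d ∧ HasDerivAt g d x := fun x K hxK => by
    refine ⟨1 + ∑ k ∈ Finset.range K, ψ k x,
      le_add_of_nonneg_right (Finset.sum_nonneg fun k _ => (hψb k x).1), ?_⟩
    have hnot : ∀ k, x ∉ G (k + K) := fun k => by
      induction k with
      | zero => simpa using hxK
      | succ k ih => exact fun h => ih (hGn _ (by rwa [Nat.succ_add_eq_add_succ] at h))
    let T : ℝ → ℝ := fun y => ∑' k, F (k + K) y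
    have hsumT : ∀ y, Summable fun k => F (k + K) y := fun y =>
      (summable_nat_add_iff K).2 (hFsum y)
    -- Off `G K` every later term is quadratically small near `x`, so the tail has derivative zero
    -- and the derivative of `g` is a finite sum.
    have hT : HasDerivAt T 0 x := by
      rw [hasDerivAt_iff_isLittleO, Asymptotics.isLittleO_iff]
      intro η hη
      filter_upwards [Metric.ball_mem_nhds x (show 0 < η / 2 by positivity)] with y hy
      rw [Metric.mem_ball, Real.dist_eq] at hy
      rcases eq_or_ne y x with rfl | hne
      · simp
      have hr : 0 < |y - x| := abs_pos.2 (sub_ne_zero.2 hne)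
      have hb : ∀ k, ‖F (k + K) y - F (k + K) x‖ ≤ (1 / 2) ^ k * |y - x| ^ 2 := fun k => by
        rw [hFsub, Real.norm_eq_abs]
        refine (integral_le_of_forall_notMem_eq_zero (hψb _) (hGo (k + K + 1)).measurableSet
          (hψ0 _) (c := (1 / 2) ^ (k + K) * |y - x| ^ 2) (by positivity) ?_).trans ?_
        · refine (measure_mono (inter_subset_inter_right _ fun z hz => ?_)).trans
            (hGs (k + K) x (hnot k) _ hr)
          rw [Metric.mem_closedBall, Real.dist_eq]
          exact abs_sub_left_of_mem_uIcc hz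
        · gcongr ?_ * _
          exact pow_le_pow_of_le_one (by norm_num) (by norm_num) (Nat.le_add_right _ _)
      have hs : HasSum (fun k : ℕ => ((1 : ℝ) / 2) ^ k * |y - x| ^ 2) (2 * |y - x| ^ 2) :=
        hasSum_geometric_two.mul_right _
      have h1 := tsum_of_norm_bounded hs hb
      rw [(hsumT y).tsum_sub (hsumT x)] at h1
      rw [smul_zero, sub_zero]
      refine h1.trans ?_
      rw [Real.norm_eq_abs]
      nlinarith
    have hg' : g = fun y => (y + ∑ k ∈ Finset.range K, F k y) + T y := funext fun y => by
      simp only [g, T]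
      rw [← (hFsum y).sum_add_tsum_nat_add K, add_assoc]
    rw [hg']
    have := ((hasDerivAt_id x).add (HasDerivAt.fun_sum (u := Finset.range K)
      fun k _ => hFd k x)).add hT
    rw [add_zero] at this
    exact this
  have hB : ∀ x, (∀ k, x ∈ G k) → HasDerivAt e.symm 0 (g x) := fun x hx => by
    rw [hasDerivAt_iff_isLittleO, Asymptotics.isLittleO_iff]
    intro η hη
    -- Every `F k` has derivative one at `x`. Near `x` the first `M` terms each contribute slope at
    -- least one half, so `g` expands by a factor of at least `1 / η`.
    obtain ⟨M, hM⟩ := exists_nat_gt (2 / η)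
    have hMpos : (0 : ℝ) < M := lt_trans (by positivity) hM
    have hev : ∀ᶠ y in nhds x, ∀ k ∈ Finset.range M, |y - x| / 2 ≤ |F k y - F k x| := by
      rw [Filter.eventually_all_finset]
      intro k _
      have hd := hFd k x
      rw [hψ1 k x (hx _), hasDerivAt_iff_isLittleO, Asymptotics.isLittleO_iff] at hd
      filter_upwards [hd (show (0 : ℝ) < 1 / 2 by norm_num)] with y hy
      rw [smul_eq_mul, mul_one, Real.norm_eq_abs, Real.norm_eq_abs, abs_sub_comm] at hy
      have := abs_sub_abs_le_abs_sub (y - x) (F k y - F k x)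
      linarith
    have h1 : Filter.Tendsto e.symm (nhds (g x)) (nhds x) := by
      have := hec.tendsto (g x)
      rwa [heg] at this
    filter_upwards [h1.eventually hev] with t ht
    rw [smul_zero, sub_zero, heg, Real.norm_eq_abs, Real.norm_eq_abs]
    have h2 := hgabs x (e.symm t) M
    have h3 := Finset.sum_le_sum ht
    rw [Finset.sum_const, Finset.card_range, nsmul_eq_mul] at h3
    rw [hge] at h2
    have h4 : |e.symm t - x| * (2 / η) ≤ |e.symm t - x| * M := by gcongr
    have h5 : |e.symm t - x| = η * (|e.symm t - x| * (2 / η) / 2) := by field_simp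
    rw [h5]
    gcongr
    linarith
  refine ⟨e.symm, e.symm.strictMono, e.symm.surjective, ?_, fun t => ?_, fun t ht => ?_⟩
  · refine LipschitzWith.of_dist_le_mul fun s t => ?_
    rw [Real.dist_eq, Real.dist_eq, NNReal.coe_one, one_mul]
    rcases le_total s t with hst | hst
    · have := hgge1 _ _ (e.symm.monotone hst)
      rw [hge, hge] at this
      rw [abs_sub_comm, abs_of_nonneg (sub_nonneg.2 (e.symm.monotone hst)), abs_sub_comm,
        abs_of_nonneg (sub_nonneg.2 hst)]
      exact this
    · have := hgge1 _ _ (e.symm.monotone hst)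
      rw [hge, hge] at this
      rw [abs_of_nonneg (sub_nonneg.2 (e.symm.monotone hst)), abs_of_nonneg (sub_nonneg.2 hst)]
      exact this
  · obtain ⟨x, rfl⟩ := hgsurj t
    by_cases hx : ∀ k, x ∈ G k
    · exact (hB x hx).differentiableAt
    · push Not at hx
      obtain ⟨K, hK⟩ := hx
      obtain ⟨d, hd1, hd⟩ := hA x K hK
      have hd' : HasDerivAt g d (e.symm (g x)) := by rwa [heg]
      exact (hd'.of_local_left_inverse hec.continuousAt (by linarith)
        (Filter.Eventually.of_forall hge)).differentiableAt
  · have := hB (e.symm t) fun k => hEG k ht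
    rw [hge] at this
    exact this.deriv

end Zahorski

/-! ### From weak characteristics to generalized closed characteristics -/

section Characteristics

variable {n : ℕ} {S : Set (PhaseSpace n)}

theorem HasDerivWithinAt.of_shift {f : ℝ → PhaseSpace n} {v : PhaseSpace n} {s t c : ℝ}
    {A B : Set ℝ} (hf : Function.Periodic f c) (hst : t = s + c) (hAB : ∀ x ∈ B, x - c ∈ A)
    (h : HasDerivWithinAt f v A s) : HasDerivWithinAt f v B t := by
  subst hst
  have h1 : HasDerivWithinAt (fun x : ℝ => x - c) 1 B (s + c) :=
    ((hasDerivAt_id _).sub_const c).hasDerivWithinAt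
  have h2 := HasDerivWithinAt.scomp_of_eq (s + c) h h1 hAB (by simp)
  rw [one_smul] at h2
  refine h2.congr (fun x _ => ?_) ?_ <;> exact (hf.sub_eq _).symm

/-- Closing up an arc whose end points agree. -/
theorem exists_periodic_extension {f : ℝ → PhaseSpace n} {L : ℝ} (hL : 0 < L) (hf : f 0 = f L) :
    ∃ η : ℝ → PhaseSpace n, Function.Periodic η L ∧ EqOn η f (Icc 0 L) ∧
      (∀ t, ∃ s ∈ Ico 0 L, η t = f s ∧
        ∀ v, HasDerivWithinAt f v (Ioi s) s → HasDerivWithinAt η v (Ioi t) t) ∧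
      (∀ t, ∃ s ∈ Ioc 0 L, η t = f s ∧
        ∀ v, HasDerivWithinAt f v (Iio s) s → HasDerivWithinAt η v (Iio t) t) := by
  let η : ℝ → PhaseSpace n := fun t => f (toIcoMod hL 0 t)
  have hper : Function.Periodic η L := fun t => by simp [η]
  have heq : EqOn η f (Icc 0 L) := fun t ht => by
    rcases eq_or_lt_of_le ht.2 with rfl | h
    · simp only [η]
      rw [show toIcoMod hL 0 t = 0 by simpa using toIcoMod_apply_right hL 0, hf]
    · simp only [η]
      rw [(toIcoMod_eq_self hL).2 ⟨ht.1, by simpa using h⟩]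
  refine ⟨η, hper, heq, fun t => ?_, fun t => ?_⟩
  · have hs := toIcoMod_mem_Ico' hL t
    have ht : t = toIcoMod hL 0 t + toIcoDiv hL 0 t • L := (toIcoMod_add_toIcoDiv_zsmul hL 0 t).symm
    refine ⟨toIcoMod hL 0 t, hs, rfl, fun v hv => ?_⟩
    refine HasDerivWithinAt.of_shift (hper.zsmul _) ht (A := Ioi (toIcoMod hL 0 t))
      (fun x hx => ?_) ?_
    · have : t < x := hx
      simp only [mem_Ioi]; linarith
    · refine hv.congr_of_eventuallyEq ?_ (heq (Ico_subset_Icc_self hs))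
      filter_upwards [Ioo_mem_nhdsGT hs.2] with x hx
      exact heq ⟨hs.1.trans hx.1.le, hx.2.le⟩
  · have hs := toIocMod_mem_Ioc hL 0 t
    rw [zero_add] at hs
    have ht : t = toIocMod hL 0 t + toIocDiv hL 0 t • L := (toIocMod_add_toIocDiv_zsmul hL 0 t).symm
    refine ⟨toIocMod hL 0 t, hs, ?_, fun v hv => ?_⟩
    · rw [← heq (Ioc_subset_Icc_self hs)]
      conv_lhs => rw [ht]
      exact hper.zsmul _ _
    refine HasDerivWithinAt.of_shift (hper.zsmul _) ht (A := Iio (toIocMod hL 0 t))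
      (fun x hx => ?_) ?_
    · have : x < t := hx
      simp only [mem_Iio]; linarith
    · refine hv.congr_of_eventuallyEq ?_ (heq (Ioc_subset_Icc_self hs))
      filter_upwards [Ioo_mem_nhdsLT hs.1] with x hx
      exact heq ⟨hx.1.le, hx.2.le.trans hs.2⟩

/-- A weak characteristic has an everywhere differentiable reparametrization. -/
theorem IsWeakCharacteristic.exists_differentiable_reparam {a : ℝ} {γ : ℝ → PhaseSpace n}
    (hγ : IsWeakCharacteristic S a γ) : ∃ h : ℝ → ℝ, (∃ C, LipschitzWith C h) ∧
      Differentiable ℝ h ∧ h 0 = 0 ∧ h (2 * Real.pi) = 2 * Real.pi ∧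
      ∀ t, ∃ ν ∈ normalCone S (γ (h t)), HasDerivAt (fun s => γ (h s)) (stdJ ν) t ∧
        (inner ℝ (γ (h t)) ν : ℝ) = Real.pi / a * deriv h t := by
  obtain ⟨⟨C, hC⟩, hper, hfr, hae⟩ := hγ
  -- The null set is the set of times at which the inclusion fails.
  obtain ⟨k, hkm, hks, hkL, hkd, hkE⟩ := exists_differentiable_homeomorph_deriv_eq_zero hae
  obtain ⟨α, hα⟩ := hks 0
  obtain ⟨β, hβ⟩ := hks (2 * Real.pi)
  have hαβ : α < β := hkm.lt_iff_lt.1 (by rw [hα, hβ]; exact Real.two_pi_pos)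
  let c : ℝ := (β - α) / (2 * Real.pi)
  have hc : 0 < c := div_pos (sub_pos.2 hαβ) Real.two_pi_pos
  have hcd : ∀ t, HasDerivAt (fun t : ℝ => α + t * c) c t := fun t => by
    simpa using ((hasDerivAt_id t).mul_const c).const_add α
  let h : ℝ → ℝ := fun t => k (α + t * c)
  have hhd : ∀ t, HasDerivAt h (deriv k (α + t * c) * c) t := fun t =>
    HasDerivAt.comp t (hkd (α + t * c)).hasDerivAt (hcd t)
  have hhmono : StrictMono h := fun s t hst => hkm (by nlinarith)
  refine ⟨h, ⟨1 * Real.toNNReal c, hkL.comp (LipschitzWith.of_dist_le_mul fun s t => ?_)⟩,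
    fun t => (hhd t).differentiableAt, ?_, ?_, fun t => ?_⟩
  · rw [Real.dist_eq, Real.dist_eq, Real.coe_toNNReal _ hc.le,
      show α + s * c - (α + t * c) = c * (s - t) by ring, abs_mul, abs_of_pos hc]
  · simp [h, hα]
  · have : α + 2 * Real.pi * c = β := by
      simp only [c]
      field_simp
      ring
    simp only [h]
    rw [this, hβ]
  · by_cases hE : ∃ ν ∈ normalCone S (γ (h t)), HasDerivAt γ (stdJ ν) (h t) ∧
        (inner ℝ (γ (h t)) ν : ℝ) = Real.pi / a
    · obtain ⟨ν, hν, hd, hi⟩ := hE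
      refine ⟨deriv h t • ν, smul_mem_normalCone hhmono.monotone.deriv_nonneg hν, ?_, ?_⟩
      · rw [stdJ_smul]
        exact hd.scomp t (hhd t).differentiableAt.hasDerivAt
      · rw [inner_smul_right, hi, mul_comm]
    -- At an exceptional time the parameter slows to a stop. As `γ` is Lipschitz, the composite has
    -- derivative zero, and zero lies in every normal cone.
    · have h0 : deriv h t = 0 := by
        rw [(hhd t).deriv, hkE _ hE, zero_mul]
      refine ⟨0, zero_mem_normalCone S _, ?_, by rw [inner_zero_right, h0, mul_zero]⟩
      have hd := (hhd t).differentiableAt.hasDerivAt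
      rw [h0, hasDerivAt_iff_isLittleO] at hd
      rw [stdJ_zero, hasDerivAt_iff_isLittleO]
      simp only [smul_zero, sub_zero] at hd ⊢
      refine Asymptotics.IsBigO.trans_isLittleO ?_ hd
      refine Asymptotics.IsBigO.of_bound C (Filter.Eventually.of_forall fun s => ?_)
      have := hC.dist_le_mul (h s) (h t)
      rwa [dist_eq_norm, dist_eq_norm] at this

/-- Closing up the differentiable arc may leave different left and right derivatives at multiples of
`2π`, a countable set. The action density is `π / a` times `deriv h`, whose integral is `2π`. -/
theorem IsWeakCharacteristic.exists_isGenClosedCharacteristic {a : ℝ} (ha : 0 < a)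
    {γ : ℝ → PhaseSpace n} (hγ : IsWeakCharacteristic S a γ) :
    ∃ η, IsGenClosedCharacteristic S η ∧ loopAction η = Real.pi ^ 2 / a := by
  obtain ⟨h, ⟨C, hC⟩, hhd, h0, h1, hder⟩ := hγ.exists_differentiable_reparam
  have hper := hγ.2.1
  have hfr := hγ.2.2.1
  have hpi := Real.two_pi_pos
  choose ν hν hd hi using hder
  let f : ℝ → PhaseSpace n := fun s => γ (h s)
  have hf : f 0 = f (2 * Real.pi) := by
    simp only [f]
    rw [h0, h1]
    simpa using (hper 0).symm
  obtain ⟨η, hηp, hηf, hηr, hηl⟩ := exists_periodic_extension hpi hf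
  have hright : ∀ t, ∃ v ∈ stdJ '' normalCone S (η t), HasDerivWithinAt η v (Ioi t) t := fun t => by
    obtain ⟨s, hs, hst, hsd⟩ := hηr t
    rw [hst]
    exact ⟨_, mem_image_of_mem _ (hν s), hsd _ (hd s).hasDerivWithinAt⟩
  have hleft : ∀ t, ∃ v ∈ stdJ '' normalCone S (η t), HasDerivWithinAt η v (Iio t) t := fun t => by
    obtain ⟨s, hs, hst, hsd⟩ := hηl t
    rw [hst]
    exact ⟨_, mem_image_of_mem _ (hν s), hsd _ (hd s).hasDerivWithinAt⟩
  have hηd : ∀ t ∈ Ioo 0 (2 * Real.pi), HasDerivAt η (stdJ (ν t)) t := fun t ht => by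
    refine (hd t).congr_of_eventuallyEq ?_
    filter_upwards [Ioo_mem_nhds ht.1 ht.2] with s hs
    exact hηf (Ioo_subset_Icc_self hs)
  have hact : loopAction η = Real.pi ^ 2 / a := by
    have e1 : ∫ t in (0 : ℝ)..(2 * Real.pi), (inner ℝ (stdJ (η t)) (deriv η t) : ℝ) =
        ∫ t in (0 : ℝ)..(2 * Real.pi), Real.pi / a * deriv h t := by
      rw [intervalIntegral.integral_of_le hpi.le, intervalIntegral.integral_of_le hpi.le,
        integral_Ioc_eq_integral_Ioo, integral_Ioc_eq_integral_Ioo]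
      refine setIntegral_congr_fun measurableSet_Ioo fun t ht => ?_
      rw [(hηd t ht).deriv, inner_stdJ_stdJ, hηf (Ioo_subset_Icc_self ht)]
      exact hi t
    have hAC := hC.absolutelyContinuousOnInterval' (a := 0) (b := 2 * Real.pi)
    rw [loopAction, e1, intervalIntegral.integral_const_mul, hAC.integral_deriv_eq_sub, h0, h1]
    field_simp
    ring
  refine ⟨η, ⟨?_, hηp, ?_, fun t => ?_, ⟨range fun k : ℤ => k • (2 * Real.pi),
    (countable_range _).measure_zero _, fun t ht => ?_⟩, fun t => ⟨hleft t, hright t⟩⟩, hact⟩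
  · refine continuous_iff_continuousAt.2 fun t => continuousAt_iff_continuous_left'_right'.2 ?_
    obtain ⟨v, -, hv⟩ := hleft t
    obtain ⟨w, -, hw⟩ := hright t
    exact ⟨hv.continuousWithinAt, hw.continuousWithinAt⟩
  · by_contra hcon
    push Not at hcon
    have hconst : η = fun _ => η 0 := funext fun t => hcon t 0
    have : deriv η = 0 := by rw [hconst]; exact deriv_const' _
    rw [loopAction, this] at hact
    simp only [Pi.zero_apply, inner_zero_right, intervalIntegral.integral_zero, mul_zero] at hact
    have : 0 < Real.pi ^ 2 / a := by positivity
    linarith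
  · obtain ⟨s, hs, hst, -⟩ := hηr t
    rw [hst]
    exact hfr _
  · have hs := toIcoMod_mem_Ico' hpi t
    have hts : t = toIcoMod hpi 0 t + toIcoDiv hpi 0 t • (2 * Real.pi) :=
      (toIcoMod_add_toIcoDiv_zsmul hpi 0 t).symm
    have hne : toIcoMod hpi 0 t ≠ 0 := fun h' => ht ⟨toIcoDiv hpi 0 t, by
      rw [h', zero_add] at hts; exact hts.symm⟩
    have hd := hηd _ ⟨lt_of_le_of_ne hs.1 hne.symm, hs.2⟩
    rw [zsmul_eq_mul] at hts
    rw [← hηp.hasDerivAt_iff (toIcoDiv hpi 0 t), ← hts] at hd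
    exact hd.differentiableAt

end Characteristics

/-! ### Normal cones and characteristic lines at smooth boundary points -/

section SmoothBoundary

variable {n : ℕ} {S : Set (PhaseSpace n)}

/-- Farkas' lemma for one inequality. The part of `u` orthogonal to `p`, pushed slightly into the
open half-space, is an allowed test vector and forces that part to vanish. -/
theorem exists_eq_smul_of_inner_le {p u : PhaseSpace n} (hp : p ≠ 0)
    (h : ∀ v, (inner ℝ p v : ℝ) < 0 → (inner ℝ u v : ℝ) ≤ 0) : ∃ c : ℝ, 0 ≤ c ∧ u = c • p := by
  have hpp : 0 < (inner ℝ p p : ℝ) := real_inner_self_pos.2 hp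
  have h0 : 0 ≤ (inner ℝ u p : ℝ) := by
    have := h (-p) (by rw [inner_neg_right]; linarith)
    rw [inner_neg_right] at this
    linarith
  let c : ℝ := inner ℝ u p / inner ℝ p p
  have hcp : c * inner ℝ p p = inner ℝ u p := div_mul_cancel₀ _ hpp.ne'
  refine ⟨c, div_nonneg h0 hpp.le, ?_⟩
  have hpw : (inner ℝ p (u - c • p) : ℝ) = 0 := by
    rw [inner_sub_right, inner_smul_right, hcp, real_inner_comm, sub_self]
  have hww : (inner ℝ (u - c • p) (u - c • p) : ℝ) = inner ℝ u (u - c • p) := by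
    conv_lhs => rw [inner_sub_left, inner_smul_left, hpw]
    simp
  have hδ : ∀ δ > 0, (inner ℝ u (u - c • p) : ℝ) ≤ δ * inner ℝ u p := fun δ hδ => by
    have := h (u - c • p - δ • p) (by
      rw [inner_sub_right, hpw, inner_smul_right]; nlinarith)
    rw [inner_sub_right, inner_smul_right u p δ] at this
    linarith
  have hle : (inner ℝ u (u - c • p) : ℝ) ≤ 0 := by
    refine le_of_forall_pos_le_add fun ε hε => ?_
    rw [zero_add]
    refine (hδ (ε / (inner ℝ u p + 1)) (by positivity)).trans ?_
    rw [div_mul_eq_mul_div, div_le_iff₀ (by positivity)]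
    nlinarith
  rw [← hww] at hle
  exact sub_eq_zero.1 (inner_self_eq_zero.1 (le_antisymm hle real_inner_self_nonneg))

namespace IsLocalDefiningFunction

variable {x : PhaseSpace n} {ρ : PhaseSpace n → ℝ}

theorem mem (hρ : IsLocalDefiningFunction S x ρ) : x ∈ S := by
  obtain ⟨-, h0, -, U, -, hx, h⟩ := hρ
  exact (h x hx).2 h0.le

theorem inner_gradient (ρ : PhaseSpace n → ℝ) (x v : PhaseSpace n) :
    (inner ℝ (gradient ρ x) v : ℝ) = fderiv ℝ ρ x v :=
  InnerProductSpace.toDual_symm_apply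

theorem gradient_ne_zero (hρ : IsLocalDefiningFunction S x ρ) : gradient ρ x ≠ 0 := fun h =>
  hρ.2.2.1 (ContinuousLinearMap.ext fun v => by
    rw [← inner_gradient, h, inner_zero_left, _root_.zero_apply])

theorem eventually_mem_nhds (hρ : IsLocalDefiningFunction S x ρ) :
    ∀ᶠ y in nhds x, y ∈ S ↔ ρ y ≤ 0 := by
  obtain ⟨-, -, -, U, hU, hx, h⟩ := hρ
  filter_upwards [hU.mem_nhds hx] with y hy using h y hy

theorem tendsto_slope (hρ : IsLocalDefiningFunction S x ρ) (v : PhaseSpace n) :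
    Filter.Tendsto (fun t : ℝ => t⁻¹ * ρ (x + t • v)) (nhdsWithin 0 (Ioi 0))
      (nhds (inner ℝ (gradient ρ x) v)) := by
  have hd : HasFDerivAt ρ (fderiv ℝ ρ x) x :=
    (hρ.1.differentiable (by simp) x).hasFDerivAt
  have h2 := hd.hasLineDerivAt v
  have h1 : HasDerivAt (fun t : ℝ => ρ (x + t • v)) (fderiv ℝ ρ x v) 0 := h2
  have h3 := h1.tendsto_slope_zero_right
  simp only [zero_add, zero_smul, add_zero, hρ.2.1, sub_zero, smul_eq_mul] at h3
  rwa [← inner_gradient] at h3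

theorem eventually_line_mem (hρ : IsLocalDefiningFunction S x ρ) (v : PhaseSpace n) :
    ∀ᶠ t in nhdsWithin (0 : ℝ) (Ioi 0), x + t • v ∈ S ↔ ρ (x + t • v) ≤ 0 := by
  have : Filter.Tendsto (fun t : ℝ => x + t • v) (nhdsWithin 0 (Ioi 0)) (nhds x) := by
    have h : Continuous fun t : ℝ => x + t • v := by fun_prop
    have := h.tendsto 0
    rw [zero_smul, add_zero] at this
    exact this.mono_left nhdsWithin_le_nhds
  exact this.eventually hρ.eventually_mem_nhds

/-- At a regular point every direction of decreasing `ρ` enters the body, which confines normals to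
the gradient ray; the converse differentiates `ρ` along segments inside the convex body. -/
theorem mem_normalCone_iff (hρ : IsLocalDefiningFunction S x ρ) (hS : Convex ℝ S)
    {u : PhaseSpace n} : u ∈ normalCone S x ↔ ∃ c : ℝ, 0 ≤ c ∧ u = c • gradient ρ x := by
  constructor
  · intro hu
    refine exists_eq_smul_of_inner_le hρ.gradient_ne_zero fun v hv => ?_
    obtain ⟨t, ⟨ht1, ht2⟩, ht0⟩ := (((hρ.tendsto_slope v).eventually (gt_mem_nhds hv)).and
      (hρ.eventually_line_mem v)).and self_mem_nhdsWithin |>.exists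
    have ht0 : 0 < t := ht0
    have h1 : ρ (x + t • v) < 0 := by
      rcases neg_of_mul_neg_right ht1 (inv_pos.2 ht0).le with h
      exact h
    have h2 := hu _ (ht2.2 h1.le)
    rw [sub_add_cancel_left, inner_neg_right, inner_smul_right] at h2
    nlinarith
  · rintro ⟨c, hc, rfl⟩
    refine smul_mem_normalCone hc fun y hy => ?_
    have hle : (inner ℝ (gradient ρ x) (y - x) : ℝ) ≤ 0 := by
      refine le_of_tendsto (hρ.tendsto_slope (y - x)) ?_
      filter_upwards [hρ.eventually_line_mem (y - x), Ioo_mem_nhdsGT one_pos] with t ht ht1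
      have hmem : x + t • (y - x) ∈ S :=
        hS.add_smul_sub_mem hρ.mem hy ⟨ht1.1.le, ht1.2.le⟩
      exact mul_nonpos_of_nonneg_of_nonpos (inv_pos.2 ht1.1).le (ht.1 hmem)
    rw [← neg_sub, inner_neg_right]
    linarith

theorem gradient_mem_normalCone (hρ : IsLocalDefiningFunction S x ρ) (hS : Convex ℝ S) :
    gradient ρ x ∈ normalCone S x :=
  (hρ.mem_normalCone_iff hS).2 ⟨1, zero_le_one, (one_smul _ _).symm⟩

/-- Any other defining function has its gradient in the same normal ray, so one function tests
tangency. -/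
theorem mem_boundaryTangentSpace_iff (hρ : IsLocalDefiningFunction S x ρ) (hS : Convex ℝ S)
    {v : PhaseSpace n} : v ∈ boundaryTangentSpace S x ↔ (inner ℝ (gradient ρ x) v : ℝ) = 0 := by
  constructor
  · intro h
    rw [inner_gradient]
    exact h ρ hρ
  · intro h ρ' hρ'
    obtain ⟨c, -, hc⟩ := (hρ.mem_normalCone_iff hS).1 (hρ'.gradient_mem_normalCone hS)
    rw [← inner_gradient, hc, inner_smul_left, h, mul_zero]

/-- If `ξ` is symplectically orthogonal to the tangent hyperplane, then `stdJ ξ` is orthogonal to it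
and hence a multiple of the gradient. -/
theorem mem_characteristicLine_iff (hρ : IsLocalDefiningFunction S x ρ) (hS : Convex ℝ S)
    {ξ : PhaseSpace n} : ξ ∈ characteristicLine S x ↔ ∃ c : ℝ, ξ = c • stdJ (gradient ρ x) := by
  have hp := hρ.gradient_ne_zero
  set p := gradient ρ x with hpdef
  have hpp : 0 < (inner ℝ p p : ℝ) := real_inner_self_pos.2 hp
  constructor
  · rintro ⟨-, h⟩
    let c : ℝ := inner ℝ (stdJ ξ) p / inner ℝ p p
    have hcp : c * inner ℝ p p = inner ℝ (stdJ ξ) p := div_mul_cancel₀ _ hpp.ne'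
    have hperp : (inner ℝ p (stdJ ξ - c • p) : ℝ) = 0 := by
      rw [inner_sub_right, inner_smul_right, hcp, real_inner_comm, sub_self]
    have h1 := h _ ((hρ.mem_boundaryTangentSpace_iff hS).2 hperp)
    rw [stdOmega_eq_inner] at h1
    have h2 : (inner ℝ (stdJ ξ - c • p) (stdJ ξ - c • p) : ℝ) = 0 := by
      conv_lhs => rw [inner_sub_left, inner_smul_left, hperp, h1]
      simp
    have h3 : stdJ ξ = c • p := sub_eq_zero.1 (inner_self_eq_zero.1 h2)
    refine ⟨-c, ?_⟩
    rw [neg_smul, ← stdJ_smul, ← h3, stdJ_stdJ, neg_neg]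
  · rintro ⟨c, rfl⟩
    refine ⟨(hρ.mem_boundaryTangentSpace_iff hS).2 ?_, fun η hη => ?_⟩
    · rw [inner_smul_right, real_inner_comm, inner_stdJ_self, mul_zero]
    · rw [stdOmega_eq_inner, stdJ_smul, stdJ_stdJ, inner_smul_left, inner_neg_left,
        (hρ.mem_boundaryTangentSpace_iff hS).1 hη, neg_zero, mul_zero]

end IsLocalDefiningFunction

end SmoothBoundary

/-! ### Orientation, monotonicity and scaling -/

section SmoothCharacteristics

variable {n : ℕ} {S : Set (PhaseSpace n)}

theorem isGenClosedCharacteristic_of_differentiable {γ : ℝ → PhaseSpace n}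
    (hd : Differentiable ℝ γ) (hper : Function.Periodic γ (2 * Real.pi))
    (hne : ∃ t, deriv γ t ≠ 0) (hfr : ∀ t, γ t ∈ frontier S)
    (hN : ∀ t, deriv γ t ∈ stdJ '' normalCone S (γ t)) : IsGenClosedCharacteristic S γ := by
  refine ⟨hd.continuous, hper, ?_, hfr, ⟨∅, measure_empty, fun t _ => hd t⟩, fun t =>
    ⟨⟨_, hN t, (hd t).hasDerivAt.hasDerivWithinAt⟩, ⟨_, hN t, (hd t).hasDerivAt.hasDerivWithinAt⟩⟩⟩
  by_contra hcon
  push Not at hcon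
  obtain ⟨t, ht⟩ := hne
  have hconst : γ = fun _ => γ 0 := funext fun t => hcon t 0
  rw [hconst] at ht
  exact ht (deriv_const _ _)

theorem loopAction_comp_neg {γ : ℝ → PhaseSpace n} (hper : Function.Periodic γ (2 * Real.pi)) :
    loopAction (fun t => γ (-t)) = -loopAction γ := by
  have hper' : Function.Periodic (fun t => (inner ℝ (stdJ (γ t)) (deriv γ t) : ℝ)) (2 * Real.pi) :=
    fun t => by
      have : deriv γ (t + 2 * Real.pi) = deriv γ t := by
        rw [← deriv_comp_add_const]
        congr 1
        exact funext hper
      simp only [hper t, this]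
  have h1 : ∀ t, deriv (fun t => γ (-t)) t = -deriv γ (-t) := fun t => deriv_comp_neg γ t
  have h2 := hper'.intervalIntegral_add_eq (-(2 * Real.pi)) 0
  rw [neg_add_cancel, zero_add] at h2
  have h3 := intervalIntegral.integral_comp_neg (a := 0) (b := 2 * Real.pi)
    fun t => (inner ℝ (stdJ (γ t)) (deriv γ t) : ℝ)
  rw [neg_zero, h2] at h3
  rw [loopAction, loopAction, ← h3]
  simp only [h1, inner_neg_right, intervalIntegral.integral_neg, mul_neg]

/-- A closed characteristic is, up to orientation, a generalized closed characteristic. -/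
theorem IsClosedCharacteristic.exists_isGenClosedCharacteristic (hS : IsSmoothConvexBody S)
    (h0 : 0 ∈ interior S) {γ : ℝ → PhaseSpace n} (hγ : IsClosedCharacteristic S γ) :
    ∃ η, IsGenClosedCharacteristic S η ∧ |loopAction η| = |loopAction γ| := by
  obtain ⟨hsm, hper, -, hγt⟩ := hγ
  have hcb : IsCenteredBody S := ⟨hS.1.1, hS.1.2.1, h0⟩
  have hd : Differentiable ℝ γ := hsm.differentiable (by simp)
  have hdc : Continuous (deriv γ) := hsm.continuous_deriv (by simp)
  choose ρ hρ using fun t => hS.2 (γ t) (hγt t).2.1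
  have hchar := fun t => ((hρ t).mem_characteristicLine_iff hcb.1).1 (hγt t).2.2
  choose c hc using hchar
  have hN := fun t => (hρ t).gradient_mem_normalCone hcb.1
  have hpos : ∀ t, 0 < (inner ℝ (γ t) (gradient (ρ t) (γ t)) : ℝ) := fun t => by
    rw [inner_eq_supportFn_of_mem_normalCone hcb.2.1 (hρ t).mem (hN t)]
    exact hcb.supportFn_pos (hρ t).gradient_ne_zero
  let f : ℝ → ℝ := fun t => inner ℝ (stdJ (γ t)) (deriv γ t)
  have hf : Continuous f := (continuous_stdJ.comp hsm.continuous).inner hdc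
  have hfc : ∀ t, f t = c t * inner ℝ (γ t) (gradient (ρ t) (γ t)) := fun t => by
    simp only [f]
    rw [hc t, inner_smul_right, inner_stdJ_stdJ]
  have hc0 : ∀ t, c t ≠ 0 := fun t h => (hγt t).1 (by rw [hc t, h, zero_smul])
  -- No continuity of `c` is available, since the defining functions are chosen point by point. The
  -- continuous function `f` has the same sign as `c` and never vanishes.
  have hsign : (∀ t, 0 < c t) ∨ ∀ t, c t < 0 := by
    by_contra hcon
    push Not at hcon
    obtain ⟨⟨s, hs⟩, ⟨t, ht⟩⟩ := hcon
    obtain ⟨τ, hτ⟩ : (0 : ℝ) ∈ range f := mem_range_of_exists_le_of_exists_ge hf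
      ⟨s, by rw [hfc]; exact mul_nonpos_of_nonpos_of_nonneg hs (hpos s).le⟩
      ⟨t, by rw [hfc]; exact mul_nonneg ht (hpos t).le⟩
    rw [hfc] at hτ
    exact (mul_ne_zero (hc0 τ) (hpos τ).ne') hτ
  rcases hsign with h | h
  · refine ⟨γ, isGenClosedCharacteristic_of_differentiable hd hper ⟨0, (hγt 0).1⟩
      (fun t => (hγt t).2.1) fun t => ?_, rfl⟩
    rw [hc t, ← stdJ_smul]
    exact mem_image_of_mem _ (smul_mem_normalCone (h t).le (hN t))
  · have hdn : ∀ t, deriv (fun t => γ (-t)) t = -deriv γ (-t) := fun t => deriv_comp_neg γ t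
    refine ⟨fun t => γ (-t), isGenClosedCharacteristic_of_differentiable (hd.comp differentiable_neg)
      (fun t => ?_) ⟨0, ?_⟩ (fun t => (hγt (-t)).2.1) fun t => ?_, ?_⟩
    · simp only [neg_add_rev]
      rw [add_comm, ← sub_eq_add_neg, hper.sub_eq]
    · rw [hdn, neg_zero, neg_ne_zero]
      exact (hγt 0).1
    · rw [hdn, hc, ← neg_smul, ← stdJ_smul]
      exact mem_image_of_mem _ (smul_mem_normalCone (neg_pos.2 (h _)).le (hN _))
    · rw [loopAction_comp_neg hper, abs_neg]

theorem unitSpeedLoops_anti {S' : Set (PhaseSpace n)} (hS : S.Nonempty) (hS' : IsCompact S')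
    (h : S ⊆ S') : unitSpeedLoops S' ⊆ unitSpeedLoops S := fun _ hΓ =>
  ⟨hΓ.1, hΓ.2.1, fun a b hab => (supportFn_mono hS' hS h _).trans (hΓ.2.2 a b hab)⟩

/-- Shrinking the larger body into `S` bounds its support function, so the maximal action drops by
at most the factor `lam⁻²`. -/
theorem smul_mem_unitSpeedLoops (hS : IsCenteredBody S) {S' : Set (PhaseSpace n)}
    (hS' : IsCenteredBody S') {lam : ℝ} (h : ∀ x ∈ S', lam⁻¹ • x ∈ S)
    {Γ : ℝ → PhaseSpace n} (hΓ : Γ ∈ unitSpeedLoops S) : lam⁻¹ • Γ ∈ unitSpeedLoops S' := by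
  obtain ⟨h0, hper, hsp⟩ := hΓ
  refine ⟨by simp [h0], fun t => by simp [hper t], fun a b hab => ?_⟩
  refine le_trans ?_ (hsp a b hab)
  rw [Pi.smul_apply, Pi.smul_apply, ← smul_sub]
  refine supportFn_le ⟨0, hS'.zero_mem⟩ fun x hx => ?_
  rw [inner_smul_right, ← real_inner_smul_left]
  exact inner_le_supportFn hS.2.1 (h x hx) _

theorem loopAction_smul (c : ℝ) (γ : ℝ → PhaseSpace n) :
    loopAction (c • γ) = c ^ 2 * loopAction γ := by
  have h : ∀ t, (inner ℝ (stdJ ((c • γ) t)) (deriv (c • γ) t) : ℝ) =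
      c ^ 2 * inner ℝ (stdJ (γ t)) (deriv γ t) := fun t => by
    rw [Pi.smul_apply, stdJ_smul, deriv_const_smul_field, inner_smul_left,
      inner_smul_right, RCLike.conj_to_real]
    ring
  rw [loopAction, loopAction]
  simp only [h, intervalIntegral.integral_const_mul]
  ring

end SmoothCharacteristics

/-! ### Outer approximation by smooth convex bodies -/

section Smoothing

variable {n : ℕ} {S : Set (PhaseSpace n)}

/-- A centered body is approximated from outside by sublevel sets of smooth convex functions. -/
theorem exists_smooth_convexOn_of_isCenteredBody (hS : IsCenteredBody S) {lam : ℝ} (hl : 1 < lam) :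
    ∃ (G : PhaseSpace n → ℝ) (c : ℝ), ContDiff ℝ ∞ G ∧ ConvexOn ℝ univ G ∧ G 0 < c ∧
      (∀ x ∈ S, G x ≤ c) ∧ ∀ x, G x ≤ c → lam⁻¹ • x ∈ S := by
  have hP := hS.polarBody
  have hPne : (polarBody S).Nonempty := ⟨0, hP.zero_mem⟩
  obtain ⟨R, hR, hRS⟩ := hP.exists_norm_le
  let N := supportFn (polarBody S)
  have hNc : Continuous N := continuous_supportFn hP.2.1 hPne
  -- The mollified gauge is within `κ` of the gauge, so its sublevel `1 + κ` lies between gauge one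
  -- and gauge `1 + 2κ = lam`.
  let κ : ℝ := (lam - 1) / 2
  have hκ : 0 < κ := by simp only [κ]; linarith
  let ε : ℝ := κ / R
  have hε : 0 < ε := div_pos hκ hR
  let φ : ContDiffBump (0 : PhaseSpace n) := ⟨ε / 2, ε, by positivity, by linarith⟩
  let G : PhaseSpace n → ℝ := convolution (φ.normed volume) N (ContinuousLinearMap.lsmul ℝ ℝ) volume
  have hGN : ∀ x, |G x - N x| ≤ κ := fun x => by
    rw [← Real.dist_eq]
    refine φ.dist_normed_convolution_le hNc.aestronglyMeasurable fun y hy => ?_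
    rw [Real.dist_eq]
    refine (abs_supportFn_sub_le hP.2.1 hPne hRS y x).trans ?_
    rw [Metric.mem_ball, dist_eq_norm] at hy
    calc R * ‖y - x‖ ≤ R * ε := by gcongr
      _ = κ := by simp only [ε]; field_simp
  have hGs : ContDiff ℝ ∞ G := φ.hasCompactSupport_normed.contDiff_convolution_left _
    φ.contDiff_normed hNc.locallyIntegrable
  have hGdef : ∀ x, G x = ∫ t, φ.normed volume t * N (x - t) := fun x => rfl
  have hint : ∀ x, Integrable fun t => φ.normed volume t * N (x - t) := fun x =>
    Continuous.integrable_of_hasCompactSupport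
      (φ.continuous_normed.mul (hNc.comp (continuous_const.sub continuous_id)))
      (φ.hasCompactSupport_normed.mul_right)
  have hNconv := convexOn_supportFn hP.2.1 hPne
  have hGconv : ConvexOn ℝ univ G := ⟨convex_univ, fun x _ y _ a b ha hb hab => by
    rw [hGdef, hGdef, hGdef, smul_eq_mul, smul_eq_mul, ← integral_const_mul, ← integral_const_mul,
      ← integral_add ((hint x).const_mul a) ((hint y).const_mul b)]
    refine integral_mono (hint _) (((hint x).const_mul a).add ((hint y).const_mul b)) fun t => ?_
    have h1 := hNconv.2 (mem_univ (x - t)) (mem_univ (y - t)) ha hb hab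
    rw [show a • (x - t) + b • (y - t) = a • x + b • y - t by
      rw [smul_sub, smul_sub, sub_add_sub_comm, ← add_smul, hab, one_smul]] at h1
    have h2 := mul_le_mul_of_nonneg_left h1 (φ.nonneg_normed (μ := volume) t)
    simp only [smul_eq_mul] at h2
    change _ ≤ a * _ + b * _
    linarith⟩
  have hmem : ∀ x, x ∈ S ↔ N x ≤ 1 := fun x => hS.mem_iff_supportFn_polarBody_le
  refine ⟨G, 1 + κ, hGs, hGconv, ?_, fun x hx => ?_, fun x hx => ?_⟩
  · have h1 := (abs_le.1 (hGN 0)).2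
    have h2 : N 0 = 0 := supportFn_zero hPne
    linarith
  · have h1 := (abs_le.1 (hGN x)).2
    have h2 := (hmem x).1 hx
    linarith
  · have h1 := (abs_le.1 (hGN x)).1
    have hl0 : 0 < lam := by linarith
    rw [hmem]
    simp only [N]
    rw [supportFn_smul hP.2.1 hPne (inv_pos.2 hl0).le, inv_mul_le_iff₀ hl0]
    change N x ≤ lam * 1
    have : 2 * κ = lam - 1 := by simp only [κ]; ring
    linarith

section Sublevel

variable {G : PhaseSpace n → ℝ} {c : ℝ}

/-- The tangent inequality of a convex function, tested at the origin; it keeps the gradient from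
vanishing at any level above `G 0`. -/
theorem le_inner_gradient_of_convexOn (hG : ContDiff ℝ ∞ G) (hconv : ConvexOn ℝ univ G)
    (x : PhaseSpace n) : G x - G 0 ≤ inner ℝ (gradient G x) x := by
  have hd : HasFDerivAt G (fderiv ℝ G x) x := (hG.differentiable (by simp) x).hasFDerivAt
  have h2 := hd.hasLineDerivAt (-x)
  have h1 : HasDerivAt (fun t : ℝ => G (x + t • (-x))) (fderiv ℝ G x (-x)) 0 := h2
  have h3 := h1.tendsto_slope_zero_right
  simp only [zero_add, zero_smul, add_zero, smul_eq_mul] at h3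
  have h4 : fderiv ℝ G x (-x) ≤ G 0 - G x := by
    refine le_of_tendsto h3 ?_
    filter_upwards [Ioo_mem_nhdsGT one_pos] with t ht
    have h5 := hconv.2 (mem_univ x) (mem_univ 0) (sub_nonneg.2 ht.2.le) ht.1.le (by ring)
    rw [show (1 - t) • x + t • (0 : PhaseSpace n) = x + t • (-x) by module] at h5
    rw [inv_mul_le_iff₀ ht.1]
    simp only [smul_eq_mul] at h5
    linarith
  rw [map_neg, ← IsLocalDefiningFunction.inner_gradient] at h4
  linarith

theorem eq_of_mem_frontier_sublevel (hG : ContDiff ℝ ∞ G) {x : PhaseSpace n}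
    (hx : x ∈ frontier {y | G y ≤ c}) : G x = c :=
  frontier_le_subset_eq hG.continuous continuous_const hx

theorem isLocalDefiningFunction_sublevel (hG : ContDiff ℝ ∞ G) (hconv : ConvexOn ℝ univ G)
    (h0 : G 0 < c) {x : PhaseSpace n} (hx : x ∈ frontier {y | G y ≤ c}) :
    IsLocalDefiningFunction {y | G y ≤ c} x (fun y => G y - c) := by
  have hxc := eq_of_mem_frontier_sublevel hG hx
  refine ⟨hG.sub contDiff_const, by simp [hxc], fun hcon => ?_, univ, isOpen_univ, mem_univ x,
    fun y _ => by simp⟩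
  have h1 := le_inner_gradient_of_convexOn hG hconv x
  rw [fderiv_sub_const] at hcon
  rw [IsLocalDefiningFunction.inner_gradient, hcon, _root_.zero_apply] at h1
  linarith

theorem isCenteredBody_sublevel (hG : ContDiff ℝ ∞ G) (hconv : ConvexOn ℝ univ G)
    (h0 : G 0 < c) (hb : Bornology.IsBounded {y | G y ≤ c}) : IsCenteredBody {y | G y ≤ c} := by
  refine ⟨by simpa using hconv.convex_le c, Metric.isCompact_of_isClosed_isBounded
    (isClosed_le hG.continuous continuous_const) hb, mem_interior.2 ⟨{y | G y < c}, fun y hy => ?_,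
      isOpen_lt hG.continuous continuous_const, h0⟩⟩
  exact (show G y < c from hy).le

theorem isSmoothConvexBody_sublevel (hG : ContDiff ℝ ∞ G) (hconv : ConvexOn ℝ univ G)
    (h0 : G 0 < c) (hb : Bornology.IsBounded {y | G y ≤ c}) : IsSmoothConvexBody {y | G y ≤ c} :=
  ⟨(isCenteredBody_sublevel hG hconv h0 hb).isConvexBody,
    fun _ hx => ⟨_, isLocalDefiningFunction_sublevel hG hconv h0 hx⟩⟩

end Sublevel

end Smoothing

/-! ### Characteristics of smooth bodies as periodic orbits -/

section Autonomous

variable {n : ℕ} {S : Set (PhaseSpace n)}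

/-- Bootstrapping: if the solution has `k` derivatives, so does its velocity, and the solution gains
one more. -/
theorem contDiff_of_hasDerivAt_comp {X γ : ℝ → PhaseSpace n} {Y : PhaseSpace n → PhaseSpace n}
    (hX : ∀ t, X t = Y (γ t)) (hY : ∀ t, ContDiffAt ℝ ∞ Y (γ t))
    (hd : ∀ t, HasDerivAt γ (X t) t) : ContDiff ℝ ∞ γ := by
  have hdiff : Differentiable ℝ γ := fun t => (hd t).differentiableAt
  have hderiv : deriv γ = fun t => Y (γ t) := funext fun t => by rw [(hd t).deriv, hX]
  refine contDiff_infty.2 fun k => ?_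
  induction k with
  | zero => exact contDiff_zero.2 hdiff.continuous
  | succ k ih =>
    push_cast
    refine contDiff_succ_iff_deriv.2 ⟨hdiff, fun h => absurd h (by simp), ?_⟩
    rw [hderiv]
    refine contDiff_iff_contDiffAt.2 fun t => ?_
    exact ((hY t).of_le (by exact_mod_cast le_top)).comp t ih.contDiffAt

/-- Two points of an orbit of an autonomous equation coincide only if the orbit is periodic. -/
theorem periodic_of_orbit_self_intersection {K : Set (PhaseSpace n)} (hK : IsCompact K)
    {Y : PhaseSpace n → PhaseSpace n} (hY : ∀ x ∈ K, ContDiffAt ℝ ∞ Y x) {γ : ℝ → PhaseSpace n}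
    (hγ : ∀ t, γ t ∈ K) (hd : ∀ t, HasDerivAt γ (Y (γ t)) t) {s t : ℝ} (hst : γ s = γ t) :
    Function.Periodic γ (t - s) := by
  obtain ⟨L, hL⟩ := LocallyLipschitzOn.exists_lipschitzOnWith_of_compact (f := Y) hK fun x hx => by
    obtain ⟨C, U, hU, hC⟩ := ((hY x hx).of_le (by exact_mod_cast le_top)).exists_lipschitzOnWith
    exact ⟨C, U, mem_nhdsWithin_of_mem_nhds hU, hC⟩
  have h := ODE_solution_unique_univ (v := fun _ => Y) (s := fun _ => K) (K := L) (t₀ := s)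
    (f := fun τ => γ (τ + (t - s))) (g := γ) (fun _ => hL)
    (fun τ => ⟨(hd (τ + (t - s))).comp_add_const τ (t - s), hγ _⟩) (fun τ => ⟨hd τ, hγ τ⟩)
    (by rw [add_sub_cancel]; exact hst.symm)
  exact fun τ => congrFun h τ

/-- The periods form a subgroup of the line. A dense one would make the loop constant, so it is
cyclic; self-intersections yield periods, and none is smaller than the generator. -/
theorem exists_minimal_period {γ : ℝ → PhaseSpace n} {L : ℝ} (hL : 0 < L) (hγ : Continuous γ)
    (hper : Function.Periodic γ L) (hne : ∃ t, γ t ≠ γ 0)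
    (hself : ∀ s t, γ s = γ t → Function.Periodic γ (t - s)) :
    ∃ k : ℕ, 1 ≤ k ∧ Function.Periodic γ (L / k) ∧ InjOn γ (Ico 0 (L / k)) := by
  let P : AddSubgroup ℝ :=
    { carrier := {p | Function.Periodic γ p}
      add_mem' := fun hp hq => hp.add_period hq
      zero_mem' := fun t => by rw [add_zero]
      neg_mem' := fun hp => hp.neg }
  rcases P.dense_or_cyclic with hdense | ⟨g, hg⟩
  · exfalso
    obtain ⟨t, ht⟩ := hne
    refine ht ?_
    have hcl : IsClosed {p | γ p = γ 0} := isClosed_eq hγ continuous_const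
    have hsub : (P : Set ℝ) ⊆ {p | γ p = γ 0} := fun p hp => by
      have := (show Function.Periodic γ p from hp) 0
      rwa [zero_add] at this
    have := hcl.closure_subset_iff.2 hsub (hdense t)
    exact this
  · have hmem : ∀ p, Function.Periodic γ p ↔ ∃ j : ℤ, j • g = p := fun p => by
      rw [← AddSubgroup.mem_closure_singleton, ← hg]
      exact Iff.rfl
    obtain ⟨k, hk⟩ := (hmem L).1 hper
    have hk0 : k ≠ 0 := by
      rintro rfl
      rw [zero_smul] at hk
      exact hL.ne hk
    have hkabs : (0 : ℝ) < |(k : ℝ)| := abs_pos.2 (by exact_mod_cast hk0)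
    have hcast : ((k.natAbs : ℕ) : ℝ) = |(k : ℝ)| := by
      rw [Nat.cast_natAbs, Int.cast_abs]
    have habs : L / (k.natAbs : ℕ) = |g| := by
      rw [hcast, div_eq_iff hkabs.ne', ← abs_of_pos hL, ← hk, zsmul_eq_mul, abs_mul, mul_comm]
    refine ⟨k.natAbs, Int.natAbs_pos.2 hk0, ?_, fun s hs t ht hst => ?_⟩
    · rw [habs]
      rcases abs_choice g with h | h <;> rw [h]
      · exact (hmem g).2 ⟨1, one_smul _ _⟩
      · exact (hmem (-g)).2 ⟨-1, by simp⟩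
    · rw [habs] at hs ht
      obtain ⟨j, hj⟩ := (hmem _).1 (hself s t hst)
      have h1 : |t - s| < |g| := abs_sub_lt_of_nonneg_of_lt ht.1 ht.2 hs.1 hs.2
      rw [← hj, zsmul_eq_mul, abs_mul] at h1
      have h2 : |(j : ℝ)| < 1 := by
        by_contra hcon
        push Not at hcon
        nlinarith [abs_nonneg g]
      have h3 : j = 0 := by
        rw [← Int.cast_abs] at h2
        have : |j| < 1 := by exact_mod_cast h2
        exact Int.abs_lt_one_iff.1 this
      rw [h3, zero_smul] at hj
      linarith

/-- On a regular sublevel set of a smooth convex function, weak characteristics are multiple covers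
of closed characteristics. -/
theorem IsWeakCharacteristic.exists_isClosedCharacteristic {G : PhaseSpace n → ℝ} {c a : ℝ}
    (hG : ContDiff ℝ ∞ G) (hconv : ConvexOn ℝ univ G) (h0 : G 0 < c)
    (hb : Bornology.IsBounded {y | G y ≤ c}) (ha : 0 < a) {γ : ℝ → PhaseSpace n}
    (hγ : IsWeakCharacteristic {y | G y ≤ c} a γ) :
    ∃ η, IsClosedCharacteristic {y | G y ≤ c} η ∧ |loopAction η| ≤ Real.pi ^ 2 / a := by
  obtain ⟨⟨C, hC⟩, hper, hfr, hae⟩ := hγ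
  have hcb := isCenteredBody_sublevel hG hconv h0 hb
  have hpi := Real.two_pi_pos
  set S : Set (PhaseSpace n) := {y | G y ≤ c} with hSdef
  let ρ : PhaseSpace n → ℝ := fun y => G y - c
  have hρ : ∀ x ∈ frontier S, IsLocalDefiningFunction S x ρ := fun x hx =>
    isLocalDefiningFunction_sublevel hG hconv h0 hx
  have hgs : ContDiff ℝ ∞ (gradient ρ) := by
    have h1 : ContDiff ℝ ∞ (fderiv ℝ ρ) := (hG.sub contDiff_const).fderiv_right (by simp)
    exact (InnerProductSpace.toDual ℝ (PhaseSpace n)).symm.contDiff.comp h1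
  let q : PhaseSpace n → ℝ := fun x => inner ℝ x (gradient ρ x)
  have hq : ∀ x ∈ frontier S, 0 < q x := fun x hx => by
    simp only [q]
    rw [inner_eq_supportFn_of_mem_normalCone hcb.2.1 (hρ x hx).mem
      ((hρ x hx).gradient_mem_normalCone hcb.1)]
    exact hcb.supportFn_pos (hρ x hx).gradient_ne_zero
  -- On a smooth boundary the normal ray and the normalization `⟨γ, ν⟩ = π / a` determine `ν`, so
  -- the inclusion becomes an autonomous equation with this field.
  let Y : PhaseSpace n → PhaseSpace n := fun x => (Real.pi / a * (q x)⁻¹) • stdJ (gradient ρ x)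
  have hYs : ∀ x ∈ frontier S, ContDiffAt ℝ ∞ Y x := fun x hx => by
    have h1 : ContDiffAt ℝ ∞ q x := contDiffAt_id.inner ℝ hgs.contDiffAt
    have h2 : ContDiffAt ℝ ∞ (fun x => stdJ (gradient ρ x)) x :=
      ((stdJL n).contDiff.comp hgs).contDiffAt
    exact (contDiffAt_const.mul (h1.inv (hq x hx).ne')).smul h2
  have hae' : ∀ᵐ t, HasDerivAt γ (Y (γ t)) t := by
    filter_upwards [hae] with t ht
    obtain ⟨ν, hν, hd, hi⟩ := ht
    obtain ⟨b, hb0, rfl⟩ := ((hρ _ (hfr t)).mem_normalCone_iff hcb.1).1 hν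
    rw [inner_smul_right] at hi
    have hbq : b = Real.pi / a * (q (γ t))⁻¹ := by
      rw [← hi]
      exact (mul_inv_cancel_right₀ (hq _ (hfr t)).ne' b).symm
    rw [stdJ_smul, hbq] at hd
    exact hd
  have hYc : Continuous fun t => Y (γ t) := continuous_iff_continuousAt.2 fun t =>
    (hYs _ (hfr t)).continuousAt.comp hC.continuous.continuousAt
  -- A Lipschitz curve is the integral of its derivative, here almost everywhere equal to a
  -- continuous function; so the equation holds at every time.
  have hd : ∀ t, HasDerivAt γ (Y (γ t)) t := fun t => by
    have h1 : γ = fun t => γ 0 + ∫ s in (0 : ℝ)..t, Y (γ s) := funext fun t => by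
      have h2 := hC.sub_eq_integral_deriv 0 t
      rw [intervalIntegral.integral_congr_ae (g := fun s => Y (γ s)) (by
        filter_upwards [hae'] with s hs _ using hs.deriv)] at h2
      rw [← h2]
      abel
    have h3 := (intervalIntegral.integral_hasDerivAt_right (hYc.intervalIntegrable 0 t)
      (hYc.stronglyMeasurableAtFilter _ _) hYc.continuousAt).const_add (γ 0)
    refine h3.congr_of_eventuallyEq (Filter.Eventually.of_forall fun s => ?_)
    exact congrFun h1 s
  have hsm : ContDiff ℝ ∞ γ := contDiff_of_hasDerivAt_comp (fun t => rfl) (fun t => hYs _ (hfr t)) hd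
  have hK : IsCompact (frontier S) := hcb.2.1.of_isClosed_subset isClosed_frontier
    hcb.2.1.isClosed.frontier_subset
  have hY0 : ∀ x ∈ frontier S, Y x ≠ 0 := fun x hx => by
    refine smul_ne_zero ?_ ?_
    · have := hq x hx
      have := Real.pi_pos
      positivity
    · rw [← norm_ne_zero_iff, norm_stdJ, norm_ne_zero_iff]
      exact (hρ x hx).gradient_ne_zero
  have hne : ∃ t, γ t ≠ γ 0 := by
    by_contra hcon
    push Not at hcon
    have hconst : γ = fun _ => γ 0 := funext hcon
    have h1 := (hd 0).deriv
    rw [hconst, deriv_const] at h1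
    exact hY0 _ (hfr 0) h1.symm
  obtain ⟨k, hk1, hkp, hkinj⟩ := exists_minimal_period hpi hsm.continuous hper hne
    fun s t hst => periodic_of_orbit_self_intersection hK hYs hfr hd hst
  have hk0 : (0 : ℝ) < k := by exact_mod_cast hk1
  -- One traversal of the minimal period, stretched to `2π`; it carries a fraction `1 / k` of the
  -- action.
  let η : ℝ → PhaseSpace n := fun t => γ (t / k)
  have hηd : ∀ t, HasDerivAt η ((k : ℝ)⁻¹ • Y (η t)) t := fun t => by
    have h1 : HasDerivAt (fun t : ℝ => t / k) ((k : ℝ)⁻¹) t := by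
      simpa [one_div] using (hasDerivAt_id t).div_const (k : ℝ)
    exact (hd (t / k)).scomp t h1
  have hact : loopAction η = Real.pi ^ 2 / (a * k) := by
    have h1 : ∀ t, (inner ℝ (stdJ (η t)) (deriv η t) : ℝ) = Real.pi / (a * k) := fun t => by
      have := (hq _ (hfr (t / k))).ne'
      rw [(hηd t).deriv, inner_smul_right, inner_smul_right, inner_stdJ_stdJ]
      change (k : ℝ)⁻¹ * (Real.pi / a * (q (γ (t / k)))⁻¹ * q (γ (t / k))) = _
      field_simp
    rw [loopAction]
    simp only [h1]
    rw [intervalIntegral.integral_const, smul_eq_mul]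
    field_simp
    ring
  refine ⟨η, ⟨hsm.comp (contDiff_id.div_const _), fun t => ?_, fun s hs t ht hst => ?_, fun t =>
    ⟨?_, hfr _, ?_⟩⟩, ?_⟩
  · simp only [η]
    rw [add_div, hkp]
  · have h1 : ∀ τ ∈ Ico 0 (2 * Real.pi), τ / k ∈ Ico 0 (2 * Real.pi / k) := fun τ hτ =>
      ⟨div_nonneg hτ.1 hk0.le, div_lt_div_of_pos_right hτ.2 hk0⟩
    have h2 := hkinj (h1 s hs) (h1 t ht) hst
    exact (div_left_inj' hk0.ne').1 h2
  · rw [(hηd t).deriv]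
    exact smul_ne_zero (inv_ne_zero hk0.ne') (hY0 _ (hfr _))
  · rw [(hηd t).deriv, (hρ _ (hfr _)).mem_characteristicLine_iff hcb.1]
    exact ⟨_, smul_smul _ _ _⟩
  · have h1 : (1 : ℝ) ≤ k := by exact_mod_cast hk1
    rw [hact, abs_of_nonneg (by positivity)]
    refine div_le_div_of_nonneg_left (by positivity) ha ?_
    nlinarith

end Autonomous

/-! ### Translation to the centered case and comparison of the minima -/

section Main

variable {n : ℕ} {S : Set (PhaseSpace n)}

theorem IsGenClosedCharacteristic.intervalIntegrable_deriv (hS : IsCenteredBody S)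
    {γ : ℝ → PhaseSpace n} (hγ : IsGenClosedCharacteristic S γ) :
    IntervalIntegrable (deriv γ) volume 0 (2 * Real.pi) ∧
      ∫ t in (0 : ℝ)..(2 * Real.pi), deriv γ t = 0 := by
  obtain ⟨hcont, hper, -, hfr, ⟨F, hF, hFd⟩, hLR⟩ := hγ
  choose v hv hd using fun t => (hLR t).2.imp fun v hv => hv
  choose ν hν hνeq using hv
  have hvd : v =ᵐ[volume] deriv γ := by
    have hdiff : ∀ᵐ t, DifferentiableAt ℝ γ t :=
      measure_mono_null (fun t ht => by_contra fun htF => ht (hFd t htF)) hF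
    filter_upwards [hdiff] with t ht
    exact (uniqueDiffWithinAt_Ioi t).eq_deriv _ (hd t) ht.hasDerivAt.hasDerivWithinAt
  have hint := intervalIntegrable_deriv_of_genClosedCharacteristic hS hcont
    (fun t => hS.2.1.isClosed.frontier_subset (hfr t)) hvd hν (fun t => (hνeq t).symm) hd
  refine ⟨hint.congr_ae (ae_restrict_of_ae hvd), ?_⟩
  rw [← intervalIntegral.integral_congr_ae (hvd.mono fun t ht _ => ht),
    intervalIntegral.integral_eq_sub_of_hasDeriv_right hcont.continuousOn (fun t _ => hd t) hint,
    ← zero_add (2 * Real.pi), hper 0, sub_self]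

/-- The constant only contributes its pairing with the total displacement, which is zero. -/
theorem loopAction_add_const {γ : ℝ → PhaseSpace n} (hγ : Continuous γ)
    (hint : IntervalIntegrable (deriv γ) volume 0 (2 * Real.pi))
    (h0 : ∫ t in (0 : ℝ)..(2 * Real.pi), deriv γ t = 0) (c : PhaseSpace n) :
    loopAction (fun t => γ t + c) = loopAction γ := by
  have h1 : ∫ t in (0 : ℝ)..(2 * Real.pi), (inner ℝ (stdJ c) (deriv γ t) : ℝ) = 0 := by
    have := integral_inner_const_left hint (stdJ c)
    rw [this, h0, inner_zero_right]
  have i1 := intervalIntegrable_inner_continuousOn (f := fun t => stdJ (γ t))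
    (continuous_stdJ.comp hγ).continuousOn hint
  have i2 := intervalIntegrable_inner_continuousOn
    (continuous_const (y := stdJ c)).continuousOn hint
  rw [loopAction, loopAction]
  simp only [deriv_add_const, stdJ_add, inner_add_left]
  rw [intervalIntegral.integral_add i1 i2, h1, add_zero]

section Translation

/-- The translate `S - c`. -/
def shiftBody (c : PhaseSpace n) (S : Set (PhaseSpace n)) : Set (PhaseSpace n) :=
  (fun x => x + c) ⁻¹' S

theorem shiftBody_neg_shiftBody (c : PhaseSpace n) (S : Set (PhaseSpace n)) :
    shiftBody (-c) (shiftBody c S) = S := by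
  ext x
  simp [shiftBody]

theorem frontier_shiftBody (c : PhaseSpace n) (S : Set (PhaseSpace n)) :
    frontier (shiftBody c S) = shiftBody c (frontier S) :=
  ((Homeomorph.addRight c).preimage_frontier S).symm

theorem interior_shiftBody (c : PhaseSpace n) (S : Set (PhaseSpace n)) :
    interior (shiftBody c S) = shiftBody c (interior S) :=
  ((Homeomorph.addRight c).preimage_interior S).symm

theorem mem_normalCone_shiftBody {c x u : PhaseSpace n} :
    u ∈ normalCone (shiftBody c S) x ↔ u ∈ normalCone S (x + c) := by
  constructor
  · intro h y hy
    have := h (y - c) (by simpa [shiftBody] using hy)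
    rwa [sub_sub_eq_add_sub] at this
  · intro h y hy
    have := h (y + c) hy
    rwa [add_sub_add_right_eq_sub] at this

theorem IsConvexBody.shift (hS : IsConvexBody S) (c : PhaseSpace n) :
    IsConvexBody (shiftBody c S) := by
  refine ⟨hS.1.translate_preimage_left c, (Homeomorph.addRight c).isCompact_preimage.2 hS.2.1, ?_⟩
  rw [interior_shiftBody]
  obtain ⟨x, hx⟩ := hS.2.2
  exact ⟨x - c, by simpa [shiftBody] using hx⟩

theorem IsLocalDefiningFunction.shift {x : PhaseSpace n} {ρ : PhaseSpace n → ℝ}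
    {c : PhaseSpace n} (hρ : IsLocalDefiningFunction S (x + c) ρ) :
    IsLocalDefiningFunction (shiftBody c S) x fun y => ρ (y + c) := by
  obtain ⟨h1, h2, h3, U, hU, hxU, h⟩ := hρ
  refine ⟨h1.comp (contDiff_id.add contDiff_const), h2, ?_, shiftBody c U,
    hU.preimage (by fun_prop), hxU, fun y hy => h _ hy⟩
  rw [fderiv_comp_add_right]
  exact h3

theorem IsSmoothConvexBody.shift (hS : IsSmoothConvexBody S) (c : PhaseSpace n) :
    IsSmoothConvexBody (shiftBody c S) := by
  refine ⟨hS.1.shift c, fun x hx => ?_⟩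
  rw [frontier_shiftBody] at hx
  obtain ⟨ρ, hρ⟩ := hS.2 _ hx
  exact ⟨_, hρ.shift⟩

theorem IsClosedCharacteristic.shift (hS : IsSmoothConvexBody S) {γ : ℝ → PhaseSpace n}
    (hγ : IsClosedCharacteristic S γ) (c : PhaseSpace n) :
    IsClosedCharacteristic (shiftBody c S) fun t => γ t + -c := by
  obtain ⟨hsm, hper, hinj, h⟩ := hγ
  refine ⟨hsm.add contDiff_const, fun t => by simp only [hper t],
    fun s hs t ht hst => hinj hs ht (add_right_cancel hst), fun t => ?_⟩
  obtain ⟨h1, h2, h3⟩ := h t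
  have hx : γ t + -c + c = γ t := neg_add_cancel_right _ _
  rw [deriv_add_const]
  refine ⟨h1, ?_, ?_⟩
  · rw [frontier_shiftBody]
    change γ t + -c + c ∈ frontier S
    rwa [hx]
  · obtain ⟨ρ, hρ⟩ := hS.2 _ h2
    have hρ' : IsLocalDefiningFunction (shiftBody c S) (γ t + -c) fun y => ρ (y + c) :=
      IsLocalDefiningFunction.shift (by rwa [hx])
    rw [hρ'.mem_characteristicLine_iff (hS.shift c).1.1, gradient, fderiv_comp_add_right, hx]
    exact (hρ.mem_characteristicLine_iff hS.1.1).1 h3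

theorem IsGenClosedCharacteristic.shift {γ : ℝ → PhaseSpace n}
    (hγ : IsGenClosedCharacteristic S γ) (c : PhaseSpace n) :
    IsGenClosedCharacteristic (shiftBody c S) fun t => γ t + -c := by
  obtain ⟨hcont, hper, ⟨s, t, hst⟩, hfr, ⟨F, hF, hFd⟩, hLR⟩ := hγ
  have hN : ∀ t, normalCone (shiftBody c S) (γ t + -c) = normalCone S (γ t) := fun t => by
    ext u
    rw [mem_normalCone_shiftBody, neg_add_cancel_right]
  refine ⟨hcont.add continuous_const, fun t => by simp only [hper t],
    ⟨s, t, fun h => hst (add_right_cancel h)⟩, fun t => ?_,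
    ⟨F, hF, fun t ht => (hFd t ht).add_const _⟩, fun t => ?_⟩
  · rw [frontier_shiftBody]
    change γ t + -c + c ∈ frontier S
    rw [neg_add_cancel_right]
    exact hfr t
  · rw [hN]
    obtain ⟨⟨v, hv, hdv⟩, ⟨w, hw, hdw⟩⟩ := hLR t
    exact ⟨⟨v, hv, hdv.add_const _⟩, ⟨w, hw, hdw.add_const _⟩⟩

theorem cEHZExt_shiftBody_le (c : PhaseSpace n) (S : Set (PhaseSpace n)) :
    cEHZExt (shiftBody c S) ≤ cEHZExt S := by
  refine le_iInf₂ fun S' hS' => ?_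
  refine (iInf₂_le (shiftBody c S') ⟨hS'.1.shift c, preimage_mono hS'.2⟩).trans ?_
  refine le_iInf₂ fun b hb => ?_
  obtain ⟨γ, hγ, rfl⟩ := hb
  refine (iInf₂_le _ ⟨_, hγ.shift hS'.1 c, rfl⟩).trans (le_of_eq ?_)
  have hsm := hγ.1
  have hint := (hsm.continuous_deriv (by simp)).intervalIntegrable (μ := volume) 0 (2 * Real.pi)
  rw [loopAction_add_const hsm.continuous hint]
  rw [intervalIntegral.integral_deriv_eq_sub
    (fun t _ => (hsm.differentiable (by simp)).differentiableAt) hint,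
    ← zero_add (2 * Real.pi), hγ.2.1 0, sub_self]

theorem cEHZExt_shiftBody (c : PhaseSpace n) (S : Set (PhaseSpace n)) :
    cEHZExt (shiftBody c S) = cEHZExt S := by
  refine le_antisymm (cEHZExt_shiftBody_le c S) ?_
  conv_lhs => rw [← shiftBody_neg_shiftBody c S]
  exact cEHZExt_shiftBody_le _ _

/-- Invariance of the action needs integrable velocities, which are known on the centered translate;
both inclusions establish them there. -/
theorem genActionSpectrum_shiftBody {c : PhaseSpace n} (hS : IsCenteredBody (shiftBody c S)) :
    genActionSpectrum (shiftBody c S) = genActionSpectrum S := by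
  ext b
  constructor
  · rintro ⟨γ, hγ, rfl⟩
    obtain ⟨h1, h2⟩ := hγ.intervalIntegrable_deriv hS
    have := hγ.shift (-c)
    rw [shiftBody_neg_shiftBody] at this
    exact ⟨_, this, by rw [loopAction_add_const hγ.1 h1 h2]⟩
  · rintro ⟨γ, hγ, rfl⟩
    have hγ' := hγ.shift c
    obtain ⟨h1, h2⟩ := hγ'.intervalIntegrable_deriv hS
    refine ⟨_, hγ', ?_⟩
    have h3 := loopAction_add_const hγ'.1 h1 h2 c
    simp only [neg_add_cancel_right] at h3
    exact congrArg abs h3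

end Translation

theorem isLeast_genActionSpectrum (hn : 1 ≤ n) (hS : IsCenteredBody S) {a : ℝ} (ha0 : 0 < a)
    (ha : IsGreatest (loopAction '' unitSpeedLoops S) a) :
    IsLeast (genActionSpectrum S) (Real.pi ^ 2 / a) := by
  refine ⟨?_, ?_⟩
  · obtain ⟨γ, hγ⟩ := exists_isWeakCharacteristic hn hS ha
    obtain ⟨η, hη, hact⟩ := hγ.exists_isGenClosedCharacteristic ha0
    exact ⟨η, hη, by rw [hact, abs_of_pos (by positivity)]⟩
  · rintro _ ⟨γ, hγ, rfl⟩
    exact (genClosedCharacteristic_lower_bound hS ha0 ha.2 hγ).trans (le_abs_self _)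

/-- A larger body admits fewer unit speed loops, so the same `a` bounds their actions, and the lower
bound for characteristics applies on every smooth competitor. -/
theorem le_cEHZExt (hS : IsCenteredBody S) {a : ℝ} (ha0 : 0 < a)
    (ha : a ∈ upperBounds (loopAction '' unitSpeedLoops S)) :
    ENNReal.ofReal (Real.pi ^ 2 / a) ≤ cEHZExt S := by
  refine le_iInf₂ fun S' hS' => le_iInf₂ fun b hb => ?_
  obtain ⟨γ, hγ, rfl⟩ := hb
  have h0 : (0 : PhaseSpace n) ∈ interior S' := interior_mono hS'.2 hS.2.2
  have hcb : IsCenteredBody S' := ⟨hS'.1.1.1, hS'.1.1.2.1, h0⟩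
  obtain ⟨η, hη, hact⟩ := hγ.exists_isGenClosedCharacteristic hS'.1 h0
  rw [← hact]
  have ha' : a ∈ upperBounds (loopAction '' unitSpeedLoops S') := fun x hx =>
    ha (image_mono (unitSpeedLoops_anti ⟨0, hS.zero_mem⟩ hcb.2.1 hS'.2) hx)
  exact ENNReal.ofReal_le_ofReal
    ((genClosedCharacteristic_lower_bound hcb ha0 ha' hη).trans (le_abs_self _))

/-- On a smooth body between `S` and its dilate by `lam`, the maximal action is at least `lam⁻² a`,
and its weak characteristic covers an embedded one. -/
theorem cEHZExt_le_of_one_lt (hn : 1 ≤ n) (hS : IsCenteredBody S) {a : ℝ} (ha0 : 0 < a)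
    (ha : IsGreatest (loopAction '' unitSpeedLoops S) a) {lam : ℝ} (hl : 1 < lam) :
    cEHZExt S ≤ ENNReal.ofReal (lam ^ 2 * (Real.pi ^ 2 / a)) := by
  have hl0 : 0 < lam := one_pos.trans hl
  obtain ⟨G, c, hG, hconv, h0, hSG, hGS⟩ := exists_smooth_convexOn_of_isCenteredBody hS hl
  have hb : Bornology.IsBounded {y | G y ≤ c} := by
    obtain ⟨R, hR, hRS⟩ := hS.exists_norm_le
    refine isBounded_iff_forall_norm_le.2 ⟨lam * R, fun y hy => ?_⟩
    have := hRS _ (hGS y hy)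
    rwa [norm_smul, norm_inv, Real.norm_of_nonneg hl0.le, inv_mul_le_iff₀ hl0] at this
  have hcb := isCenteredBody_sublevel hG hconv h0 hb
  obtain ⟨a', ha'⟩ := hcb.exists_isGreatest_loopAction
  have haa' : lam⁻¹ ^ 2 * a ≤ a' := by
    obtain ⟨Γ, hΓ, rfl⟩ := ha.1
    rw [← loopAction_smul]
    exact ha'.2 ⟨_, smul_mem_unitSpeedLoops hS hcb hGS hΓ, rfl⟩
  have ha'0 : 0 < a' := lt_of_lt_of_le (by positivity) haa'
  obtain ⟨γ, hγ⟩ := exists_isWeakCharacteristic hn hcb ha'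
  obtain ⟨η, hη, hact⟩ := hγ.exists_isClosedCharacteristic hG hconv h0 hb ha'0
  refine (iInf₂_le {y | G y ≤ c} ⟨isSmoothConvexBody_sublevel hG hconv h0 hb, hSG⟩).trans ?_
  refine (iInf₂_le _ ⟨η, hη, rfl⟩).trans (ENNReal.ofReal_le_ofReal (hact.trans ?_))
  calc Real.pi ^ 2 / a' ≤ Real.pi ^ 2 / (lam⁻¹ ^ 2 * a) :=
        div_le_div_of_nonneg_left (by positivity) (by positivity) haa'
    _ = lam ^ 2 * (Real.pi ^ 2 / a) := by field_simp

theorem cEHZExt_eq (hn : 1 ≤ n) (hS : IsCenteredBody S) {a : ℝ} (ha0 : 0 < a)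
    (ha : IsGreatest (loopAction '' unitSpeedLoops S) a) :
    cEHZExt S = ENNReal.ofReal (Real.pi ^ 2 / a) := by
  refine le_antisymm ?_ (le_cEHZExt hS ha0 ha.2)
  have hlim : Filter.Tendsto (fun lam : ℝ => ENNReal.ofReal (lam ^ 2 * (Real.pi ^ 2 / a)))
      (nhdsWithin 1 (Ioi 1)) (nhds (ENNReal.ofReal (Real.pi ^ 2 / a))) := by
    have hc : Continuous fun lam : ℝ => ENNReal.ofReal (lam ^ 2 * (Real.pi ^ 2 / a)) :=
      ENNReal.continuous_ofReal.comp (by fun_prop)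
    have := hc.tendsto 1
    rw [one_pow, one_mul] at this
    exact this.mono_left nhdsWithin_le_nhds
  refine ge_of_tendsto hlim ?_
  filter_upwards [self_mem_nhdsWithin] with lam hl
  exact cEHZExt_le_of_one_lt hn hS ha0 ha hl

theorem exists_pos_isGreatest_loopAction (hn : 1 ≤ n) (hS : IsCenteredBody S) :
    ∃ a, 0 < a ∧ IsGreatest (loopAction '' unitSpeedLoops S) a := by
  obtain ⟨a, ha⟩ := hS.exists_isGreatest_loopAction
  obtain ⟨Γ, hΓ, hpos⟩ := hS.exists_loopAction_pos hn
  exact ⟨a, hpos.trans_le (ha.2 ⟨Γ, hΓ, rfl⟩), ha⟩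

end Main

theorem mainTheorem6 (n : ℕ) (hn : 1 ≤ n) (S : Set (PhaseSpace n)) (hS : IsConvexBody S) :
    ∃ m : ℝ, cEHZExt S = ENNReal.ofReal m ∧
      ((0 : PhaseSpace n) ∈ interior S →
        IsLeast ((fun z => Real.pi / 2 * dualFunctional S z) '' loopSpace n) m) ∧
      IsLeast (genActionSpectrum S) m := by
  by_cases h0 : (0 : PhaseSpace n) ∈ interior S
  · have hcb : IsCenteredBody S := ⟨hS.1, hS.2.1, h0⟩
    obtain ⟨a, ha0, ha⟩ := exists_pos_isGreatest_loopAction hn hcb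
    exact ⟨Real.pi ^ 2 / a, cEHZExt_eq hn hcb ha0 ha, fun _ => isLeast_dualFunctional hcb ha0 ha,
      isLeast_genActionSpectrum hn hcb ha0 ha⟩
  -- Otherwise move an interior point to the origin; the capacity and the spectrum are translation
  -- invariant, and the clause on the dual functional is vacuous.
  · obtain ⟨c, hc⟩ := hS.2.2
    have hT := hS.shift c
    have hcb : IsCenteredBody (shiftBody c S) := ⟨hT.1, hT.2.1, by
      rw [interior_shiftBody]
      simpa [shiftBody] using hc⟩
    obtain ⟨a, ha0, ha⟩ := exists_pos_isGreatest_loopAction hn hcb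
    refine ⟨Real.pi ^ 2 / a, ?_, fun h => absurd h h0, ?_⟩
    · rw [← cEHZExt_shiftBody c S]
      exact cEHZExt_eq hn hcb ha0 ha
    · rw [← genActionSpectrum_shiftBody hcb]
      exact isLeast_genActionSpectrum hn hcb ha0 ha
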